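/- Let $N\in\mathbb N$, $T>0$, $p\in(1,\infty)$, and let $Q,Q',R:[0,T]\to\mathbb R^{N\times N}$ be continuous, with $Q(t)$ and $Q'(t)$ symmetric and non-negative definite for every $t$. Let $g:[0,T]\to[0,\infty)$ be bounded and Borel, put $\mathfrak m(dt,dx)=g(t)\,dt\,dx$ on $(0,T)\times\mathbb R^N$, and let $|\cdot|$ be a norm (or just a seminorm) on $\mathbb R^{N\times N}$. Let $B_b(0,T;C_0^\infty(\mathbb R^N))$ be the space of bounded Borel functions $f:[0,T]\times\mathbb R^N\to\mathbb R$ such that every $f(t,\cdot)$ is smooth, the space derivatives of $f$ of each order are bounded uniformly in $(t,z)$, the supports of all $f(t,\cdot)$ lie in one ball, and for each $z$ the map $t\mapsto f(t,z)$ is continuous on $[0,T]$ except at finitely many points. For a continuous symmetric non-negative definite $A:[0,T]\to\mathbb R^{N\times N}$ and $f\in B_b(0,T;C_0^\infty(\mathbb R^N))$, a solution of $$\partial_t u=\mathrm{Tr}(A(t)D^2u)+f\ \text{ on }(0,T)\times\mathbb R^N,\qquad u(0,\cdot)=0,$$ is a bounded continuous $u:[0,T]\times\mathbb R^N\to\mathbb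 R$ with $u(t,\cdot)\in C^2(\mathbb R^N)$ for all $t\in[0,T]$ such that, for all $(t,z)\in[0,T]\times\mathbb R^N$, the function $s\mapsto f(s,z)+\mathrm{Tr}(A(s)D^2u(s,z))$ is integrable on $[0,T]$ and $$u(t,z)=\int_0^t\Big(f(s,z)+\mathrm{Tr}\big(A(s)D^2u(s,z)\big)\Big)\,ds .$$ **Theorem.** Let $C_p>0$ be such that for every $f\in B_b(0,T;C_0^\infty(\mathbb R^N))$ the solution $v$ of $\partial_t v=\mathrm{Tr}(Q(t)D^2v)+f$, $v(0,\cdot)=0$, satisfies $$\|R(t)^*D^2v\,R(t)\|_{L^p((0,T)\times\mathbb R^N,\mathfrak m)}\le C_p\,\|f\|_{L^p((0,T)\times\mathbb R^N,\mathfrak m)} .$$ Then for every $f\in B_b(0,T;C_0^\infty(\mathbb R^N))$ the problem $\partial_t w=\mathrm{Tr}\big((Q(t)+Q'(t))D^2w\big)+f$, $w(0,\cdot)=0$, has a unique solution $w$, and it satisfies, with the same constant $C_p$, $$\|R(t)^*D^2w\,R(t)\|_{L^p((0,T)\times\mathbb R^N,\mathfrak m)}\le C_p\,\|f\|_{L^p((0,T)\times\mathbb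 R^N,\mathfrak m)} .$$ -/

import Mathlib

open Set MeasureTheory
open scoped ContDiff

noncomputable section

/-- The space `ℝ^N` with its Euclidean norm. -/
abbrev RN (N : ℕ) : Type := EuclideanSpace ℝ (Fin N)

/-- The Hessian matrix `D² u (z)` in the canonical basis. -/
def hessianMatrix {N : ℕ} (u : RN N → ℝ) (z : RN N) : Matrix (Fin N) (Fin N) ℝ :=
  Matrix.of fun i j =>
    fderiv ℝ (fderiv ℝ u) z (EuclideanSpace.single i 1) (EuclideanSpace.single j 1)

/-- The class `B_b(0, T; C_0^∞(ℝ^N))` of sources on `[0, T] × ℝ^N`; values at times outside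
`[0, T]` play no role. -/
structure MemBb {N : ℕ} (T : ℝ) (f : ℝ → RN N → ℝ) : Prop where
  /-- `f` is Borel on `[0, T] × ℝ^N`. -/
  borel : Measurable fun q : Icc (0 : ℝ) T × RN N => f q.1 q.2
  /-- Each `f(t, ·)` is smooth. -/
  smooth : ∀ t ∈ Icc (0 : ℝ) T, ContDiff ℝ ∞ (f t)
  /-- All space derivatives, including `f` itself, are bounded uniformly in time. -/
  bounded : ∀ n : ℕ, ∃ M : ℝ, ∀ t ∈ Icc (0 : ℝ) T, ∀ z, ‖iteratedFDeriv ℝ n (f t) z‖ ≤ M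
  /-- The supports lie in one and the same ball. -/
  support : ∃ r : ℝ, ∀ t ∈ Icc (0 : ℝ) T, tsupport (f t) ⊆ Metric.closedBall 0 r
  /-- For fixed `z`, the map `t ↦ f(t, z)` is continuous on `[0, T]` except at finitely many
  points. -/
  piecewise : ∀ z, ∃ F : Finset ℝ, ∀ t ∈ Icc (0 : ℝ) T \ (F : Set ℝ),
    ContinuousWithinAt (fun s => f s z) (Icc (0 : ℝ) T) t

/-- `v` is a solution, in integral form, of `∂_t v = Tr(Q(t) D² v) + f` on `(0, T) × ℝ^N` with
`v(0, ·) = 0`: it is continuous and bounded on `[0, T] × ℝ^N`, of class `C²` in space, and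
`v(t, z) = ∫_0^t (f(s, z) + Tr(Q(s) D² v(s, z))) ds`, the integrand being integrable. -/
structure IsSolution {N : ℕ} (T : ℝ) (Q : ℝ → Matrix (Fin N) (Fin N) ℝ) (f v : ℝ → RN N → ℝ) :
    Prop where
  continuous : ContinuousOn (fun q : ℝ × RN N => v q.1 q.2) (Icc (0 : ℝ) T ×ˢ univ)
  bounded : ∃ M : ℝ, ∀ t ∈ Icc (0 : ℝ) T, ∀ z, |v t z| ≤ M
  contDiff : ∀ t ∈ Icc (0 : ℝ) T, ContDiff ℝ 2 (v t)
  integrable : ∀ z, IntervalIntegrable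
    (fun s => f s z + (Q s * hessianMatrix (v s) z).trace) volume 0 T
  integral_eq : ∀ t ∈ Icc (0 : ℝ) T, ∀ z,
    v t z = ∫ s in (0 : ℝ)..t, (f s z + (Q s * hessianMatrix (v s) z).trace)

/-- The measure `𝔪(dt, dx) = g(t) dt dx` on `(0, T) × ℝ^N`. -/
def weightedMeasure (N : ℕ) (T : ℝ) (g : ℝ → ℝ) : Measure (ℝ × RN N) :=
  (((volume : Measure ℝ).restrict (Ioo 0 T)).prod (volume : Measure (RN N))).withDensity
    fun q => ENNReal.ofReal (g q.1)

/-- The estimate `‖R(t)* D² v R(t)‖_{L^p(𝔪)} ≤ C ‖f‖_{L^p(𝔪)}` on `(0, T) × ℝ^N`, where the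
size of a matrix is measured by `ν`. -/
def HessianEstimate {N : ℕ} (T : ℝ) (ν : Seminorm ℝ (Matrix (Fin N) (Fin N) ℝ))
    (R : ℝ → Matrix (Fin N) (Fin N) ℝ) (g : ℝ → ℝ) (p C : ℝ) (f v : ℝ → RN N → ℝ) : Prop :=
  eLpNorm (fun q : ℝ × RN N => ν ((R q.1).transpose * hessianMatrix (v q.1) q.2 * R q.1))
      (ENNReal.ofReal p) (weightedMeasure N T g) ≤
    ENNReal.ofReal C *
      eLpNorm (fun q : ℝ × RN N => f q.1 q.2) (ENNReal.ofReal p) (weightedMeasure N T g)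

end

/-! ### Second-order maximum principle and a quadratic barrier. -/

section Hessian

variable {N : ℕ}

/-! On the Fourier side the solution with diffusion Q superposes the values f̂(r, ξ), r ≤ t, with
symbol exp(-∫_r^t 4π² ξ·Qξ ds). Adding Q' multiplies this symbol by exp(-∫_r^t 4π² ξ·Q'ξ ds), the
characteristic function of an increment of a Gaussian process. For a fixed path b, translating the
source by b(s), solving with Q and translating the solution back by b(t) multiplies the symbol by
the plane wave exp(-2πi ξ·(b(t) - b(r))). The density of 𝔪 and the matrix R depend on time only, so
both translations preserve the L^p norms and the constant survives; averaging over paths keeps it by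
Minkowski's inequality.

No stochastic calculus is needed. A path with one jump ±β at a fixed time gives the factor cos(2π
ξ·β) (`hessAmp_mul_jumpFactor`, `SymbolEstimate.mul_jumpFactor`), and the shifted source is still
continuous in time off finitely many points. Products of such cosines over a fine time grid converge
to the Gaussian factor as in the central limit theorem (`exists_tendsto_jumpProduct`), and Fatou's
lemma carries the estimate to the limit (`SymbolEstimate.gaussSymbol_add`). Existence comes from the
same Fourier formula and Duhamel's identity (`isSolution_superpose_gaussSymbol`).

Uniqueness (`eq_zero_of_integral_eq`) is delicate: D²u is not assumed bounded or continuous in time,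
so Fubini cannot be used directly to test the integral equation against functions of x. The weak
equation is reached by a Baire argument (`eq_of_closed_cover`). The times at which the second
differences on a ball are bounded by n form closed sets covering [0, T], so a portion of the set of
bad times lies in one of them. On that portion Fubini applies. Across its gaps the weak equation is
already known, and a barrier for the mollified function bounds increments by the gap length
(`abs_sub_le_of_weakDefect_eq`), so the sum over gaps may be integrated term by term
(`weakDefect_eq_of_gapSet`). Once the weak equation holds on [0, T], the same barrier with zero
initial data and radius tending to infinity forces the solution to vanish. -/

lemma euclideanSpace_eq_sum_single (k : RN N) :
    k = ∑ i, k i • (EuclideanSpace.single i (1 : ℝ) : RN N) := by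
  conv_lhs => rw [← (EuclideanSpace.basisFun (Fin N) ℝ).sum_repr k]
  simp

lemma bilin_eq_dotProduct_mulVec (B : RN N →L[ℝ] RN N →L[ℝ] ℝ) (k : RN N) :
    B k k = (k : Fin N → ℝ) ⬝ᵥ ((Matrix.of fun i j =>
      B (EuclideanSpace.single i 1) (EuclideanSpace.single j 1)).mulVec (k : Fin N → ℝ)) := by
  conv_lhs => rw [euclideanSpace_eq_sum_single k]
  simp only [map_sum, map_smul, _root_.sum_apply, _root_.smul_apply,
    smul_eq_mul, dotProduct, Matrix.mulVec, Matrix.of_apply, Finset.mul_sum]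
  rw [Finset.sum_comm]
  refine Finset.sum_congr rfl fun i _ => Finset.sum_congr rfl fun j _ => by ring

lemma Matrix.PosSemidef.exists_eq_transpose_mul {P : Matrix (Fin N) (Fin N) ℝ}
    (hP : P.PosSemidef) : ∃ B : Matrix (Fin N) (Fin N) ℝ, P = B.transpose * B := by
  open scoped MatrixOrder Matrix.Norms.L2Operator in
  obtain ⟨B, rfl⟩ := CStarAlgebra.nonneg_iff_eq_star_mul_self.mp hP.nonneg
  exact ⟨B, by simp [Matrix.star_eq_conjTranspose]⟩

/-- Factoring P = BᵀB turns both traces into sums of quadratic forms over the rows of B, to which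
the hypothesis applies one row at a time. Symmetry of H plays no role. -/
lemma trace_mul_le_of_quadratic_le {P H : Matrix (Fin N) (Fin N) ℝ} (hP : P.PosSemidef) {c : ℝ}
    (hH : ∀ k : Fin N → ℝ, k ⬝ᵥ H.mulVec k ≤ c * (k ⬝ᵥ k)) : (P * H).trace ≤ c * P.trace := by
  obtain ⟨B, rfl⟩ := hP.exists_eq_transpose_mul
  have h1 : (B.transpose * B * H).trace = ∑ l, (B l) ⬝ᵥ H.mulVec (B l) := by
    rw [Matrix.mul_assoc, Matrix.trace_mul_comm]
    simp only [Matrix.trace, Matrix.diag, Matrix.mul_apply, Matrix.transpose_apply, dotProduct,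
      Matrix.mulVec, Finset.sum_mul, Finset.mul_sum]
    refine Finset.sum_congr rfl fun i _ => ?_
    rw [Finset.sum_comm]
    exact Finset.sum_congr rfl fun i _ => Finset.sum_congr rfl fun j _ => by ring
  have h2 : (B.transpose * B).trace = ∑ l, (B l) ⬝ᵥ (B l) := by
    rw [Matrix.trace_mul_comm]
    simp [Matrix.trace, Matrix.mul_apply, dotProduct]
  rw [h1, h2, Finset.mul_sum]
  exact Finset.sum_le_sum fun l _ => hH _

/-- A positive second derivative would make the maximum also a local minimum, hence f locally
constant and its second derivative zero. -/
lemma deriv_deriv_nonpos_of_isLocalMax {f : ℝ → ℝ} {x : ℝ} (hc : ContinuousAt f x)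
    (h : IsLocalMax f x) : deriv (deriv f) x ≤ 0 := by
  by_contra! hpos
  have hmin := isLocalMin_of_deriv_deriv_pos hpos h.deriv_eq_zero hc
  have hconst : f =ᶠ[nhds x] fun _ => f x := by
    filter_upwards [h, hmin] with y h1 h2 using le_antisymm h1 h2
  have : deriv f =ᶠ[nhds x] fun _ => 0 := by
    simpa using hconst.deriv
  rw [this.deriv_eq] at hpos
  simp at hpos

lemma deriv_deriv_line {u : RN N → ℝ} (hu : ContDiff ℝ 2 u) (z k : RN N) :
    deriv (deriv fun τ : ℝ => u (z + τ • k)) 0 = fderiv ℝ (fderiv ℝ u) z k k := by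
  have hline : ∀ τ : ℝ, HasDerivAt (fun τ : ℝ => z + τ • k) k τ := fun τ => by
    simpa using ((hasDerivAt_id τ).smul_const k).const_add z
  have h1 : deriv (fun τ : ℝ => u (z + τ • k)) = fun τ => fderiv ℝ u (z + τ • k) k := by
    funext τ
    exact (((hu.differentiable (by simp)) _).hasFDerivAt.comp_hasDerivAt τ (hline τ)).deriv
  rw [h1]
  have hd : Differentiable ℝ (fderiv ℝ u) :=
    (hu.fderiv_right (m := 1) (by norm_num)).differentiable (by simp)
  have h2 : HasDerivAt (fun τ : ℝ => fderiv ℝ u (z + τ • k))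
      (fderiv ℝ (fderiv ℝ u) (z + (0 : ℝ) • k) k) 0 :=
    (hd _).hasFDerivAt.comp_hasDerivAt 0 (hline 0)
  have h3 := h2.clm_apply (hasDerivAt_const (0 : ℝ) k)
  simpa using h3.deriv

/-- On every line through z the penalized function has a local maximum at parameter zero, where the
penalty contributes 2K‖k‖² to the second derivative. -/
lemma hessianMatrix_quadratic_le_of_isLocalMax {u : RN N → ℝ} (hu : ContDiff ℝ 2 u) {K : ℝ}
    {z : RN N} (h : IsLocalMax (fun x => u x - K * ‖x‖ ^ 2) z) (k : Fin N → ℝ) :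
    k ⬝ᵥ (hessianMatrix u z).mulVec k ≤ 2 * K * (k ⬝ᵥ k) := by
  set k' : RN N := WithLp.toLp 2 k with hk'
  have hq : k ⬝ᵥ (hessianMatrix u z).mulVec k = fderiv ℝ (fderiv ℝ u) z k' k' :=
    (bilin_eq_dotProduct_mulVec (fderiv ℝ (fderiv ℝ u) z) k').symm
  have hkk : k ⬝ᵥ k = ‖k'‖ ^ 2 := by
    rw [EuclideanSpace.norm_sq_eq]; simp [dotProduct, sq, hk']
  have hv : ContDiff ℝ 2 fun τ : ℝ => u (z + τ • k') := by fun_prop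
  have hw : ContDiff ℝ 2 fun τ : ℝ => K * ‖z + τ • k'‖ ^ 2 := by
    have : ContDiff ℝ 2 fun τ : ℝ => ‖z + τ • k'‖ ^ 2 := ContDiff.norm_sq ℝ (by fun_prop)
    fun_prop
  have hnorm : ∀ τ : ℝ, K * ‖z + τ • k'‖ ^ 2
      = K * ‖z‖ ^ 2 + τ * (2 * K * inner ℝ z k') + τ ^ 2 * (K * ‖k'‖ ^ 2) := fun τ => by
    rw [norm_add_sq_real, inner_smul_right, norm_smul, mul_pow, Real.norm_eq_abs, sq_abs]; ring
  have hmax : IsLocalMax (fun τ : ℝ => u (z + τ • k') - K * ‖z + τ • k'‖ ^ 2) 0 := by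
    have hc : Filter.Tendsto (fun τ : ℝ => z + τ • k') (nhds 0) (nhds z) := by
      have : Continuous fun τ : ℝ => z + τ • k' := by fun_prop
      simpa using this.tendsto 0
    have := hc.eventually h
    filter_upwards [this] with τ hτ
    simpa using hτ
  have hle := deriv_deriv_nonpos_of_isLocalMax
    (f := fun τ : ℝ => u (z + τ • k') - K * ‖z + τ • k'‖ ^ 2) (hv.continuous.sub hw.continuous).continuousAt hmax
  have hd1 : deriv (fun τ : ℝ => u (z + τ • k') - K * ‖z + τ • k'‖ ^ 2)
      = fun τ => deriv (fun τ : ℝ => u (z + τ • k')) τ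
        - (2 * K * inner ℝ z k' + 2 * τ * (K * ‖k'‖ ^ 2)) := by
    funext τ
    have e : (fun τ : ℝ => K * ‖z + τ • k'‖ ^ 2) = fun τ =>
      K * ‖z‖ ^ 2 + τ * (2 * K * inner ℝ z k') + τ ^ 2 * (K * ‖k'‖ ^ 2) := funext hnorm
    have h2 : HasDerivAt (fun τ : ℝ => K * ‖z + τ • k'‖ ^ 2)
        (2 * K * inner ℝ z k' + 2 * τ * (K * ‖k'‖ ^ 2)) τ := by
      rw [e]
      have := (((hasDerivAt_id τ).mul_const (2 * K * inner ℝ z k')).const_add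
        (K * ‖z‖ ^ 2)).fun_add (((hasDerivAt_id τ).pow 2).mul_const (K * ‖k'‖ ^ 2))
      simpa using this
    exact ((hv.differentiable (by simp) τ).hasDerivAt.sub h2).deriv
  rw [hd1] at hle
  have hv' : Differentiable ℝ (deriv fun τ : ℝ => u (z + τ • k')) := by
    have h2 : ContDiff ℝ (1 + 1) fun τ : ℝ => u (z + τ • k') := by simpa [one_add_one_eq_two] using hv
    exact (contDiff_succ_iff_deriv.1 h2).2.2.differentiable (by simp)
  have h3 : HasDerivAt (fun τ : ℝ => 2 * K * inner ℝ z k' + 2 * τ * (K * ‖k'‖ ^ 2))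
      (2 * (K * ‖k'‖ ^ 2)) 0 := by
    have := (((hasDerivAt_id (0 : ℝ)).const_mul 2).mul_const (K * ‖k'‖ ^ 2)).const_add
      (2 * K * inner ℝ z k')
    simpa using this
  have h4 := ((hv' 0).hasDerivAt.sub h3).deriv
  have h5 : deriv (fun τ => deriv (fun τ : ℝ => u (z + τ • k')) τ
        - (2 * K * inner ℝ z k' + 2 * τ * (K * ‖k'‖ ^ 2))) 0 =
        fderiv ℝ (fderiv ℝ u) z k' k' - 2 * (K * ‖k'‖ ^ 2) := by
    rw [← deriv_deriv_line hu z k']; exact h4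
  rw [h5] at hle
  rw [hq, hkk]; linarith

/-- Comparison with the barrier `K |k|² + 2 K α (t - a)` on a cylinder. -/
lemma parabolic_barrier {A : ℝ → Matrix (Fin N) (Fin N) ℝ} {e : ℝ → RN N → ℝ} {q : ℝ → RN N → ℝ}
    {a b κ K α : ℝ} (hab : a ≤ b) (hκ : 0 < κ) (hK : 0 ≤ K)
    (hA : ∀ t, (A t).PosSemidef) (hα : ∀ t, (A t).trace ≤ α)
    (he : Continuous fun x : ℝ × RN N => e x.1 x.2) (he2 : ∀ t, ContDiff ℝ 2 (e t))
    (hq : ∀ k, Continuous fun t => q t k)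
    (hqe : ∀ t k, q t k = (A t * hessianMatrix (e t) k).trace)
    (hint : ∀ s ∈ Icc a b, ∀ t ∈ Icc a b, ∀ k : RN N, ‖k‖ < κ → e t k - e s k = ∫ r in s..t, q r k)
    (h0 : ∀ k : RN N, ‖k‖ ≤ κ → e a k ≤ K * ‖k‖ ^ 2)
    (h1 : ∀ t ∈ Icc a b, ∀ k : RN N, ‖k‖ = κ → e t k ≤ K * κ ^ 2) :
    e b 0 ≤ 2 * K * α * (b - a) := by
  refine le_of_forall_pos_le_add fun ε hε => ?_
  -- The extra slope η makes the barrier a strict supersolution at total cost at most ε; the summand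
  -- 1 keeps the denominator positive when a = b.
  set η : ℝ := ε / (b - a + 1) with hη
  have hb1 : 0 < b - a + 1 := by linarith
  have hηpos : 0 < η := by positivity
  have hηle : η * (b - a) ≤ ε := by
    rw [hη, div_mul_eq_mul_div, div_le_iff₀ hb1]; nlinarith
  set ψ : ℝ × RN N → ℝ := fun x => e x.1 x.2 - (K * ‖x.2‖ ^ 2 + (2 * K * α + η) * (x.1 - a)) with hψ
  have hψc : Continuous ψ := by fun_prop
  have hcomp : IsCompact (Icc a b ×ˢ Metric.closedBall (0 : RN N) κ) :=
    isCompact_Icc.prod (isCompact_closedBall _ _)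
  obtain ⟨⟨t0, k0⟩, hmem, hmax⟩ := hcomp.exists_isMaxOn
    ⟨(b, 0), ⟨right_mem_Icc.2 hab, by simp [hκ.le]⟩⟩ hψc.continuousOn
  have hbmax : ψ (b, 0) ≤ ψ (t0, k0) :=
    hmax ⟨right_mem_Icc.2 hab, by simp [hκ.le]⟩
  have hk0 : ‖k0‖ ≤ κ := by simpa using hmem.2
  by_cases hneg : ψ (t0, k0) ≤ 0
  · have : ψ (b, 0) ≤ 0 := hbmax.trans hneg
    simp only [hψ, norm_zero] at this
    nlinarith
  -- A positive maximum lies neither at the initial time nor on the lateral boundary. It may lie at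
  -- the final time, so the contradiction is sought backward in time.
  exfalso
  push Not at hneg
  have htr : ∀ t, 0 ≤ (A t).trace := fun t => (hA t).trace_nonneg
  have hα0 : 0 ≤ α := (htr a).trans (hα a)
  have ht0 : a < t0 := by
    rcases hmem.1.1.eq_or_lt with h | h
    · have := h0 k0 hk0
      have h' : t0 = a := h.symm
      simp only [hψ, h'] at hneg
      nlinarith
    · exact h
  have hk0' : ‖k0‖ < κ := by
    rcases hk0.eq_or_lt with h | h
    · have := h1 t0 hmem.1 k0 h
      simp only [hψ, h] at hneg
      have : 0 ≤ (2 * K * α + η) * (t0 - a) := by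
        have : 0 ≤ t0 - a := by linarith
        positivity
      linarith
    · exact h
  have hloc : IsLocalMax (fun x => e t0 x - K * ‖x‖ ^ 2) k0 := by
    have : Metric.ball (0 : RN N) κ ∈ nhds k0 := Metric.isOpen_ball.mem_nhds (by simpa using hk0')
    filter_upwards [this] with k hk
    have := hmax (show (t0, k) ∈ _ from ⟨hmem.1, Metric.ball_subset_closedBall hk⟩)
    simp only [hψ, mem_ofPred_eq] at this
    linarith
  have hqle : q t0 k0 ≤ 2 * K * α := by
    rw [hqe]
    refine (trace_mul_le_of_quadratic_le (hA t0)
      (hessianMatrix_quadratic_le_of_isLocalMax (he2 t0) hloc)).trans ?_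
    have := hα t0
    gcongr
  have hev : ∀ᶠ r in nhds t0, q r k0 < 2 * K * α + η :=
    (hq k0).continuousAt.eventually (gt_mem_nhds (by linarith))
  obtain ⟨δ, hδ, hball⟩ := Metric.eventually_nhds_iff.1 hev
  -- On [s, t0] the growth rate at k0 is below the slope of the barrier, so ψ would be larger at (s,
  -- k0) than at its maximum.
  set s := max a (t0 - δ / 2) with hs
  have hst : s < t0 := max_lt ht0 (by linarith)
  have hsmem : s ∈ Icc a b := ⟨le_max_left _ _, hst.le.trans hmem.1.2⟩
  have hi := hint s hsmem t0 hmem.1 k0 hk0'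
  have hlt : ∫ r in s..t0, q r k0 < ∫ r in s..t0, (2 * K * α + η) := by
    refine intervalIntegral.integral_lt_integral_of_continuousOn_of_le_of_exists_lt hst
      (hq k0).continuousOn continuousOn_const (fun x hx => ?_) ⟨t0, right_mem_Icc.2 hst.le, ?_⟩
    · refine (hball ?_).le
      rw [Real.dist_eq, abs_lt]
      have := le_max_right a (t0 - δ / 2)
      constructor <;> linarith [hx.1, hx.2]
    · linarith
  rw [← hi] at hlt
  have := hmax (show (s, k0) ∈ _ from ⟨hsmem, hmem.2⟩)
  simp only [hψ, mem_ofPred_eq] at this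
  simp only [intervalIntegral.integral_const, smul_eq_mul] at hlt
  nlinarith

end Hessian

/-! ### Mollification and the weak formulation. -/

section Mollification

variable {N : ℕ}

lemma ContDiff.two_of_infty {u : RN N → ℝ} (hu : ContDiff ℝ ∞ u) : ContDiff ℝ 2 u := by
  exact_mod_cast contDiff_infty.1 hu 2

lemma continuous_integral_of_compact_vanishing {X : Type*} [TopologicalSpace X]
    [FirstCountableTopology X] [LocallyCompactSpace X] {F : X → RN N → ℝ}
    (hF : Continuous (Function.uncurry F)) {K : Set (RN N)} (hK : IsCompact K)
    (h0 : ∀ x, ∀ y ∉ K, F x y = 0) : Continuous fun x => ∫ y, F x y := by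
  have : (fun x => ∫ y, F x y) = fun x => ∫ y in K, F x y := by
    funext x
    exact (setIntegral_eq_integral_of_forall_compl_eq_zero fun y hy => h0 x y hy).symm
  rw [this]
  exact continuous_parametric_integral_of_continuous hF hK

lemma fderiv_fderiv_apply {u : RN N → ℝ} (hu : ContDiff ℝ 2 u) (z v w : RN N) :
    fderiv ℝ (fderiv ℝ u) z v w = fderiv ℝ (fun x => fderiv ℝ u x w) z v := by
  have hd : Differentiable ℝ (fderiv ℝ u) :=
    (hu.fderiv_right (m := 1) (by norm_num)).differentiable (by simp)
  rw [fderiv_clm_apply (hd z) (differentiableAt_const w)]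
  simp

lemma continuous_hessianMatrix {u : RN N → ℝ} (hu : ContDiff ℝ 2 u) (i j : Fin N) :
    Continuous fun z => hessianMatrix u z i j := by
  have h1 : Continuous (fderiv ℝ (fderiv ℝ u)) :=
    (hu.fderiv_right (m := 1) (by norm_num)).continuous_fderiv (by simp)
  simp only [hessianMatrix, Matrix.of_apply]
  fun_prop

lemma hessianMatrix_eq_zero_of_notMem_tsupport {u : RN N → ℝ} {z : RN N} (hz : z ∉ tsupport u) :
    hessianMatrix u z = 0 := by
  have h1 : z ∉ tsupport (fderiv ℝ u) := fun h => hz (tsupport_fderiv_subset ℝ h)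
  have h2 : z ∉ tsupport (fderiv ℝ (fderiv ℝ u)) := fun h => h1 (tsupport_fderiv_subset ℝ h)
  ext i j
  simp [hessianMatrix, image_eq_zero_of_notMem_tsupport h2]

lemma hessianMatrix_comp_const_sub {u : RN N → ℝ} (hu : ContDiff ℝ 2 u) (y k : RN N) :
    hessianMatrix (fun x => u (y - x)) k = hessianMatrix u (y - k) := by
  have hsub : ∀ x, HasFDerivAt (fun x : RN N => y - x) (-ContinuousLinearMap.id ℝ (RN N)) x :=
    fun x => by simpa using (hasFDerivAt_id (𝕜 := ℝ) x).const_sub y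
  have h1 : fderiv ℝ (fun x => u (y - x)) = fun x => -fderiv ℝ u (y - x) := by
    funext x
    have := ((hu.differentiable (by simp)) (y - x)).hasFDerivAt.comp x (hsub x)
    rw [show (fun x => u (y - x)) = u ∘ fun x => y - x from rfl, this.fderiv]
    ext v
    simp
  have hd : Differentiable ℝ (fderiv ℝ u) :=
    (hu.fderiv_right (m := 1) (by norm_num)).differentiable (by simp)
  have h2 : fderiv ℝ (fun x => -fderiv ℝ u (y - x)) k
      = -((fderiv ℝ (fderiv ℝ u) (y - k)).comp (-ContinuousLinearMap.id ℝ (RN N))) :=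
    (((hd (y - k)).hasFDerivAt.comp k (hsub k)).neg).fderiv
  ext i j
  simp [hessianMatrix, h1, h2]

lemma hessianMatrix_comp_const_add (u : RN N → ℝ) (y k : RN N) :
    hessianMatrix (fun x => u (y + x)) k = hessianMatrix u (y + k) := by
  have h1 : fderiv ℝ (fun x => u (y + x)) = fun x => fderiv ℝ u (y + x) := by
    funext x
    exact fderiv_comp_add_left y
  ext i j
  simp only [hessianMatrix, h1, Matrix.of_apply]
  rw [fderiv_comp_add_left]

lemma hessianMatrix_add {u v : RN N → ℝ} (hu : ContDiff ℝ 2 u) (hv : ContDiff ℝ 2 v) (z : RN N) :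
    hessianMatrix (fun x => u x + v x) z = hessianMatrix u z + hessianMatrix v z := by
  have h1 : fderiv ℝ (fun x => u x + v x) = fun x => fderiv ℝ u x + fderiv ℝ v x := by
    funext x
    exact fderiv_fun_add (hu.differentiable (by simp) x) (hv.differentiable (by simp) x)
  have hd : Differentiable ℝ (fderiv ℝ u) :=
    (hu.fderiv_right (m := 1) (by norm_num)).differentiable (by simp)
  have hd' : Differentiable ℝ (fderiv ℝ v) :=
    (hv.fderiv_right (m := 1) (by norm_num)).differentiable (by simp)
  ext i j
  simp only [hessianMatrix, h1, Matrix.of_apply, Matrix.add_apply]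
  rw [fderiv_fun_add (hd z) (hd' z)]
  simp

lemma hessianMatrix_const_smul {u : RN N → ℝ} (hu : ContDiff ℝ 2 u) (c : ℝ) (z : RN N) :
    hessianMatrix (fun x => c * u x) z = c • hessianMatrix u z := by
  have h1 : fderiv ℝ (fun x => c * u x) = fun x => c • fderiv ℝ u x := by
    funext x
    exact fderiv_const_mul (hu.differentiable (by simp) x) c
  have hd : Differentiable ℝ (fderiv ℝ u) :=
    (hu.fderiv_right (m := 1) (by norm_num)).differentiable (by simp)
  ext i j
  simp only [hessianMatrix, h1, Matrix.of_apply, Matrix.smul_apply]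
  rw [fderiv_fun_const_smul (hd z)]
  simp

lemma hessianMatrix_sub_const (u : RN N → ℝ) (c : ℝ) (z : RN N) :
    hessianMatrix (fun x => u x - c) z = hessianMatrix u z := by
  have h1 : fderiv ℝ (fun x => u x - c) = fderiv ℝ u := by
    funext x
    exact fderiv_sub_const c
  simp only [hessianMatrix, h1]

/-- The mollification `y ↦ ∫ g(x) φ(y - x) dx`. -/
noncomputable def mollify (φ g : RN N → ℝ) (y : RN N) : ℝ := ∫ x, g x * φ (y - x)

lemma mollify_eq_convolution (φ g : RN N → ℝ) :
    mollify φ g = convolution g φ (ContinuousLinearMap.mul ℝ ℝ) volume := rfl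

lemma mollify_eq_swap (φ g : RN N → ℝ) (y : RN N) : mollify φ g y = ∫ x, g (y - x) * φ x := by
  rw [mollify, ← integral_sub_left_eq_self _ _ y]
  simp

lemma fderiv_mollify {φ g : RN N → ℝ} (hφ : ContDiff ℝ 1 φ) (hc : HasCompactSupport φ)
    (hg : Continuous g) (y v : RN N) :
    fderiv ℝ (mollify φ g) y v = mollify (fun x => fderiv ℝ φ x v) g y := by
  have hl : LocallyIntegrable g := hg.locallyIntegrable
  rw [mollify_eq_convolution, (hc.hasFDerivAt_convolution_right _ hl hφ y).fderiv,
    convolution_precompR_apply _ hl (hc.fderiv ℝ) (hφ.continuous_fderiv (by simp))]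
  rfl

lemma contDiff_mollify {φ g : RN N → ℝ} (hφ : ContDiff ℝ ∞ φ) (hc : HasCompactSupport φ)
    (hg : Continuous g) : ContDiff ℝ ∞ (mollify φ g) := by
  rw [mollify_eq_convolution]
  exact hc.contDiff_convolution_right _ hg.locallyIntegrable hφ

lemma hessianMatrix_mollify {φ g : RN N → ℝ} (hφ : ContDiff ℝ ∞ φ) (hc : HasCompactSupport φ)
    (hg : Continuous g) (y : RN N) (i j : Fin N) :
    hessianMatrix (mollify φ g) y i j = mollify (fun x => hessianMatrix φ x i j) g y := by
  have h2 : ContDiff ℝ 2 φ := hφ.two_of_infty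
  have hd : ∀ w : RN N, ContDiff ℝ 1 fun x => fderiv ℝ φ x w := fun w =>
    (h2.fderiv_right (m := 1) (by norm_num)).clm_apply contDiff_const
  have hcs : ∀ w : RN N, HasCompactSupport fun x => fderiv ℝ φ x w := fun w =>
    hc.fderiv_apply (𝕜 := ℝ) w
  simp only [hessianMatrix, Matrix.of_apply]
  rw [fderiv_fderiv_apply (contDiff_mollify hφ hc hg).two_of_infty]
  have h3 : (fun x => fderiv ℝ (mollify φ g) x (EuclideanSpace.single j 1))
      = mollify (fun x => fderiv ℝ φ x (EuclideanSpace.single j 1)) g := by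
    funext x
    exact fderiv_mollify (hφ.of_le (by exact_mod_cast le_top)) hc hg x _
  rw [h3, fderiv_mollify (hd _) (hcs _) hg]
  congr 1
  funext x
  rw [fderiv_fderiv_apply h2]

/-- The pairing of `g` with `Tr(P D² ρ)`. -/
noncomputable def weakTrace (P : Matrix (Fin N) (Fin N) ℝ) (g ρ : RN N → ℝ) : ℝ :=
  ∫ y, g y * (P * hessianMatrix ρ y).trace

lemma continuous_trace_mul_hessianMatrix {A : ℝ → Matrix (Fin N) (Fin N) ℝ} (hA : Continuous A)
    {ρ : RN N → ℝ} (hρ : ContDiff ℝ 2 ρ) :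
    Continuous fun x : ℝ × RN N => (A x.1 * hessianMatrix ρ x.2).trace := by
  simp only [Matrix.trace, Matrix.diag, Matrix.mul_apply]
  have h1 : ∀ i j, Continuous fun x : ℝ × RN N => hessianMatrix ρ x.2 i j := fun i j =>
    (continuous_hessianMatrix hρ i j).comp continuous_snd
  have h2 : ∀ i j, Continuous fun x : ℝ × RN N => A x.1 i j := fun i j =>
    (hA.comp continuous_fst).matrix_elem i j
  exact continuous_finsetSum _ fun i _ => continuous_finsetSum _ fun j _ => (h2 i j).mul (h1 j i)

/-- Both derivatives fall on the bump, so continuity of g suffices. Testing weakly against the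
reflected translates of φ is thus the same as applying the operator to the mollification. -/
lemma trace_mul_hessianMatrix_mollify {φ g : RN N → ℝ} (hφ : ContDiff ℝ ∞ φ)
    (hc : HasCompactSupport φ) (hg : Continuous g) (P : Matrix (Fin N) (Fin N) ℝ) (y : RN N) :
    (P * hessianMatrix (mollify φ g) y).trace = weakTrace P g (fun x => φ (y - x)) := by
  have h2 : ContDiff ℝ 2 φ := hφ.two_of_infty
  have hint : ∀ i j, Integrable fun x => P i j * (g x * hessianMatrix φ (y - x) j i) := fun i j => by
    refine Integrable.const_mul ?_ _
    refine (hg.mul ((continuous_hessianMatrix h2 j i).comp (by fun_prop))).integrable_of_hasCompactSupport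
      ?_
    refine HasCompactSupport.mul_left ?_
    have h3 : HasCompactSupport fun x => hessianMatrix φ x j i :=
      hc.mono' fun x hx => by
        by_contra h
        exact hx (by simp [hessianMatrix_eq_zero_of_notMem_tsupport h])
    exact h3.comp_homeomorph (Homeomorph.subLeft y)
  simp only [weakTrace, hessianMatrix_comp_const_sub h2]
  simp only [Matrix.trace, Matrix.diag, Matrix.mul_apply, hessianMatrix_mollify hφ hc hg, mollify]
  simp only [Finset.mul_sum]
  rw [integral_finsetSum]
  · refine Finset.sum_congr rfl fun i _ => ?_
    rw [integral_finsetSum]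
    · refine Finset.sum_congr rfl fun j _ => ?_
      rw [← integral_const_mul]
      congr 1; funext x; ring
    · exact fun j _ => (hint i j).congr (Filter.Eventually.of_forall fun x => by simp only []; ring)
  · exact fun i _ => integrable_finsetSum _ fun j _ =>
      (hint i j).congr (Filter.Eventually.of_forall fun x => by simp only []; ring)

lemma continuous_pairing {d : ℝ → RN N → ℝ} (hd : Continuous fun x : ℝ × RN N => d x.1 x.2)
    {ρ : RN N → ℝ} (hρ : Continuous ρ) (hc : HasCompactSupport ρ) :
    Continuous fun t => ∫ y, d t y * ρ y :=
  continuous_integral_of_compact_vanishing (K := tsupport ρ)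
    (hd.mul (hρ.comp continuous_snd)) hc
    fun t y hy => by simp [image_eq_zero_of_notMem_tsupport hy]

/-- The derivatives sit on ρ, so the weak operator is continuous in time even where D² d is not. -/
lemma continuous_weakTrace {A : ℝ → Matrix (Fin N) (Fin N) ℝ} (hA : Continuous A)
    {d : ℝ → RN N → ℝ} (hd : Continuous fun x : ℝ × RN N => d x.1 x.2)
    {ρ : RN N → ℝ} (hρ : ContDiff ℝ ∞ ρ) (hc : HasCompactSupport ρ) :
    Continuous fun t => weakTrace (A t) (d t) ρ :=
  continuous_integral_of_compact_vanishing (K := tsupport ρ)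
    (hd.mul (continuous_trace_mul_hessianMatrix hA hρ.two_of_infty)) hc
    fun t y hy => by simp [hessianMatrix_eq_zero_of_notMem_tsupport hy]

lemma continuous_mollify {d : ℝ → RN N → ℝ} (hd : Continuous fun x : ℝ × RN N => d x.1 x.2)
    {φ : RN N → ℝ} (hφ : Continuous φ) (hc : HasCompactSupport φ) :
    Continuous fun x : ℝ × RN N => mollify φ (d x.1) x.2 := by
  simp only [mollify_eq_swap]
  refine continuous_integral_of_compact_vanishing (K := tsupport φ) ?_ hc
    fun t y hy => by simp [image_eq_zero_of_notMem_tsupport hy]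
  have : Continuous fun x : (ℝ × RN N) × RN N => d x.1.1 (x.1.2 - x.2) :=
    hd.comp (by fun_prop : Continuous fun x : (ℝ × RN N) × RN N => (x.1.1, x.1.2 - x.2))
  exact this.mul (hφ.comp continuous_snd)

/-- The defect in the weak formulation of `∂_t d = Tr(A D² d)` tested against `ρ`. -/
noncomputable def weakDefect (A : ℝ → Matrix (Fin N) (Fin N) ℝ) (d : ℝ → RN N → ℝ)
    (ρ : RN N → ℝ) (t : ℝ) : ℝ :=
  (∫ y, d t y * ρ y) - ∫ s in (0 : ℝ)..t, weakTrace (A s) (d s) ρ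

lemma continuous_weakDefect {A : ℝ → Matrix (Fin N) (Fin N) ℝ} (hA : Continuous A)
    {d : ℝ → RN N → ℝ} (hd : Continuous fun x : ℝ × RN N => d x.1 x.2)
    {ρ : RN N → ℝ} (hρ : ContDiff ℝ ∞ ρ) (hc : HasCompactSupport ρ) :
    Continuous (weakDefect A d ρ) :=
  (continuous_pairing hd hρ.continuous hc).sub
    (intervalIntegral.continuous_primitive
      (fun a b => (continuous_weakTrace hA hd hρ hc).intervalIntegrable a b) 0)

/-- The weak equation tested against the translates of φ becomes a classical equation for the
mollification, with a continuous right-hand side to which the barrier applies. -/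
lemma mollify_sub_eq_of_weakDefect_eq {A : ℝ → Matrix (Fin N) (Fin N) ℝ} (hA : Continuous A)
    {d : ℝ → RN N → ℝ} (hd : Continuous fun x : ℝ × RN N => d x.1 x.2)
    {φ : RN N → ℝ} (hφ : ContDiff ℝ ∞ φ) (hc : HasCompactSupport φ) {s t : ℝ} {y : RN N}
    (h : weakDefect A d (fun x => φ (y - x)) t = weakDefect A d (fun x => φ (y - x)) s) :
    mollify φ (d t) y - mollify φ (d s) y
      = ∫ r in s..t, (A r * hessianMatrix (mollify φ (d r)) y).trace := by
  have hg : ∀ r, Continuous (d r) := fun r => hd.comp (Continuous.prodMk_right r)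
  simp only [fun r => trace_mul_hessianMatrix_mollify hφ hc (hg r) (A r) y]
  have hcont := continuous_weakTrace hA hd (ρ := fun x => φ (y - x)) (by fun_prop)
    (hc.comp_homeomorph (Homeomorph.subLeft y))
  rw [← intervalIntegral.integral_interval_sub_left (hcont.intervalIntegrable 0 t)
    (hcont.intervalIntegrable 0 s)]
  simp only [weakDefect] at h
  simp only [mollify]
  linarith

lemma mollify_abs_le {φ : ContDiffBump (0 : RN N)} {g : RN N → ℝ} (hg : Continuous g) {y : RN N}
    {c : ℝ} (h : ∀ x, ‖x‖ ≤ φ.rOut → |g (y - x)| ≤ c) : |mollify (φ.normed volume) g y| ≤ c := by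
  rw [mollify_eq_swap]
  have hc : Continuous (φ.normed volume) := φ.continuous_normed
  calc |∫ x, g (y - x) * φ.normed volume x| ≤ ∫ x, |g (y - x) * φ.normed volume x| :=
        abs_integral_le_integral_abs
    _ ≤ ∫ x, c * φ.normed volume x := by
        refine integral_mono ?_ ?_ fun x => ?_
        · exact (((hg.comp (by fun_prop)).mul hc).abs).integrable_of_hasCompactSupport
            (φ.hasCompactSupport_normed.mul_left.abs)
        · exact (φ.integrable_normed).const_mul c
        · simp only [abs_mul, abs_of_nonneg (φ.nonneg_normed (μ := volume) x)]
          by_cases hx : ‖x‖ ≤ φ.rOut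
          · exact mul_le_mul_of_nonneg_right (h x hx) (φ.nonneg_normed x)
          · have : φ.normed volume x = 0 := by
              have : x ∉ Function.support (φ.normed volume) := by
                rw [φ.support_normed_eq]; simp; linarith
              simpa using this
            simp [this]
    _ = c := by rw [integral_const_mul, φ.integral_normed, mul_one]

lemma tendsto_mollify {φ : ℕ → ContDiffBump (0 : RN N)}
    (hφ : Filter.Tendsto (fun n => (φ n).rOut) Filter.atTop (nhds 0)) {g : RN N → ℝ}
    (hg : Continuous g) (y : RN N) :
    Filter.Tendsto (fun n => mollify ((φ n).normed volume) g y) Filter.atTop (nhds (g y)) := by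
  have := ContDiffBump.convolution_tendsto_right (μ := (volume : Measure (RN N)))
    (g := fun _ => g) (k := fun _ => y) (x₀ := y) (z₀ := g y) hφ
    (Filter.Eventually.of_forall fun _ => hg.aestronglyMeasurable)
    ((hg.tendsto y).comp Filter.tendsto_snd) tendsto_const_nhds
  refine this.congr fun n => ?_
  rw [convolution_lsmul_swap, mollify]
  simp only [smul_eq_mul, mul_comm]

end Mollification

/-! ### Increments of weak solutions controlled by initial second differences. -/

section Gap

variable {N : ℕ}

/-- Mixed second differences of `u` inside the closed ball of radius `r` are at most `c |v| |w|`. -/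
def SecondDifferenceBound (u : RN N → ℝ) (r c : ℝ) : Prop :=
  ∀ y v w : RN N, ‖y‖ ≤ r → ‖y + v‖ ≤ r → ‖y + w‖ ≤ r → ‖y + v + w‖ ≤ r →
    |u (y + v + w) - u (y + v) - u (y + w) + u y| ≤ c * ‖v‖ * ‖w‖

/-- Smooth test functions compactly supported in the open ball of radius `r`. -/
structure IsTest (r : ℝ) (ρ : RN N → ℝ) : Prop where
  smooth : ContDiff ℝ ∞ ρ
  compact : HasCompactSupport ρ
  support : tsupport ρ ⊆ Metric.ball 0 r

lemma exists_bump_sequence (κ : ℝ) (hκ : 0 < κ) : ∃ φ : ℕ → ContDiffBump (0 : RN N),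
    (∀ n, (φ n).rOut < κ) ∧ Filter.Tendsto (fun n => (φ n).rOut) Filter.atTop (nhds 0) := by
  refine ⟨fun n => ⟨κ / (n + 2) / 2, κ / (n + 2), by positivity, half_lt_self (by positivity)⟩,
    fun n => ?_, ?_⟩
  · have : (0 : ℝ) ≤ n := n.cast_nonneg
    exact div_lt_self hκ (by linarith)
  · exact (tendsto_const_nhds (x := κ)).div_atTop
      (Filter.tendsto_atTop_add_const_right _ _ tendsto_natCast_atTop_atTop)

lemma isTest_bump_translate {φ : ContDiffBump (0 : RN N)} {y : RN N} {r : ℝ}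
    (h : ‖y‖ + φ.rOut < r) : IsTest r fun x => φ.normed volume (y - x) where
  smooth := φ.contDiff_normed.comp (by fun_prop : ContDiff ℝ ∞ fun x : RN N => y - x)
  compact := φ.hasCompactSupport_normed.comp_homeomorph (Homeomorph.subLeft y)
  support := by
    have h1 : tsupport (fun x => φ.normed volume (y - x)) ⊆ Metric.closedBall y φ.rOut := by
      refine closure_minimal (fun x hx => ?_) Metric.isClosed_closedBall
      have hx' : y - x ∈ Function.support (φ.normed volume) := hx
      rw [φ.support_normed_eq] at hx'
      rw [Metric.mem_closedBall, dist_comm, dist_eq_norm]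
      simpa using hx'.out.le
    refine h1.trans fun x hx => ?_
    rw [Metric.mem_closedBall, dist_eq_norm] at hx
    have : ‖x‖ ≤ ‖y‖ + ‖x - y‖ := by simpa using norm_add_le y (x - y)
    simp only [Metric.mem_ball, dist_zero_right]
    linarith

/-- The barrier is applied to the symmetrization m(t, y + k) + m(t, y - k) - 2 m(a, y). Initially
this is a pure second difference, at most c‖k‖² with no linear term; on ‖k‖ = κ it is at most 4M.
Both are below K‖k‖² for K = c + 4M/κ². At k = 0 it is twice the increment, which cancels the 2 of
the barrier. The margin 2κ leaves one κ for k and one for the bump. -/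
lemma mollify_sub_le_of_weakDefect_eq {A : ℝ → Matrix (Fin N) (Fin N) ℝ} (hA : Continuous A)
    (hApos : ∀ t, (A t).PosSemidef) {α : ℝ} (hα : ∀ t, (A t).trace ≤ α) {d : ℝ → RN N → ℝ}
    (hd : Continuous fun x : ℝ × RN N => d x.1 x.2) {M : ℝ} (hM : ∀ t z, |d t z| ≤ M) {r a b : ℝ}
    (hab : a ≤ b)
    (hE : ∀ ρ : RN N → ℝ, IsTest r ρ → ∀ s ∈ Icc a b, ∀ t ∈ Icc a b,
      weakDefect A d ρ t = weakDefect A d ρ s)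
    {c : ℝ} (hc : 0 ≤ c) (hsd : SecondDifferenceBound (d a) r c) {κ : ℝ} (hκ : 0 < κ) {y : RN N}
    (hy : ‖y‖ + 2 * κ ≤ r) (φ : ContDiffBump (0 : RN N)) (hφ : φ.rOut < κ) :
    mollify (φ.normed volume) (d b) y - mollify (φ.normed volume) (d a) y
      ≤ (c + 4 * M / κ ^ 2) * α * (b - a) := by
  have hg : ∀ t, Continuous (d t) := fun t => hd.comp (Continuous.prodMk_right t)
  have hM0 : 0 ≤ M := (abs_nonneg _).trans (hM 0 0)
  have hφs : ContDiff ℝ ∞ (φ.normed volume) := φ.contDiff_normed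
  have hφc := φ.hasCompactSupport_normed (μ := (volume : Measure (RN N)))
  set m : ℝ → RN N → ℝ := fun t => mollify (φ.normed volume) (d t) with hm
  have hmc : Continuous fun x : ℝ × RN N => m x.1 x.2 := continuous_mollify hd hφs.continuous hφc
  have hm2 : ∀ t, ContDiff ℝ 2 (m t) := fun t => (contDiff_mollify hφs hφc (hg t)).two_of_infty
  have hmM : ∀ t z, |m t z| ≤ M := fun t z => mollify_abs_le (hg t) fun x _ => hM _ _
  have hqc : ∀ z, Continuous fun t => (A t * hessianMatrix (m t) z).trace := fun z => by
    simp only [hm, fun r => trace_mul_hessianMatrix_mollify hφs hφc (hg r) (A r) z]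
    exact continuous_weakTrace hA hd (ρ := fun x => φ.normed volume (z - x))
      (hφs.comp (by fun_prop : ContDiff ℝ ∞ fun x : RN N => z - x))
      (hφc.comp_homeomorph (Homeomorph.subLeft z))
  have hmi : ∀ s ∈ Icc a b, ∀ t ∈ Icc a b, ∀ z : RN N, ‖z‖ < ‖y‖ + κ →
      m t z - m s z = ∫ r in s..t, (A r * hessianMatrix (m r) z).trace := fun s hs t ht z hz =>
    mollify_sub_eq_of_weakDefect_eq hA hd hφs hφc
      (hE _ (isTest_bump_translate (by linarith)) s hs t ht)
  set K := c + 4 * M / κ ^ 2 with hKdef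
  have hK : 0 ≤ K := by positivity
  have key := parabolic_barrier (A := A)
    (e := fun t k => (m t (y + k) + m t (y - k)) - 2 * m a y)
    (q := fun t k => (A t * hessianMatrix (m t) (y + k)).trace
      + (A t * hessianMatrix (m t) (y - k)).trace) hab hκ hK hApos hα ?_ ?_ ?_ ?_ ?_ ?_ ?_
  · simp only [add_zero, sub_zero] at key
    linarith
  · have h1 : Continuous fun x : ℝ × RN N => m x.1 (y + x.2) :=
      hmc.comp (by fun_prop : Continuous fun x : ℝ × RN N => (x.1, y + x.2))
    have h2 : Continuous fun x : ℝ × RN N => m x.1 (y - x.2) :=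
      hmc.comp (by fun_prop : Continuous fun x : ℝ × RN N => (x.1, y - x.2))
    fun_prop
  · intro t
    have := hm2 t
    fun_prop
  · exact fun k => (hqc _).add (hqc _)
  · intro t k
    have h1 : ContDiff ℝ 2 fun k => m t (y + k) := (hm2 t).comp (by fun_prop)
    have h2 : ContDiff ℝ 2 fun k => m t (y - k) := (hm2 t).comp (by fun_prop)
    rw [hessianMatrix_sub_const, hessianMatrix_add h1 h2, hessianMatrix_comp_const_add,
      hessianMatrix_comp_const_sub (hm2 t), Matrix.mul_add, Matrix.trace_add]
  · intro s hs t ht k hk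
    have e1 := hmi s hs t ht (y + k) ((norm_add_le _ _).trans_lt (by linarith))
    have e2 := hmi s hs t ht (y - k) ((norm_sub_le _ _).trans_lt (by linarith))
    rw [intervalIntegral.integral_add ((hqc _).intervalIntegrable _ _)
      ((hqc _).intervalIntegrable _ _), ← e1, ← e2]
    ring
  · intro k hk
    -- Second differences commute with mollification, so those of `d a` near y suffice.
    have hlin : m a (y + k) + m a (y - k) - 2 * m a y
        = mollify (φ.normed volume) (fun z => d a (z + k) + d a (z - k) - 2 * d a z) y := by
      simp only [hm, mollify_eq_swap]
      have hi : ∀ z : RN N, Integrable fun x => d a (z - x) * φ.normed volume x := fun z =>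
        (((hg a).comp (by fun_prop)).mul hφs.continuous).integrable_of_hasCompactSupport
          hφc.mul_left
      rw [← integral_const_mul, ← integral_add (hi _) (hi _),
        ← integral_sub (f := fun x => d a (y + k - x) * φ.normed volume x
          + d a (y - k - x) * φ.normed volume x) ((hi _).add (hi _)) ((hi _).const_mul _)]
      congr 1
      funext x
      rw [show y - x + k = y + k - x by abel, show y - x - k = y - k - x by abel]
      ring
    rw [hlin]
    refine (le_abs_self _).trans (mollify_abs_le ?_ fun x hx => ?_)
    · have h1 := hg a
      fun_prop
    · have hz : ‖y - x‖ ≤ ‖y‖ + φ.rOut := (norm_sub_le _ _).trans (by linarith)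
      have h1 : ‖y - x + k‖ ≤ r := (norm_add_le _ _).trans (by linarith)
      have h2 : ‖y - x - k‖ ≤ r := (norm_sub_le _ _).trans (by linarith)
      have h3 : ‖y - x‖ ≤ r := by linarith
      -- Both increments equal to k, from the base point y - x - k, give the symmetric second
      -- difference centred at y - x.
      have := hsd (y - x - k) k k h2 (by simpa using h3) (by simpa using h3) (by simpa using h1)
      rw [show y - x - k + k + k = y - x + k by abel, sub_add_cancel] at this
      calc |d a (y - x + k) + d a (y - x - k) - 2 * d a (y - x)|
          = |d a (y - x + k) - d a (y - x) - d a (y - x) + d a (y - x - k)| := by ring_nf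
        _ ≤ c * ‖k‖ * ‖k‖ := this
        _ ≤ K * ‖k‖ ^ 2 := by
          rw [mul_assoc, ← sq]
          gcongr
          rw [hKdef]
          have : 0 ≤ 4 * M / κ ^ 2 := by positivity
          linarith
  · intro t ht k hk
    have h1 := (abs_le.1 (hmM t (y + k))).2
    have h2 := (abs_le.1 (hmM t (y - k))).2
    have h3 := (abs_le.1 (hmM a y)).1
    have h4 : K * κ ^ 2 = c * κ ^ 2 + 4 * M := by
      rw [hKdef]; field_simp
    have h5 : 0 ≤ c * κ ^ 2 := by positivity
    linarith

lemma weakDefect_neg (A : ℝ → Matrix (Fin N) (Fin N) ℝ) (d : ℝ → RN N → ℝ) (ρ : RN N → ℝ) (t : ℝ) :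
    weakDefect A (fun t z => -d t z) ρ t = -weakDefect A d ρ t := by
  simp only [weakDefect, weakTrace, neg_mul, integral_neg, intervalIntegral.integral_neg]
  ring

lemma SecondDifferenceBound.neg {u : RN N → ℝ} {r c : ℝ} (h : SecondDifferenceBound u r c) :
    SecondDifferenceBound (fun z => -u z) r c := by
  intro y v w h1 h2 h3 h4
  have := h y v w h1 h2 h3 h4
  rw [← abs_neg] at this
  convert this using 2
  ring

/-- On a time interval where `∂_t d = Tr(A D² d)` holds weakly, a second difference bound at the
initial time gives a Lipschitz bound from the initial time. -/
lemma abs_sub_le_of_weakDefect_eq {A : ℝ → Matrix (Fin N) (Fin N) ℝ} (hA : Continuous A)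
    (hApos : ∀ t, (A t).PosSemidef) {α : ℝ} (hα : ∀ t, (A t).trace ≤ α) {d : ℝ → RN N → ℝ}
    (hd : Continuous fun x : ℝ × RN N => d x.1 x.2) {M : ℝ} (hM : ∀ t z, |d t z| ≤ M) {r a b : ℝ}
    (hab : a ≤ b)
    (hE : ∀ ρ : RN N → ℝ, IsTest r ρ → ∀ s ∈ Icc a b, ∀ t ∈ Icc a b,
      weakDefect A d ρ t = weakDefect A d ρ s)
    {c : ℝ} (hc : 0 ≤ c) (hsd : SecondDifferenceBound (d a) r c) {κ : ℝ} (hκ : 0 < κ) {y : RN N}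
    (hy : ‖y‖ + 2 * κ ≤ r) :
    |d b y - d a y| ≤ (c + 4 * M / κ ^ 2) * α * (b - a) := by
  obtain ⟨φ, hφ, hφ0⟩ := exists_bump_sequence (N := N) κ hκ
  have hg : ∀ t, Continuous (d t) := fun t => hd.comp (Continuous.prodMk_right t)
  -- The bound for mollifications is independent of the bump, so the bump may shrink. The lower
  -- bound is the same argument for -d.
  have h1 : d b y - d a y ≤ (c + 4 * M / κ ^ 2) * α * (b - a) :=
    le_of_tendsto ((tendsto_mollify hφ0 (hg b) y).sub (tendsto_mollify hφ0 (hg a) y))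
      (Filter.Eventually.of_forall fun n =>
        mollify_sub_le_of_weakDefect_eq hA hApos hα hd hM hab hE hc hsd hκ hy (φ n) (hφ n))
  have h2 : -d b y - -d a y ≤ (c + 4 * M / κ ^ 2) * α * (b - a) :=
    le_of_tendsto ((tendsto_mollify hφ0 (hg b).neg y).sub (tendsto_mollify hφ0 (hg a).neg y))
      (Filter.Eventually.of_forall fun n =>
        mollify_sub_le_of_weakDefect_eq (d := fun t z => -d t z) hA hApos hα hd.neg
          (by simpa using hM) hab
          (fun ρ hρ s hs t ht => by rw [weakDefect_neg, weakDefect_neg, hE ρ hρ s hs t ht])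
          hc hsd.neg hκ hy (φ n) (hφ n))
  exact abs_le.2 ⟨by linarith, h1⟩

end Gap

/-! ### Gaps of closed sets and a Baire category principle. -/

section Gaps

/-- The gaps of `S` inside `[s, t]`. -/
def gapSet (S : Set ℝ) (s t : ℝ) : Set (ℝ × ℝ) :=
  {p | p.1 < p.2 ∧ p.1 ∈ S ∧ p.2 ∈ S ∧ s ≤ p.1 ∧ p.2 ≤ t ∧ Disjoint (Ioo p.1 p.2) S}

lemma gapSet_pairwise (S : Set ℝ) (s t : ℝ) :
    (gapSet S s t).PairwiseDisjoint fun p => Ioo p.1 p.2 := by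
  rintro ⟨a, b⟩ ⟨hab, ha, hb, -, -, hd⟩ ⟨a', b'⟩ ⟨hab', ha', hb', -, -, hd'⟩ hne
  refine Set.disjoint_left.2 fun x hx hx' => hne ?_
  have key : ∀ z ∈ S, ¬ (a < z ∧ z < b) := fun z hz h => Set.disjoint_left.1 hd h hz
  have key' : ∀ z ∈ S, ¬ (a' < z ∧ z < b') := fun z hz h => Set.disjoint_left.1 hd' h hz
  simp only [mem_Ioo] at hx hx' hab hab' ha hb ha' hb'
  have h1 := key _ ha'
  have h2 := key _ hb'
  have h3 := key' _ ha
  have h4 := key' _ hb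
  ext
  · by_contra h
    rcases lt_or_gt_of_ne h with h | h
    · exact h1 ⟨h, by linarith⟩
    · exact h3 ⟨h, by linarith⟩
  · by_contra h
    rcases lt_or_gt_of_ne h with h | h
    · exact h4 ⟨by linarith, h⟩
    · exact h2 ⟨by linarith, h⟩

lemma gapSet_countable (S : Set ℝ) (s t : ℝ) : (gapSet S s t).Countable :=
  (gapSet_pairwise S s t).countable_of_isOpen (fun _ _ => isOpen_Ioo)
    fun _ hp => nonempty_Ioo.2 hp.1

/-- The gap around x ∉ S runs from the last point of S before x to the first one after it; both
exist by compactness, as s and t belong to S. -/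
lemma iUnion_gapSet {S : Set ℝ} (hS : IsClosed S) {s t : ℝ} (hs : s ∈ S) (ht : t ∈ S) :
    (⋃ p : gapSet S s t, Ioo p.1.1 p.1.2) = Ioo s t \ S := by
  ext x
  simp only [mem_iUnion, mem_sdiff]
  constructor
  · rintro ⟨⟨⟨a, b⟩, hab, ha, hb, hsa, hbt, hd⟩, hx⟩
    exact ⟨⟨hsa.trans_lt hx.1, hx.2.trans_le hbt⟩, Set.disjoint_left.1 hd hx⟩
  · rintro ⟨hx, hxS⟩
    obtain ⟨a, ha, hamax⟩ := (isCompact_Icc.inter_right hS).exists_isGreatest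
      ⟨s, left_mem_Icc.2 hx.1.le, hs⟩
    obtain ⟨b, hb, hbmin⟩ := (isCompact_Icc.inter_right hS).exists_isLeast
      ⟨t, right_mem_Icc.2 hx.2.le, ht⟩
    have hax : a < x := lt_of_le_of_ne ha.1.2 fun h => hxS (h ▸ ha.2)
    have hxb : x < b := lt_of_le_of_ne hb.1.1 fun h => hxS (h ▸ hb.2)
    refine ⟨⟨(a, b), hax.trans hxb, ha.2, hb.2, ha.1.1, hb.1.2, ?_⟩, hax, hxb⟩
    refine Set.disjoint_left.2 fun z hz hzS => ?_
    rcases le_total z x with h | h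
    · exact absurd (hamax ⟨⟨ha.1.1.trans hz.1.le, h⟩, hzS⟩) (not_le.2 hz.1)
    · exact absurd (hbmin ⟨⟨h, hz.2.le.trans hb.1.2⟩, hzS⟩) (not_le.2 hz.2)

lemma eq_of_locally_constant_on_Ioo {E : ℝ → ℝ} (hE : Continuous E) {a b : ℝ} (hab : a < b)
    (h : ∀ x ∈ Ioo a b, ∀ᶠ y in nhds x, E y = E x) : E a = E b := by
  have hd : ∀ x ∈ Ioo a b, HasDerivAt E 0 x := fun x hx =>
    (hasDerivAt_const x (E x)).congr_of_eventuallyEq (h x hx)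
  obtain ⟨c, hc, hc'⟩ := exists_deriv_eq_slope E hab hE.continuousOn
    fun x hx => (hd x hx).differentiableAt.differentiableWithinAt
  rw [(hd c hc).deriv, eq_comm, div_eq_zero_iff] at hc'
  rcases hc' with h | h <;> linarith

/-- A family of continuous functions is constant on `[0, T]` if its constancy across the gaps of a
closed set, contained in a single member of a countable closed cover, forces its constancy across
that set. -/
lemma eq_of_closed_cover {ι : Type*} {E : ι → ℝ → ℝ} (hE : ∀ i, Continuous (E i)) {T : ℝ}
    {F : ℕ → Set ℝ} (hF : ∀ n, IsClosed (F n)) (hcov : Icc 0 T ⊆ ⋃ n, F n)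
    (hyp : ∀ n, ∀ S : Set ℝ, IsClosed S → ∀ s t, s < t → s ∈ S → t ∈ S → Icc s t ⊆ Icc 0 T →
      S ∩ Icc s t ⊆ F n →
      (∀ p ∈ gapSet S s t, ∀ i, ∀ x ∈ Icc p.1 p.2, ∀ y ∈ Icc p.1 p.2, E i y = E i x) →
      ∀ i, E i s = E i t) :
    ∀ i, ∀ x ∈ Icc 0 T, ∀ y ∈ Icc 0 T, E i y = E i x := by
  -- The radius ε is common to all members of the family: across gaps the hypothesis `hyp` needs
  -- constancy of all of them, and it returns all of them.
  set G : Set ℝ := {t | ∃ ε > 0, ∀ i, ∀ x ∈ Ioo (t - ε) (t + ε) ∩ Icc 0 T,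
    ∀ y ∈ Ioo (t - ε) (t + ε) ∩ Icc 0 T, E i y = E i x} with hG
  have hGo : IsOpen G := by
    rw [Metric.isOpen_iff]
    rintro t ⟨ε, hε, h⟩
    refine ⟨ε / 2, by positivity, fun u hu => ⟨ε / 2, by positivity, fun i x hx y hy => ?_⟩⟩
    rw [Metric.mem_ball, Real.dist_eq, abs_lt] at hu
    exact h i x ⟨⟨by linarith [hx.1.1], by linarith [hx.1.2]⟩, hx.2⟩ y
      ⟨⟨by linarith [hy.1.1], by linarith [hy.1.2]⟩, hy.2⟩
  set S : Set ℝ := Icc 0 T \ G with hS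
  have hSc : IsClosed S := isClosed_Icc.sdiff hGo
  have hgap : ∀ a b, a ≤ b → Icc a b ⊆ Icc 0 T → Disjoint (Ioo a b) S → ∀ i, E i a = E i b := by
    intro a b hab hsub hd i
    rcases hab.eq_or_lt with rfl | hab
    · rfl
    refine eq_of_locally_constant_on_Ioo (hE i) hab fun x hx => ?_
    have hxG : x ∈ G := by
      by_contra hxG
      exact Set.disjoint_left.1 hd hx ⟨hsub (Ioo_subset_Icc_self hx), hxG⟩
    obtain ⟨ε, hε, h⟩ := hxG
    filter_upwards [isOpen_Ioo.mem_nhds hx,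
      isOpen_Ioo.mem_nhds (show x ∈ Ioo (x - ε) (x + ε) from ⟨by linarith, by linarith⟩)] with y hy hy'
    exact h i x ⟨⟨by linarith, by linarith⟩, hsub (Ioo_subset_Icc_self hx)⟩ y
      ⟨hy', hsub (Ioo_subset_Icc_self hy)⟩
  have hSe : S = ∅ := by
    by_contra hne
    have hne' : Nonempty S := (nonempty_iff_ne_empty.2 hne).to_subtype
    have : CompleteSpace S := hSc.completeSpace_coe
    -- Baire's theorem in the complete space S of bad times: near some t0 in S, all of S lies in one
    -- F n. It is then shown that t0 is good.
    obtain ⟨n, ⟨t0, ht0⟩, hint⟩ := nonempty_interior_of_iUnion_of_closed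
      (f := fun n => (Subtype.val ⁻¹' F n : Set S)) (fun n => (hF n).preimage continuous_subtype_val)
      (by
        refine eq_univ_of_forall fun x => ?_
        have := hcov x.2.1
        simpa using this)
    rw [mem_interior_iff_mem_nhds, Metric.mem_nhds_iff] at hint
    obtain ⟨ε, hε, hball⟩ := hint
    have hloc : ∀ x ∈ S, x ∈ Ioo (t0 - ε) (t0 + ε) → x ∈ F n := fun x hx hx' =>
      hball (show (⟨x, hx⟩ : S) ∈ Metric.ball _ _ by
        rw [Metric.mem_ball, Subtype.dist_eq, Real.dist_eq, abs_lt]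
        constructor <;> linarith [hx'.1, hx'.2])
    refine ht0.2 ⟨ε, hε, ?_⟩
    have main : ∀ i, ∀ x ∈ Ioo (t0 - ε) (t0 + ε) ∩ Icc 0 T,
        ∀ y ∈ Ioo (t0 - ε) (t0 + ε) ∩ Icc 0 T, x ≤ y → E i x = E i y := by
      intro i x hx y hy hxy
      have hsub : Icc x y ⊆ Icc 0 T := Icc_subset_Icc hx.2.1 hy.2.2
      by_cases hemp : (Icc x y ∩ S).Nonempty
      -- Here s and t are the first and last bad times in [x, y]. Before s and after t there are
      -- only good times; between them `hyp` applies, the gaps of S consisting of good times.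
      · obtain ⟨s, hs, hsmin⟩ := (isCompact_Icc.inter_right hSc).exists_isLeast hemp
        obtain ⟨t, ht, htmax⟩ := (isCompact_Icc.inter_right hSc).exists_isGreatest hemp
        have hst : s ≤ t := hsmin ht
        have e1 : E i x = E i s := hgap x s hs.1.1 ((Icc_subset_Icc le_rfl hs.1.2).trans hsub)
          (Set.disjoint_left.2 fun z hz hzS =>
            absurd (hsmin ⟨⟨hz.1.le, hz.2.le.trans hs.1.2⟩, hzS⟩) (not_le.2 hz.2)) i
        have e2 : E i t = E i y := hgap t y ht.1.2 ((Icc_subset_Icc ht.1.1 le_rfl).trans hsub)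
          (Set.disjoint_left.2 fun z hz hzS =>
            absurd (htmax ⟨⟨ht.1.1.trans hz.1.le, hz.2.le⟩, hzS⟩) (not_le.2 hz.1)) i
        rw [e1, ← e2]
        rcases hst.eq_or_lt with h | hst
        · rw [h]
        refine hyp n S hSc s t hst hs.2 ht.2 ((Icc_subset_Icc hs.1.1 ht.1.2).trans hsub)
          (fun z hz => hloc z hz.1 ⟨?_, ?_⟩) ?_ i
        · linarith [hx.1.1, hs.1.1, hz.2.1]
        · linarith [hy.1.2, ht.1.2, hz.2.2]
        · rintro ⟨a, b⟩ ⟨hab, -, -, hsa, hbt, hd⟩ j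
          have hle : ∀ u v, u ∈ Icc a b → v ∈ Icc a b → u ≤ v → E j u = E j v := fun u v hu hv huv =>
            hgap u v huv (Icc_subset_Icc
              (hs.1.1.trans (hsa.trans hu.1) |>.trans' hx.2.1)
              ((hv.2.trans hbt).trans (ht.1.2.trans hy.2.2)))
              (hd.mono_left (Ioo_subset_Ioo hu.1 hv.2)) j
          intro u hu v hv
          rcases le_total u v with h | h
          · exact (hle u v hu hv h).symm
          · exact hle v u hv hu h
      · exact hgap x y hxy hsub (Set.disjoint_left.2 fun z hz hzS =>
          hemp ⟨z, Ioo_subset_Icc_self hz, hzS⟩) i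
    intro i x hx y hy
    rcases le_total x y with h | h
    · exact (main i x hx y hy h).symm
    · exact main i y hy x hx h
  have main : ∀ i, ∀ x ∈ Icc 0 T, ∀ y ∈ Icc 0 T, x ≤ y → E i x = E i y := fun i x hx y hy hxy =>
    hgap x y hxy (Icc_subset_Icc hx.1 hy.2) (by simp [hSe]) i
  intro i x hx y hy
  rcases le_total x y with h | h
  · exact (main i x hx y hy h).symm
  · exact main i y hy x hx h

/-- The integral over `(s, t)` splits into the part over `S` and the sum over the gaps of `S`. -/
lemma hasSum_integral_gapSet {S : Set ℝ} (hS : IsClosed S) {s t : ℝ} (hst : s ≤ t) (hs : s ∈ S)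
    (ht : t ∈ S) {φ : ℝ → ℝ} (hφ : IntervalIntegrable φ volume s t) :
    HasSum (fun p : gapSet S s t => ∫ r in p.1.1..p.1.2, φ r)
      ((∫ r in s..t, φ r) - ∫ r in Ioo s t ∩ S, φ r) := by
  have hcount : Countable (gapSet S s t) := (gapSet_countable S s t).to_subtype
  have hI : IntegrableOn φ (Ioo s t) := by
    rw [← integrableOn_Ioc_iff_integrableOn_Ioo]
    exact (intervalIntegrable_iff_integrableOn_Ioc_of_le hst).1 hφ
  have hsum := hasSum_integral_iUnion (μ := volume) (f := φ)
    (s := fun p : gapSet S s t => Ioo p.1.1 p.1.2) (fun _ => measurableSet_Ioo)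
    (fun p q hpq => gapSet_pairwise S s t p.2 q.2 fun h => hpq (Subtype.ext h))
    (by rw [iUnion_gapSet hS hs ht]; exact hI.mono_set sdiff_subset)
  rw [iUnion_gapSet hS hs ht] at hsum
  have h1 : (∫ r in s..t, φ r) = (∫ r in Ioo s t ∩ S, φ r) + ∫ r in Ioo s t \ S, φ r := by
    rw [intervalIntegral.integral_of_le hst, integral_Ioc_eq_integral_Ioo,
      integral_inter_add_sdiff hS.measurableSet hI]
  rw [h1, add_sub_cancel_left]
  refine hsum.congr_fun fun p => ?_
  rw [intervalIntegral.integral_of_le p.2.1.le, integral_Ioc_eq_integral_Ioo]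

end Gaps

/-! ### Second differences, integration by parts and measurability of the Hessian. -/

section Uniqueness

variable {N : ℕ}

/-- The mean value inequality is applied twice, with the Hessian bounded on the compact ball.
Integer constants make the resulting cover of the times countable. -/
lemma exists_secondDifferenceBound {u : RN N → ℝ} (hu : ContDiff ℝ 2 u) (r : ℝ) :
    ∃ n : ℕ, SecondDifferenceBound u r n := by
  have hd1 : Differentiable ℝ u := hu.differentiable (by simp)
  have hc1 : ContDiff ℝ 1 (fderiv ℝ u) := hu.fderiv_right (by norm_num)
  have hd2 : Differentiable ℝ (fderiv ℝ u) := hc1.differentiable (by simp)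
  obtain ⟨C, hC⟩ := (isCompact_closedBall (0 : RN N) r).exists_bound_of_continuousOn
    (hc1.continuous_fderiv (by simp)).continuousOn
  obtain ⟨n, hn⟩ := exists_nat_ge C
  have hgrad : ∀ x ∈ Metric.closedBall (0 : RN N) r, ∀ z ∈ Metric.closedBall (0 : RN N) r,
      ‖fderiv ℝ u z - fderiv ℝ u x‖ ≤ n * ‖z - x‖ := fun x hx z hz =>
    (convex_closedBall _ _).norm_image_sub_le_of_norm_hasFDerivWithin_le
      (fun w _ => (hd2 w).hasFDerivAt.hasFDerivWithinAt) (fun w hw => (hC w hw).trans hn) hx hz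
  refine ⟨n, fun y v w h1 h2 h3 h4 => ?_⟩
  have hball : ∀ z : RN N, ‖z‖ ≤ r → z ∈ Metric.closedBall (0 : RN N) r := fun z hz => by
    simpa using hz
  have hg : ∀ x, HasFDerivAt (fun x => u (x + w) - u x) (fderiv ℝ u (x + w) - fderiv ℝ u x) x :=
    fun x => ((hasFDerivAt_comp_add_right w).2 (hd1 (x + w)).hasFDerivAt).fun_sub (hd1 x).hasFDerivAt
  have hseg : ∀ x ∈ segment ℝ y (y + v), ‖fderiv ℝ u (x + w) - fderiv ℝ u x‖ ≤ n * ‖w‖ := by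
    intro x hx
    have hx1 : x ∈ Metric.closedBall (0 : RN N) r :=
      (convex_closedBall _ _).segment_subset (hball _ h1) (hball _ h2) hx
    have hx2 : x + w ∈ Metric.closedBall (0 : RN N) r := by
      refine (convex_closedBall (0 : RN N) r).segment_subset (hball _ h3) (hball _ h4) ?_
      obtain ⟨a, b, ha, hb, hab, rfl⟩ := hx
      refine ⟨a, b, ha, hb, hab, ?_⟩
      calc a • (y + w) + b • (y + v + w) = a • y + b • (y + v) + (a • w + b • w) := by
            simp only [smul_add]; abel
        _ = a • y + b • (y + v) + w := by rw [← add_smul, hab, one_smul]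
    simpa using hgrad x hx1 (x + w) hx2
  have := (convex_segment (𝕜 := ℝ) y (y + v)).norm_image_sub_le_of_norm_hasFDerivWithin_le
    (fun x _ => (hg x).hasFDerivWithinAt) hseg (left_mem_segment ℝ _ _) (right_mem_segment ℝ _ _)
  simp only [add_sub_cancel_left, Real.norm_eq_abs] at this
  calc _ = |u (y + v + w) - u (y + v) - (u (y + w) - u y)| := by ring_nf
    _ ≤ _ := this.trans (le_of_eq (by ring))

/-- Letting the two increments shrink one after the other turns the bound into a Lipschitz bound for
the gradient and then into a bound for its derivative. -/
lemma SecondDifferenceBound.abs_hessianMatrix_le {u : RN N → ℝ} (hu : ContDiff ℝ 2 u) {r c : ℝ}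
    (hc : 0 ≤ c) (h : SecondDifferenceBound u r c) {z : RN N} (hz : ‖z‖ < r) (i j : Fin N) :
    |hessianMatrix u z i j| ≤ c := by
  have hd1 : Differentiable ℝ u := hu.differentiable (by simp)
  have hc1 : ContDiff ℝ 1 (fderiv ℝ u) := hu.fderiv_right (by norm_num)
  have hd2 : Differentiable ℝ (fderiv ℝ u) := hc1.differentiable (by simp)
  have hgrad : ∀ v : RN N, ‖z + v‖ < r → ‖fderiv ℝ u (z + v) - fderiv ℝ u z‖ ≤ c * ‖v‖ := by
    intro v hv
    have hg : HasFDerivAt (fun x => u (x + v) - u x) (fderiv ℝ u (z + v) - fderiv ℝ u z) z :=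
      ((hasFDerivAt_comp_add_right v).2 (hd1 (z + v)).hasFDerivAt).fun_sub (hd1 z).hasFDerivAt
    refine hg.le_of_lip' (by positivity) ?_
    have e1 : ∀ᶠ x : RN N in nhds z, ‖x‖ < r := continuous_norm.continuousAt.eventually (gt_mem_nhds hz)
    have e2 : ∀ᶠ x : RN N in nhds z, ‖x + v‖ < r :=
      (by fun_prop : Continuous fun x : RN N => ‖x + v‖).continuousAt.eventually (gt_mem_nhds hv)
    filter_upwards [e1, e2] with x hx1 hx2
    have := h z v (x - z) hz.le hv.le (by simpa using hx1.le)
      (by rw [show z + v + (x - z) = x + v by abel]; exact hx2.le)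
    rw [show z + v + (x - z) = x + v by abel, add_sub_cancel] at this
    rw [Real.norm_eq_abs]
    calc _ = |u (x + v) - u (z + v) - u x + u z| := by ring_nf
      _ ≤ _ := this
  have hnorm : ‖fderiv ℝ (fderiv ℝ u) z‖ ≤ c := by
    refine (hd2 z).hasFDerivAt.le_of_lip' hc ?_
    have e1 : ∀ᶠ x : RN N in nhds z, ‖x‖ < r := continuous_norm.continuousAt.eventually (gt_mem_nhds hz)
    filter_upwards [e1] with x hx
    simpa using hgrad (x - z) (by simpa using hx)
  have := (fderiv ℝ (fderiv ℝ u) z).le_opNorm₂ (EuclideanSpace.single i 1) (EuclideanSpace.single j 1)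
  simp only [PiLp.norm_single, norm_one, mul_one, Real.norm_eq_abs] at this
  exact this.trans hnorm

/-- Second differences involve only values of d, hence are continuous in time. This is why they
replace bounds on D² d, which need not define closed sets of times directly. -/
lemma isClosed_secondDifferenceBound {d : ℝ → RN N → ℝ}
    (hd : Continuous fun x : ℝ × RN N => d x.1 x.2) (r c : ℝ) :
    IsClosed {t | SecondDifferenceBound (d t) r c} := by
  have hc : ∀ z, Continuous fun t => d t z := fun z => hd.comp (Continuous.prodMk_left z)
  simp only [SecondDifferenceBound, ofPred_forall]
  refine isClosed_iInter fun y => isClosed_iInter fun v => isClosed_iInter fun w =>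
    isClosed_iInter fun _ => isClosed_iInter fun _ => isClosed_iInter fun _ => isClosed_iInter
    fun _ => isClosed_le ?_ continuous_const
  exact ((((hc _).sub (hc _)).sub (hc _)).add (hc _)).abs

/-- Two integrations by parts exchange the order of the two directions. The transposition is kept
here and absorbed later by the symmetry of the coefficient matrix. -/
lemma integral_mul_hessianMatrix {u ρ : RN N → ℝ} (hu : ContDiff ℝ 2 u) (hρ : ContDiff ℝ 2 ρ)
    (hc : HasCompactSupport ρ) (i j : Fin N) :
    ∫ y, ρ y * hessianMatrix u y i j = ∫ y, u y * hessianMatrix ρ y j i := by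
  have hu' : ∀ w, ContDiff ℝ 1 fun x => fderiv ℝ u x w := fun w =>
    (hu.fderiv_right (m := 1) (by norm_num)).clm_apply contDiff_const
  have hρ' : ∀ w, ContDiff ℝ 1 fun x => fderiv ℝ ρ x w := fun w =>
    (hρ.fderiv_right (m := 1) (by norm_num)).clm_apply contDiff_const
  have hcs : ∀ w : RN N, HasCompactSupport fun x => fderiv ℝ ρ x w := fun w =>
    hc.fderiv_apply (𝕜 := ℝ) w
  have hcs2 : ∀ v w : RN N, HasCompactSupport fun x => fderiv ℝ (fun x => fderiv ℝ ρ x w) x v :=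
    fun v w => (hcs w).fderiv_apply (𝕜 := ℝ) v
  have hcont : ∀ {f : RN N → ℝ}, ContDiff ℝ 1 f → ∀ v, Continuous fun x => fderiv ℝ f x v :=
    fun hf v => (hf.continuous_fderiv (by simp)).clm_apply continuous_const
  have hu1 : ContDiff ℝ 1 u := hu.of_le (by norm_num)
  have hρ1 : ContDiff ℝ 1 ρ := hρ.of_le (by norm_num)
  simp only [hessianMatrix, Matrix.of_apply, fderiv_fderiv_apply hu, fderiv_fderiv_apply hρ]
  rw [integral_mul_fderiv_eq_neg_fderiv_mul_of_integrable]
  · rw [integral_mul_fderiv_eq_neg_fderiv_mul_of_integrable (f := u)]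
    · congr 2; funext x; ring
    · exact ((hcont hu1 _).mul (hρ' _).continuous).integrable_of_hasCompactSupport (hcs _).mul_left
    · exact (hu.continuous.mul (hcont (hρ' _) _)).integrable_of_hasCompactSupport (hcs2 _ _).mul_left
    · exact (hu.continuous.mul (hρ' _).continuous).integrable_of_hasCompactSupport (hcs _).mul_left
    · exact fun x _ => hu1.differentiable (by simp) x
    · exact fun x _ => (hρ' _).differentiable (by simp) x
  · exact ((hcont hρ1 _).mul (hu' _).continuous).integrable_of_hasCompactSupport (hcs _).mul_right
  · exact (hρ.continuous.mul (hcont (hu' _) _)).integrable_of_hasCompactSupport hc.mul_right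
  · exact (hρ.continuous.mul (hu' _).continuous).integrable_of_hasCompactSupport hc.mul_right
  · exact fun x _ => hρ1.differentiable (by simp) x
  · exact fun x _ => (hu' _).differentiable (by simp) x

lemma integral_mul_trace_eq_weakTrace {u ρ : RN N → ℝ} (hu : ContDiff ℝ 2 u) (hρ : ContDiff ℝ 2 ρ)
    (hc : HasCompactSupport ρ) {P : Matrix (Fin N) (Fin N) ℝ} (hP : P.transpose = P) :
    ∫ y, ρ y * (P * hessianMatrix u y).trace = weakTrace P u ρ := by
  have hi1 : ∀ i j, Integrable fun y => P i j * (ρ y * hessianMatrix u y j i) := fun i j =>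
    ((hρ.continuous.mul (continuous_hessianMatrix hu j i)).integrable_of_hasCompactSupport
      hc.mul_right).const_mul _
  have hcs : ∀ i j, HasCompactSupport fun y => hessianMatrix ρ y i j := fun i j =>
    hc.mono' fun x hx => by
      by_contra h
      exact hx (by simp [hessianMatrix_eq_zero_of_notMem_tsupport h])
  have hi2 : ∀ i j, Integrable fun y => P i j * (u y * hessianMatrix ρ y j i) := fun i j =>
    ((hu.continuous.mul (continuous_hessianMatrix hρ j i)).integrable_of_hasCompactSupport
      (hcs j i).mul_left).const_mul _
  have e1 : ∀ y, ρ y * (P * hessianMatrix u y).trace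
      = ∑ i, ∑ j, P i j * (ρ y * hessianMatrix u y j i) := fun y => by
    simp only [Matrix.trace, Matrix.diag, Matrix.mul_apply, Finset.mul_sum]
    exact Finset.sum_congr rfl fun i _ => Finset.sum_congr rfl fun j _ => by ring
  have e2 : ∀ y, u y * (P * hessianMatrix ρ y).trace
      = ∑ i, ∑ j, P i j * (u y * hessianMatrix ρ y j i) := fun y => by
    simp only [Matrix.trace, Matrix.diag, Matrix.mul_apply, Finset.mul_sum]
    exact Finset.sum_congr rfl fun i _ => Finset.sum_congr rfl fun j _ => by ring
  simp only [weakTrace, e1, e2]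
  rw [integral_finsetSum _ fun i _ => integrable_finsetSum _ fun j _ => hi1 i j,
    integral_finsetSum _ fun i _ => integrable_finsetSum _ fun j _ => hi2 i j]
  simp only [integral_finsetSum _ fun j _ => hi1 _ j, integral_finsetSum _ fun j _ => hi2 _ j,
    integral_const_mul, integral_mul_hessianMatrix hu hρ hc]
  rw [Finset.sum_comm]
  refine Finset.sum_congr rfl fun i _ => Finset.sum_congr rfl fun j _ => ?_
  rw [show P j i = P i j from congrFun (congrFun hP i) j]

/-- Joint continuity of d makes its first space derivatives jointly measurable; the second ones are
pointwise limits of their difference quotients. -/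
lemma measurable_hessianMatrix {d : ℝ → RN N → ℝ} (hd : Continuous fun x : ℝ × RN N => d x.1 x.2)
    (hd2 : ∀ t, ContDiff ℝ 2 (d t)) (i j : Fin N) :
    Measurable fun x : ℝ × RN N => hessianMatrix (d x.1) x.2 i j := by
  have hm : Measurable fun x : ℝ × RN N => fderiv ℝ (d x.1) x.2 (EuclideanSpace.single j 1) :=
    measurable_fderiv_apply_const_with_param ℝ hd _
  refine measurable_of_tendsto_metrizable (f := fun (n : ℕ) (x : ℝ × RN N) => (n : ℝ) •
    (fderiv ℝ (d x.1) (x.2 + (n : ℝ)⁻¹ • EuclideanSpace.single i 1) (EuclideanSpace.single j 1)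
      - fderiv ℝ (d x.1) x.2 (EuclideanSpace.single j 1))) (fun n => ?_) ?_
  · simp only [smul_eq_mul]
    refine Measurable.const_mul (Measurable.sub ?_ hm) _
    exact hm.comp (g := fun x : ℝ × RN N => fderiv ℝ (d x.1) x.2 (EuclideanSpace.single j 1))
      (f := fun x : ℝ × RN N => (x.1, x.2 + (n : ℝ)⁻¹ • EuclideanSpace.single i 1))
      (by fun_prop)
  · refine tendsto_pi_nhds.2 fun x => ?_
    have h1 : ContDiff ℝ 1 fun y => fderiv ℝ (d x.1) y (EuclideanSpace.single j 1) :=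
      ((hd2 x.1).fderiv_right (m := 1) (by norm_num)).clm_apply contDiff_const
    simp only [hessianMatrix, Matrix.of_apply, fderiv_fderiv_apply (hd2 x.1)]
    exact (h1.differentiable (by simp) x.2).hasFDerivAt.lim _
      (by simpa using tendsto_natCast_atTop_atTop (R := ℝ))

lemma abs_trace_mul_le {P H : Matrix (Fin N) (Fin N) ℝ} {β c : ℝ} (hβ : 0 ≤ β)
    (hP : ∀ i j, |P i j| ≤ β) (hH : ∀ i j, |H i j| ≤ c) :
    |(P * H).trace| ≤ N * (N * (β * c)) := by
  simp only [Matrix.trace, Matrix.diag, Matrix.mul_apply]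
  refine (Finset.abs_sum_le_sum_abs _ _).trans ((Finset.sum_le_card_nsmul _ _ (N * (β * c))
    fun i _ => (Finset.abs_sum_le_sum_abs _ _).trans ((Finset.sum_le_card_nsmul _ _ (β * c)
      fun j _ => ?_).trans (by simp))).trans (by simp))
  rw [abs_mul]
  exact mul_le_mul (hP i j) (hH j i) (abs_nonneg _) hβ

end Uniqueness

/-! ### Uniqueness of bounded solutions. -/

section Uniqueness

variable {N : ℕ}

/-- A single κ for the whole support makes the Lipschitz bound across gaps uniform on it. -/
lemma IsTest.exists_margin {r : ℝ} {ρ : RN N → ℝ} (h : IsTest r ρ) :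
    ∃ κ > 0, ∀ y ∈ tsupport ρ, ‖y‖ + 2 * κ ≤ r := by
  rcases (tsupport ρ).eq_empty_or_nonempty with he | hne
  · exact ⟨1, one_pos, by simp [he]⟩
  · obtain ⟨y0, hy0, hmax⟩ := h.compact.isCompact.exists_isMaxOn hne continuous_norm.continuousOn
    have : ‖y0‖ < r := by simpa using h.support hy0
    refine ⟨(r - ‖y0‖) / 2, by linarith, fun y hy => ?_⟩
    have : ‖y‖ ≤ ‖y0‖ := hmax hy
    linarith

/-- If `∂_t d = Tr(A D² d)` holds pointwise in integral form, and weakly across the gaps of a closed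
set of times on which the second differences of `d` are uniformly bounded, then it holds weakly
between any two points of that set. -/
lemma weakDefect_eq_of_gapSet {A : ℝ → Matrix (Fin N) (Fin N) ℝ} (hA : Continuous A)
    (hApos : ∀ t, (A t).PosSemidef) {β : ℝ} (hβ0 : 0 ≤ β) (hβ : ∀ t i j, |A t i j| ≤ β)
    {α : ℝ} (hα : ∀ t, (A t).trace ≤ α) {d : ℝ → RN N → ℝ}
    (hd : Continuous fun x : ℝ × RN N => d x.1 x.2) {M : ℝ} (hM : ∀ t z, |d t z| ≤ M)
    (hd2 : ∀ t, ContDiff ℝ 2 (d t)) {s t : ℝ} (hst : s < t)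
    (hint : ∀ z, IntervalIntegrable (fun r => (A r * hessianMatrix (d r) z).trace) volume s t)
    (heq : ∀ a ∈ Icc s t, ∀ b ∈ Icc s t, ∀ z,
      d b z - d a z = ∫ r in a..b, (A r * hessianMatrix (d r) z).trace)
    {S : Set ℝ} (hS : IsClosed S) (hs : s ∈ S) (ht : t ∈ S) {R c : ℝ} (hc : 0 ≤ c)
    (hbd : ∀ r ∈ S ∩ Icc s t, SecondDifferenceBound (d r) R c)
    (hgap : ∀ p ∈ gapSet S s t, ∀ ρ : RN N → ℝ, IsTest R ρ → ∀ x ∈ Icc p.1 p.2,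
      ∀ y ∈ Icc p.1 p.2, weakDefect A d ρ y = weakDefect A d ρ x)
    {ρ : RN N → ℝ} (hρ : IsTest R ρ) : weakDefect A d ρ s = weakDefect A d ρ t := by
  classical
  have hcount : Countable (gapSet S s t) := (gapSet_countable S s t).to_subtype
  have hg : ∀ t, Continuous (d t) := fun t => hd.comp (Continuous.prodMk_right t)
  have hρ2 : ContDiff ℝ 2 ρ := hρ.smooth.two_of_infty
  have hM0 : 0 ≤ M := (abs_nonneg _).trans (hM 0 0)
  have hα0 : 0 ≤ α := (hApos 0).trace_nonneg.trans (hα 0)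
  have hsym : ∀ r, (A r).transpose = A r := fun r => by
    have := (hApos r).1
    rwa [Matrix.IsHermitian, Matrix.conjTranspose_eq_transpose_of_trivial] at this
  obtain ⟨κ, hκ, hmargin⟩ := hρ.exists_margin
  set L : ℝ := (c + 4 * M / κ ^ 2) * α with hL
  have hL0 : 0 ≤ L := by positivity
  set I : Set ℝ := Ioo s t ∩ S with hI
  have hIm : MeasurableSet I := measurableSet_Ioo.inter hS.measurableSet
  have hIfin : IsFiniteMeasure (volume.restrict I) :=
    ⟨by
      rw [Measure.restrict_apply_univ]
      exact (measure_mono inter_subset_left).trans_lt (by simp)⟩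
  -- Lipschitz bound across the gaps
  have hgapd : ∀ p ∈ gapSet S s t, ∀ y ∈ tsupport ρ,
      |d p.2 y - d p.1 y| ≤ L * (p.2 - p.1) := fun p hp y hy =>
    abs_sub_le_of_weakDefect_eq hA hApos hα hd hM hp.1.le (hgap p hp) hc
      (hbd p.1 ⟨hp.2.1, hp.2.2.2.1, hp.1.le.trans hp.2.2.2.2.1⟩) hκ (hmargin y hy)
  have hpair : ∀ a, Integrable fun y => d a y * ρ y := fun a =>
    ((hg a).mul hρ.smooth.continuous).integrable_of_hasCompactSupport hρ.compact.mul_left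
  set F : gapSet S s t → RN N → ℝ := fun p y => (d p.1.2 y - d p.1.1 y) * ρ y with hF
  have hFi : ∀ p, Integrable (F p) := fun p => by
    simp only [hF, sub_mul]
    exact (hpair _).sub (hpair _)
  -- The decomposition of the integral of the constant 1 shows that the gap lengths are summable;
  -- with the Lipschitz bound this dominates the increments.
  have hlen : Summable fun p : gapSet S s t => p.1.2 - p.1.1 := by
    have := hasSum_integral_gapSet hS hst.le hs ht (φ := fun _ => (1 : ℝ)) (by simp)
    simpa using this.summable
  have hFs : Summable fun p => ∫ y, ‖F p y‖ := by
    have hρi : Integrable fun y => |ρ y| :=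
      (hρ.smooth.continuous.integrable_of_hasCompactSupport hρ.compact).abs
    refine Summable.of_nonneg_of_le (fun p => integral_nonneg fun y => norm_nonneg _) (fun p => ?_)
      (hlen.mul_left (L * ∫ y, |ρ y|))
    rw [mul_right_comm, ← integral_const_mul]
    refine integral_mono (hFi p).norm (hρi.const_mul _) fun y => ?_
    simp only [hF, norm_mul, Real.norm_eq_abs]
    by_cases hy : y ∈ tsupport ρ
    · exact mul_le_mul_of_nonneg_right (hgapd p.1 p.2 y hy) (abs_nonneg _)
    · simp [image_eq_zero_of_notMem_tsupport hy]
  -- the sum over the gaps, pointwise and integrated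
  have hsum1 : ∀ y, HasSum (fun p => F p y)
      ((d t y - d s y) * ρ y - (∫ r in I, (A r * hessianMatrix (d r) y).trace) * ρ y) := fun y => by
    have := (hasSum_integral_gapSet hS hst.le hs ht (hint y)).mul_right (ρ y)
    rw [← heq s (left_mem_Icc.2 hst.le) t (right_mem_Icc.2 hst.le), sub_mul] at this
    refine this.congr_fun fun p => ?_
    obtain ⟨hp1, -, -, hp2, hp3, -⟩ := p.2
    simp only [hF]
    rw [heq p.1.1 ⟨hp2, hp1.le.trans hp3⟩ p.1.2 ⟨hp2.trans hp1.le, hp3⟩]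
  have hwt : Continuous fun r => weakTrace (A r) (d r) ρ :=
    continuous_weakTrace hA hd hρ.smooth hρ.compact
  have hdef : ∀ a b, weakDefect A d ρ b = weakDefect A d ρ a →
      ∫ y, (d b y - d a y) * ρ y = ∫ r in a..b, weakTrace (A r) (d r) ρ := fun a b h => by
    simp only [sub_mul]
    rw [integral_sub (hpair _) (hpair _),
      ← intervalIntegral.integral_interval_sub_left (hwt.intervalIntegrable 0 b)
      (hwt.intervalIntegrable 0 a)]
    simp only [weakDefect] at h
    linarith
  have hsum2 : HasSum (fun p => ∫ y, F p y)
      ((∫ r in s..t, weakTrace (A r) (d r) ρ) - ∫ r in I, weakTrace (A r) (d r) ρ) := by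
    refine (hasSum_integral_gapSet hS hst.le hs ht
      (φ := fun r => weakTrace (A r) (d r) ρ) (hwt.intervalIntegrable _ _)).congr_fun fun p => ?_
    exact hdef _ _ (hgap p.1 p.2 ρ hρ _ (left_mem_Icc.2 p.2.1.le) _ (right_mem_Icc.2 p.2.1.le))
  -- Fubini on the part over `S`
  have hfub : Integrable (Function.uncurry fun (r : ℝ) (y : RN N) =>
      ρ y * (A r * hessianMatrix (d r) y).trace) ((volume.restrict I).prod volume) := by
    have hmeas : Measurable (Function.uncurry fun (r : ℝ) (y : RN N) =>
        ρ y * (A r * hessianMatrix (d r) y).trace) := by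
      refine (hρ.smooth.continuous.measurable.comp measurable_snd).mul ?_
      simp only [Matrix.trace, Matrix.diag, Matrix.mul_apply]
      refine Finset.measurable_fun_sum _ fun i _ => Finset.measurable_fun_sum _ fun j _ =>
        Measurable.mul ?_ (measurable_hessianMatrix hd hd2 j i)
      exact ((hA.matrix_elem i j).measurable).comp measurable_fst
    have hdom : Integrable (fun x : ℝ × RN N => N * (N * (β * c)) * |ρ x.2|)
        ((volume.restrict I).prod volume) := by
      have h1 := (hρ.smooth.continuous.integrable_of_hasCompactSupport hρ.compact
        (μ := (volume : Measure (RN N)))).abs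
      exact ((integrable_const (1 : ℝ)).mul_prod h1).const_mul (N * (N * (β * c)))
        |>.congr (Filter.Eventually.of_forall fun x => by simp)
    refine hdom.mono' hmeas.aestronglyMeasurable ?_
    have hae : ∀ᵐ x : ℝ × RN N ∂((volume.restrict I).prod volume), x.1 ∈ I :=
      Measure.quasiMeasurePreserving_fst.ae (ae_restrict_mem hIm)
    filter_upwards [hae] with x hx
    simp only [Function.uncurry, norm_mul, Real.norm_eq_abs]
    rw [mul_comm]
    by_cases hy : x.2 ∈ tsupport ρ
    · refine mul_le_mul_of_nonneg_right ?_ (abs_nonneg _)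
      refine abs_trace_mul_le hβ0 (hβ _) fun i j => (hbd x.1
        ⟨hx.2, Ioo_subset_Icc_self hx.1⟩).abs_hessianMatrix_le (hd2 _) hc ?_ i j
      · simpa using hρ.support hy
    · simp [image_eq_zero_of_notMem_tsupport hy]
  have hswap : ∫ y, (∫ r in I, (A r * hessianMatrix (d r) y).trace) * ρ y
      = ∫ r in I, weakTrace (A r) (d r) ρ := by
    have h1 : ∀ r, weakTrace (A r) (d r) ρ = ∫ y, ρ y * (A r * hessianMatrix (d r) y).trace :=
      fun r => (integral_mul_trace_eq_weakTrace (hd2 r) hρ2 hρ.compact (hsym r)).symm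
    simp only [h1]
    rw [integral_integral_swap hfub]
    refine integral_congr_ae (Filter.Eventually.of_forall fun y => ?_)
    simp only [mul_comm (_ : ℝ) (ρ y)]
    rw [integral_const_mul]
  have hIi : Integrable fun y => (∫ r in I, (A r * hessianMatrix (d r) y).trace) * ρ y := by
    refine hfub.integral_prod_right.congr (Filter.Eventually.of_forall fun y => ?_)
    simp only [Function.uncurry]
    rw [integral_const_mul, mul_comm]
  -- The increments over all gaps are evaluated in two ways, by the weak equation on each gap and by
  -- the pointwise equation summed first. The contributions of S agree by Fubini and cancel, leaving
  -- the weak equation on [s, t].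
  have hmain := integral_tsum_of_summable_integral_norm hFi hFs
  rw [hsum2.tsum_eq] at hmain
  simp only [fun y => (hsum1 y).tsum_eq] at hmain
  have hti : Integrable fun y => (d t y - d s y) * ρ y := by
    simp only [sub_mul]
    exact (hpair _).sub (hpair _)
  rw [integral_sub hti hIi, hswap] at hmain
  have h3 : ∫ y, (d t y - d s y) * ρ y = (∫ y, d t y * ρ y) - ∫ y, d s y * ρ y := by
    simp only [sub_mul]
    exact integral_sub (hpair _) (hpair _)
  have h4 := intervalIntegral.integral_interval_sub_left (μ := volume) (hwt.intervalIntegrable 0 t)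
    (hwt.intervalIntegrable 0 s)
  simp only [weakDefect]
  linarith

/-- A bounded function satisfying `∂_t d = Tr(A D² d)` in integral form and vanishing initially
vanishes. -/
lemma eq_zero_of_integral_eq {A : ℝ → Matrix (Fin N) (Fin N) ℝ} (hA : Continuous A)
    (hApos : ∀ t, (A t).PosSemidef) {β : ℝ} (hβ0 : 0 ≤ β) (hβ : ∀ t i j, |A t i j| ≤ β)
    {d : ℝ → RN N → ℝ} (hd : Continuous fun x : ℝ × RN N => d x.1 x.2) {M : ℝ}
    (hM : ∀ t z, |d t z| ≤ M) (hd2 : ∀ t, ContDiff ℝ 2 (d t)) {T : ℝ}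
    (hint : ∀ z, IntervalIntegrable (fun r => (A r * hessianMatrix (d r) z).trace) volume 0 T)
    (heq : ∀ t ∈ Icc 0 T, ∀ z, d t z = ∫ r in (0 : ℝ)..t, (A r * hessianMatrix (d r) z).trace) :
    ∀ t ∈ Icc 0 T, ∀ z, d t z = 0 := by
  intro t ht z
  have hM0 : 0 ≤ M := (abs_nonneg _).trans (hM 0 0)
  have hα : ∀ t, (A t).trace ≤ N * β := fun t => by
    refine (Finset.sum_le_card_nsmul _ _ β fun i _ => (le_abs_self _).trans (hβ t i i)).trans ?_
    simp
  have hT : 0 ≤ T := ht.1.trans ht.2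
  have h0T : (0 : ℝ) ∈ Icc 0 T := left_mem_Icc.2 hT
  have hii : ∀ a ∈ Icc 0 T, ∀ b ∈ Icc 0 T, ∀ z,
      IntervalIntegrable (fun r => (A r * hessianMatrix (d r) z).trace) volume a b :=
    fun a ha b hb z => (hint z).mono_set (by
      rw [uIcc_of_le hT]; exact uIcc_subset_Icc ha hb)
  have hdiff : ∀ a ∈ Icc 0 T, ∀ b ∈ Icc 0 T, ∀ z,
      d b z - d a z = ∫ r in a..b, (A r * hessianMatrix (d r) z).trace := fun a ha b hb z => by
    rw [heq a ha, heq b hb, intervalIntegral.integral_interval_sub_left (hii _ h0T _ hb _)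
      (hii _ h0T _ ha _)]
  have hd0 : ∀ z, d 0 z = 0 := fun z => by simpa using heq 0 h0T z
  have hweak : ∀ R : ℝ, ∀ ρ : RN N → ℝ, IsTest R ρ → ∀ s ∈ Icc 0 T, ∀ t ∈ Icc 0 T,
      weakDefect A d ρ t = weakDefect A d ρ s := by
    intro R ρ hρ
    -- The family consists of all test functions in the ball at once, because the Lipschitz bound
    -- across a gap tests against bumps other than ρ.
    refine eq_of_closed_cover (E := fun ρ : {ρ : RN N → ℝ // IsTest R ρ} => weakDefect A d ρ.1)
      (fun ρ => continuous_weakDefect hA hd ρ.2.smooth ρ.2.compact)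
      (F := fun n => {t | SecondDifferenceBound (d t) R n})
      (fun n => isClosed_secondDifferenceBound hd R n)
      (fun t _ => mem_iUnion.2 (exists_secondDifferenceBound (hd2 t) R)) ?_ ⟨ρ, hρ⟩
    intro n S hS a b hab ha hb hsub hSn hgap ρ
    exact weakDefect_eq_of_gapSet hA hApos hβ0 hβ hα hd hM hd2 hab
      (hii a (hsub (left_mem_Icc.2 hab.le)) b (hsub (right_mem_Icc.2 hab.le)))
      (fun u hu v hv => hdiff u (hsub hu) v (hsub hv)) hS ha hb n.cast_nonneg hSn
      (fun p hp ρ hρ => hgap p hp ⟨ρ, hρ⟩) ρ.2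
  -- Zero initial data allow c = 0 on every ball. With κ = n + 1 only the lateral term 4M/κ²
  -- remains, and it tends to zero.
  have hκ : ∀ n : ℕ, |d t z| ≤ (4 * M) * (N * β) * t / ((n : ℝ) + 1) ^ 2 := fun n => by
    have hpos : (0 : ℝ) < (n : ℝ) + 1 := by positivity
    have := abs_sub_le_of_weakDefect_eq (r := ‖z‖ + 2 * ((n : ℝ) + 1)) hA hApos hα hd hM ht.1
      (fun ρ hρ u hu v hv => hweak _ ρ hρ u ⟨hu.1, hu.2.trans ht.2⟩ v ⟨hv.1, hv.2.trans ht.2⟩)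
      le_rfl (fun y v w _ _ _ _ => by simp [hd0]) hpos le_rfl
    rw [hd0, sub_zero, sub_zero, zero_add] at this
    refine this.trans (le_of_eq ?_)
    ring
  have hlim : Filter.Tendsto (fun n : ℕ => (4 * M) * (N * β) * t / ((n : ℝ) + 1) ^ 2) Filter.atTop
      (nhds 0) := by
    refine tendsto_const_nhds.div_atTop ((Filter.tendsto_pow_atTop two_ne_zero).comp ?_)
    exact Filter.tendsto_atTop_add_const_right _ _ tendsto_natCast_atTop_atTop
  exact abs_nonpos_iff.1 (ge_of_tendsto' hlim hκ)

end Uniqueness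

/-! ### Fourier synthesis with decaying amplitudes. -/

section Fourier

variable {N : ℕ}

open Complex FourierTransform

/-- The plane wave `exp(2 π i ξ · x)`. -/
noncomputable def wave (x ξ : RN N) : ℂ := exp ((2 * Real.pi * inner ℝ ξ x : ℝ) * I)

lemma norm_wave (x ξ : RN N) : ‖wave x ξ‖ = 1 := norm_exp_ofReal_mul_I _

lemma continuous_wave : Continuous fun p : RN N × RN N => wave p.1 p.2 := by
  unfold wave
  fun_prop

lemma wave_add (x y ξ : RN N) : wave (x + y) ξ = wave x ξ * wave y ξ := by
  simp only [wave, inner_add_right, ← exp_add]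
  congr 1; push_cast; ring

/-- The real part of the inverse Fourier transform. -/
noncomputable def synth (b : RN N → ℂ) (x : RN N) : ℝ := (∫ ξ, wave x ξ * b ξ).re

lemma synth_eq_fourierInv (b : RN N → ℂ) (x : RN N) : synth b x = (𝓕⁻ b x).re := by
  rw [synth, Real.fourierInv_eq']
  simp only [wave, smul_eq_mul]

/-- An integrable weight. -/
noncomputable def decayWeight (ξ : RN N) : ℝ := (1 + ‖ξ‖) ^ (-((N : ℝ) + 1))

lemma decayWeight_nonneg (ξ : RN N) : 0 ≤ decayWeight ξ := by
  unfold decayWeight; positivity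

lemma integrable_decayWeight : Integrable (decayWeight : RN N → ℝ) :=
  integrable_one_add_norm (by simp)

/-- Decay of an amplitude, with two moments to spare. -/
structure HasDecay (b : RN N → ℂ) (C : ℝ) : Prop where
  measurable : Measurable b
  bound : ∀ ξ, (1 + ‖ξ‖) ^ 2 * ‖b ξ‖ ≤ C * decayWeight ξ

namespace HasDecay

variable {b : RN N → ℂ} {C : ℝ}

lemma pow_mul_le (h : HasDecay b C) {n : ℕ} (hn : n ≤ 2) (ξ : RN N) :
    ‖ξ‖ ^ n * ‖b ξ‖ ≤ C * decayWeight ξ := by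
  refine le_trans ?_ (h.bound ξ)
  have h0 : 0 ≤ ‖ξ‖ := norm_nonneg ξ
  gcongr
  calc ‖ξ‖ ^ n ≤ (1 + ‖ξ‖) ^ n := by gcongr; linarith
    _ ≤ (1 + ‖ξ‖) ^ 2 := pow_le_pow_right₀ (by linarith) hn

lemma integrable_pow_mul (h : HasDecay b C) {n : ℕ} (hn : n ≤ 2) :
    Integrable fun ξ => ‖ξ‖ ^ n * ‖b ξ‖ :=
  (integrable_decayWeight.const_mul C).mono'
    ((by fun_prop : Measurable fun ξ : RN N => ‖ξ‖ ^ n).mul h.measurable.norm).aestronglyMeasurable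
    (Filter.Eventually.of_forall fun ξ => by
      rw [Real.norm_of_nonneg (by positivity)]; exact h.pow_mul_le hn ξ)

lemma norm_le (h : HasDecay b C) (ξ : RN N) : ‖b ξ‖ ≤ C * decayWeight ξ := by
  simpa using h.pow_mul_le (n := 0) (by norm_num) ξ

lemma integrable (h : HasDecay b C) : Integrable b :=
  (integrable_decayWeight.const_mul C).mono' h.measurable.aestronglyMeasurable
    (Filter.Eventually.of_forall h.norm_le)

end HasDecay

lemma fourierInv_eq_comp_neg (b : RN N → ℂ) : 𝓕⁻ b = 𝓕 fun ξ => b (-ξ) := by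
  funext x
  rw [Real.fourierInv_eq_fourier_comp_neg]

lemma fderiv_fourierInv_apply {b : RN N → ℂ} (h0 : Integrable b)
    (h1 : Integrable fun ξ => ‖ξ‖ * ‖b ξ‖) (x v : RN N) :
    fderiv ℝ (𝓕⁻ b) x v = 𝓕⁻ (fun ξ => ((2 * Real.pi * inner ℝ ξ v : ℝ) * I) * b ξ) x := by
  have h0' : Integrable fun ξ => b (-ξ) := h0.comp_neg
  have h1' : Integrable fun ξ => ‖ξ‖ * ‖b (-ξ)‖ := by simpa using h1.comp_neg
  have h2 : Integrable (VectorFourier.fourierSMulRight (innerSL ℝ) fun ξ : RN N => b (-ξ)) := by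
    refine (h1'.const_mul (2 * Real.pi * ‖(innerSL ℝ : RN N →L[ℝ] _)‖)).mono'
      h0'.aestronglyMeasurable.fourierSMulRight (Filter.Eventually.of_forall fun ξ => ?_)
    refine (VectorFourier.norm_fourierSMulRight_le _ _ _).trans (le_of_eq ?_)
    ring
  suffices h3 : (fun ξ => VectorFourier.fourierSMulRight (innerSL ℝ) (fun ξ : RN N => b (-ξ)) ξ v)
      = fun ξ => ((2 * Real.pi * inner ℝ (-ξ) v : ℝ) * I) * b (-ξ) by
    rw [fourierInv_eq_comp_neg, Real.fderiv_fourier h0' h1', fourierInv_eq_comp_neg,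
      Real.fourier_continuousLinearMap_apply h2, h3]
  funext ξ
  change -(2 * Real.pi * I) • ((inner ℝ ξ v : ℝ) • b (-ξ)) = _
  simp only [inner_neg_left, real_smul, smul_eq_mul]
  push_cast; ring

lemma contDiff_fourierInv {b : RN N → ℂ} {C : ℝ} (h : HasDecay b C) : ContDiff ℝ 2 (𝓕⁻ b) := by
  rw [fourierInv_eq_comp_neg]
  exact_mod_cast Real.contDiff_fourier (N := 2) fun n hn => by
    simpa using (h.integrable_pow_mul (n := n) (by exact_mod_cast hn)).comp_neg

lemma contDiff_synth {b : RN N → ℂ} {C : ℝ} (h : HasDecay b C) : ContDiff ℝ 2 (synth b) := by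
  have : synth b = fun x => reCLM (𝓕⁻ b x) := funext (synth_eq_fourierInv b)
  rw [this]
  exact reCLM.contDiff.comp (contDiff_fourierInv h)

/-- The symbol of the second derivative. -/
noncomputable def secondSymbol (i j : Fin N) (ξ : RN N) : ℂ := ((-(4 * Real.pi ^ 2 * ξ i * ξ j) : ℝ) : ℂ)

lemma continuous_secondSymbol (i j : Fin N) : Continuous (secondSymbol i j : RN N → ℂ) := by
  unfold secondSymbol
  fun_prop

lemma norm_secondSymbol_le (i j : Fin N) (ξ : RN N) :
    ‖secondSymbol i j ξ‖ ≤ 4 * Real.pi ^ 2 * (1 + ‖ξ‖) ^ 2 := by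
  rw [secondSymbol, norm_real, norm_neg]
  simp only [norm_mul, norm_pow, Real.norm_eq_abs, abs_of_pos Real.pi_pos, Nat.abs_ofNat]
  have hi : |ξ i| ≤ 1 + ‖ξ‖ := (PiLp.norm_apply_le ξ i).trans (by linarith)
  have hj : |ξ j| ≤ 1 + ‖ξ‖ := (PiLp.norm_apply_le ξ j).trans (by linarith)
  rw [mul_assoc, sq (1 + ‖ξ‖)]
  gcongr

lemma norm_secondSymbol_mul_le {b : RN N → ℂ} {C : ℝ} (h : HasDecay b C) (i j : Fin N) (ξ : RN N) :
    ‖secondSymbol i j ξ * b ξ‖ ≤ 4 * Real.pi ^ 2 * C * decayWeight ξ := by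
  rw [norm_mul]
  calc ‖secondSymbol i j ξ‖ * ‖b ξ‖ ≤ 4 * Real.pi ^ 2 * (1 + ‖ξ‖) ^ 2 * ‖b ξ‖ := by
        gcongr; exact norm_secondSymbol_le i j ξ
    _ = 4 * Real.pi ^ 2 * ((1 + ‖ξ‖) ^ 2 * ‖b ξ‖) := by ring
    _ ≤ 4 * Real.pi ^ 2 * (C * decayWeight ξ) := mul_le_mul_of_nonneg_left (h.bound ξ) (by positivity)
    _ = _ := by ring

lemma integrable_secondSymbol_mul {b : RN N → ℂ} {C : ℝ} (h : HasDecay b C) (i j : Fin N) :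
    Integrable fun ξ => secondSymbol i j ξ * b ξ :=
  (integrable_decayWeight.const_mul (4 * Real.pi ^ 2 * C)).mono'
    ((continuous_secondSymbol i j).measurable.mul h.measurable).aestronglyMeasurable
    (Filter.Eventually.of_forall (norm_secondSymbol_mul_le h i j))

/-- Each derivative under the inverse transform costs one moment of the amplitude; the two spare
moments of `HasDecay` pay for both. -/
lemma hessianMatrix_synth {b : RN N → ℂ} {C : ℝ} (h : HasDecay b C) (x : RN N) (i j : Fin N) :
    hessianMatrix (synth b) x i j = synth (fun ξ => secondSymbol i j ξ * b ξ) x := by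
  have hb1 : Integrable fun ξ => ‖ξ‖ * ‖b ξ‖ := by simpa using h.integrable_pow_mul (n := 1) (by norm_num)
  set b' : RN N → ℂ := fun ξ =>
    ((2 * Real.pi * inner ℝ ξ (EuclideanSpace.single j 1 : RN N) : ℝ) * I) * b ξ with hb'
  have hin : ∀ (k : Fin N) (ξ : RN N), inner ℝ ξ (EuclideanSpace.single k 1 : RN N) = ξ k :=
    fun k ξ => by simp [EuclideanSpace.inner_single_right]
  have hnb' : ∀ ξ, ‖b' ξ‖ ≤ 2 * Real.pi * (‖ξ‖ * ‖b ξ‖) := fun ξ => by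
    simp only [hb', hin, norm_mul, norm_real, norm_I, mul_one, Real.norm_eq_abs, abs_of_pos Real.pi_pos,
      Nat.abs_ofNat]
    rw [mul_assoc]
    gcongr
    exact PiLp.norm_apply_le ξ j
  have hmb' : AEStronglyMeasurable b' := by
    refine ((Continuous.measurable (by fun_prop)).mul h.measurable).aestronglyMeasurable
  have hb'0 : Integrable b' :=
    (hb1.const_mul (2 * Real.pi)).mono' hmb' (Filter.Eventually.of_forall hnb')
  have hb'1 : Integrable fun ξ => ‖ξ‖ * ‖b' ξ‖ := by
    refine ((h.integrable_pow_mul (n := 2) le_rfl).const_mul (2 * Real.pi)).mono'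
      (continuous_norm.aestronglyMeasurable.mul hmb'.norm) (Filter.Eventually.of_forall fun ξ => ?_)
    rw [Real.norm_of_nonneg (by positivity)]
    calc ‖ξ‖ * ‖b' ξ‖ ≤ ‖ξ‖ * (2 * Real.pi * (‖ξ‖ * ‖b ξ‖)) := by gcongr; exact hnb' ξ
      _ = _ := by ring
  have hs : synth b = fun x => reCLM (𝓕⁻ b x) := funext (synth_eq_fourierInv b)
  have hdb : Differentiable ℝ (𝓕⁻ b) := (contDiff_fourierInv h).differentiable (by simp)
  have e1 : (fun x => fderiv ℝ (synth b) x (EuclideanSpace.single j 1)) = fun x => reCLM (𝓕⁻ b' x) := by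
    funext x
    rw [hs, show (fun x => reCLM (𝓕⁻ b x)) = reCLM ∘ 𝓕⁻ b from rfl,
      (reCLM.hasFDerivAt.comp x (hdb x).hasFDerivAt).fderiv]
    simp only [ContinuousLinearMap.comp_apply]
    rw [fderiv_fourierInv_apply h.integrable hb1]
  have hdb' : Differentiable ℝ (𝓕⁻ b') := by
    rw [fourierInv_eq_comp_neg]
    exact Real.differentiable_fourier hb'0.comp_neg (by simpa using hb'1.comp_neg)
  simp only [hessianMatrix, Matrix.of_apply]
  rw [fderiv_fderiv_apply (contDiff_synth h), e1,
    show (fun x => reCLM (𝓕⁻ b' x)) = reCLM ∘ 𝓕⁻ b' from rfl,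
    (reCLM.hasFDerivAt.comp x (hdb' x).hasFDerivAt).fderiv]
  simp only [ContinuousLinearMap.comp_apply]
  rw [fderiv_fourierInv_apply hb'0 hb'1, synth_eq_fourierInv]
  simp only [reCLM_apply]
  congr 2
  refine congrFun (congrArg _ (funext fun ξ => ?_)) x
  simp only [hb', hin, secondSymbol]
  push_cast
  linear_combination (4 * (Real.pi : ℂ) ^ 2 * ξ i * ξ j * b ξ) * I_mul_I

lemma integrable_wave_mul {b : RN N → ℂ} (hb : Integrable b) (x : RN N) :
    Integrable fun ξ => wave x ξ * b ξ := by
  refine hb.norm.mono' ((continuous_wave.comp (Continuous.prodMk_right x)).aestronglyMeasurable.mul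
    hb.aestronglyMeasurable) (Filter.Eventually.of_forall fun ξ => ?_)
  rw [norm_mul, norm_wave, one_mul]

lemma synth_add {b c : RN N → ℂ} (hb : Integrable b) (hc : Integrable c) (x : RN N) :
    synth (fun ξ => b ξ + c ξ) x = synth b x + synth c x := by
  simp only [synth, mul_add]
  rw [integral_add (integrable_wave_mul hb x) (integrable_wave_mul hc x), add_re]

lemma synth_real_mul (r : ℝ) (b : RN N → ℂ) (x : RN N) :
    synth (fun ξ => (r : ℂ) * b ξ) x = r * synth b x := by
  simp only [synth]
  rw [← re_ofReal_mul, ← integral_const_mul]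
  congr 2
  funext ξ; ring

lemma synth_sum {ι : Type*} (s : Finset ι) {b : ι → RN N → ℂ} (hb : ∀ i ∈ s, Integrable (b i)) (x : RN N) :
    synth (fun ξ => ∑ i ∈ s, b i ξ) x = ∑ i ∈ s, synth (b i) x := by
  simp only [synth, Finset.mul_sum]
  rw [integral_finsetSum _ fun i hi => integrable_wave_mul (hb i hi) x, re_sum]

lemma synth_wave_mul (b : RN N → ℂ) (x y : RN N) :
    synth (fun ξ => wave y ξ * b ξ) x = synth b (x + y) := by
  simp only [synth, wave_add, mul_assoc]

lemma abs_synth_le {b : RN N → ℂ} {C : ℝ} (h : HasDecay b C) (x : RN N) :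
    |synth b x| ≤ C * ∫ ξ : RN N, decayWeight ξ := by
  rw [synth, ← integral_const_mul]
  refine (abs_re_le_norm _).trans ((norm_integral_le_integral_norm _).trans ?_)
  refine integral_mono (integrable_wave_mul h.integrable x).norm (integrable_decayWeight.const_mul C)
    fun ξ => ?_
  simp only [norm_mul, norm_wave, one_mul]
  exact h.norm_le ξ

end Fourier

/-! ### Fourier transforms of sources. -/

section Source

variable {N : ℕ}

open Complex FourierTransform

/-- Sources defined for all times, vanishing outside `[0, T]`. -/
structure IsSource (T : ℝ) (f : ℝ → RN N → ℝ) : Prop where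
  measurable : Measurable fun q : ℝ × RN N => f q.1 q.2
  zero : ∀ t ∉ Icc 0 T, f t = 0
  smooth : ∀ t, ContDiff ℝ ∞ (f t)
  bounded : ∀ n : ℕ, ∃ M : ℝ, ∀ t z, ‖iteratedFDeriv ℝ n (f t) z‖ ≤ M
  support : ∃ r : ℝ, ∀ t, tsupport (f t) ⊆ Metric.closedBall 0 r

/-- The Fourier transform in space. -/
noncomputable def fhat (f : ℝ → RN N → ℝ) (s : ℝ) (ξ : RN N) : ℂ := 𝓕 (fun x => (f s x : ℂ)) ξ

lemma fhat_eq (f : ℝ → RN N → ℝ) (s : ℝ) (ξ : RN N) :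
    fhat f s ξ = ∫ x, wave (-ξ) x * (f s x : ℂ) := by
  rw [fhat, Real.fourier_eq']
  simp only [wave, inner_neg_right, smul_eq_mul, mul_neg, neg_mul]

lemma one_add_pow_le {x : ℝ} (hx : 0 ≤ x) (k : ℕ) : (1 + x) ^ k ≤ 2 ^ k * (1 + x ^ k) := by
  have hk : 0 ≤ x ^ k := by positivity
  rcases le_total x 1 with h | h
  · calc (1 + x) ^ k ≤ 2 ^ k := by gcongr; linarith
      _ ≤ 2 ^ k * (1 + x ^ k) := le_mul_of_one_le_right (by positivity) (by linarith)
  · calc (1 + x) ^ k ≤ (2 * x) ^ k := by gcongr; linarith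
      _ = 2 ^ k * x ^ k := mul_pow _ _ _
      _ ≤ _ := by gcongr; linarith

/-- The exponent N + 3 is made of N + 1 for the integrable weight and 2 for the spare moments. -/
lemma hasDecay_of_moments {b : RN N → ℂ} (hb : Measurable b) {C0 C1 : ℝ} (h0 : ∀ ξ, ‖b ξ‖ ≤ C0)
    (h1 : ∀ ξ, ‖ξ‖ ^ (N + 3) * ‖b ξ‖ ≤ C1) : HasDecay b (2 ^ (N + 3) * (C0 + C1)) := by
  refine ⟨hb, fun ξ => ?_⟩
  have hpos : 0 < 1 + ‖ξ‖ := by positivity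
  have hw : decayWeight ξ = ((1 + ‖ξ‖) ^ (N + 1))⁻¹ := by
    rw [decayWeight, Real.rpow_neg hpos.le]
    congr 1
    exact_mod_cast Real.rpow_natCast (1 + ‖ξ‖) (N + 1)
  rw [hw, ← div_eq_mul_inv, le_div_iff₀ (pow_pos hpos _)]
  calc (1 + ‖ξ‖) ^ 2 * ‖b ξ‖ * (1 + ‖ξ‖) ^ (N + 1) = (1 + ‖ξ‖) ^ (N + 3) * ‖b ξ‖ := by ring
    _ ≤ 2 ^ (N + 3) * (1 + ‖ξ‖ ^ (N + 3)) * ‖b ξ‖ :=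
      mul_le_mul_of_nonneg_right (one_add_pow_le (norm_nonneg ξ) _) (norm_nonneg _)
    _ = 2 ^ (N + 3) * (‖b ξ‖ + ‖ξ‖ ^ (N + 3) * ‖b ξ‖) := by ring
    _ ≤ 2 ^ (N + 3) * (C0 + C1) :=
      mul_le_mul_of_nonneg_left (add_le_add (h0 ξ) (h1 ξ)) (pow_nonneg zero_le_two _)

namespace IsSource

variable {T : ℝ} {f : ℝ → RN N → ℝ}

lemma hasCompactSupport (hf : IsSource T f) (t : ℝ) : HasCompactSupport (f t) := by
  obtain ⟨r, hr⟩ := hf.support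
  exact (isCompact_closedBall (0 : RN N) r).of_isClosed_subset (isClosed_tsupport _) (hr t)

lemma continuous (hf : IsSource T f) (t : ℝ) : Continuous (f t) := (hf.smooth t).continuous

lemma integrable (hf : IsSource T f) (t : ℝ) : Integrable fun x => (f t x : ℂ) :=
  ((hf.continuous t).integrable_of_hasCompactSupport (hf.hasCompactSupport t)).ofReal

lemma stronglyMeasurable_fhat (hf : IsSource T f) :
    StronglyMeasurable fun q : ℝ × RN N => fhat f q.1 q.2 := by
  simp only [fhat_eq]
  refine StronglyMeasurable.integral_prod_right (f := fun (q : ℝ × RN N) x =>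
    wave (-q.2) x * (f q.1 x : ℂ)) ?_
  refine StronglyMeasurable.mul ?_ ?_
  · exact (continuous_wave.comp (by fun_prop : Continuous fun p : (ℝ × RN N) × RN N =>
      (-p.1.2, p.2))).stronglyMeasurable
  · exact (measurable_ofReal.comp (hf.measurable.comp (by fun_prop :
      Measurable fun p : (ℝ × RN N) × RN N => (p.1.1, p.2)))).stronglyMeasurable

/-- Derivatives bounded uniformly in time, with supports in a common ball, have uniformly bounded L¹
norms; on the Fourier side this is polynomial decay with a constant independent of time. -/
lemma exists_hasDecay (hf : IsSource T f) : ∃ C, 0 ≤ C ∧ ∀ s, HasDecay (fhat f s) C := by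
  obtain ⟨r, hr⟩ := hf.support
  set B : Set (RN N) := Metric.closedBall 0 r
  have hB : volume B < ⊤ := measure_closedBall_lt_top
  have hsm : ∀ s, ContDiff ℝ ∞ fun x => (f s x : ℂ) := fun s => ofRealCLM.contDiff.comp (hf.smooth s)
  have hnorm : ∀ s n x, ‖iteratedFDeriv ℝ n (fun x => (f s x : ℂ)) x‖ = ‖iteratedFDeriv ℝ n (f s) x‖ :=
    fun s n x => ofRealLI.norm_iteratedFDeriv_comp_left (f := f s) (hf.smooth s).contDiffAt
      (i := n) (by exact_mod_cast le_top)
  have hcs : ∀ s n, HasCompactSupport fun x => ‖iteratedFDeriv ℝ n (fun x => (f s x : ℂ)) x‖ :=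
    fun s n => (((hf.hasCompactSupport s).comp_left (g := ((↑) : ℝ → ℂ)) ofReal_zero).iteratedFDeriv
      (𝕜 := ℝ) n).norm
  have hcont : ∀ s n, Continuous fun x => ‖iteratedFDeriv ℝ n (fun x => (f s x : ℂ)) x‖ :=
    fun s n => ((hsm s).continuous_iteratedFDeriv (m := n) (by exact_mod_cast le_top)).norm
  have hzero : ∀ s n x, x ∉ B → iteratedFDeriv ℝ n (f s) x = 0 := fun s n x hx => by
    by_contra h
    exact hx (hr s (support_iteratedFDeriv_subset n h))
  choose M hM using hf.bounded
  have hint : ∀ s n, ∫ x, ‖iteratedFDeriv ℝ n (fun x => (f s x : ℂ)) x‖ ≤ M n * (volume B).toReal := by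
    intro s n
    simp only [hnorm]
    rw [← setIntegral_eq_integral_of_forall_compl_eq_zero (s := B) fun x hx => by
      rw [hzero s n x hx, norm_zero]]
    have := norm_setIntegral_le_of_norm_le_const (f := fun x => ‖iteratedFDeriv ℝ n (f s) x‖)
      (C := M n) hB fun x _ => by simpa using hM n s x
    exact (le_abs_self _).trans this
  -- polynomial decay of every order
  have hdec : ∀ n : ℕ, ∃ C, 0 ≤ C ∧ ∀ s (ξ : RN N), ‖ξ‖ ^ n * ‖fhat f s ξ‖ ≤ C := by
    intro n
    -- The factor `range 1` leaves only the zeroth moment in x, since no frequency derivative is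
    -- taken.
    set C : ℝ := 2 ^ n * ∑ p ∈ Finset.range 1 ×ˢ Finset.range (n + 1), M p.2 * (volume B).toReal
    refine ⟨|C|, abs_nonneg _, fun s ξ => le_trans ?_ (le_abs_self C)⟩
    have := Real.pow_mul_norm_iteratedFDeriv_fourier_le (f := fun x => (f s x : ℂ)) (K := 0) (N := n)
      ((hsm s).of_le (by exact_mod_cast le_top)) (fun k m hk hm => by
        refine Continuous.integrable_of_hasCompactSupport
          ((continuous_norm.pow k).mul (hcont s m)) (hcs s m).mul_left) (k := 0) (n := n) le_rfl le_rfl ξ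
    simp only [norm_iteratedFDeriv_zero] at this
    refine this.trans ?_
    simp only [pow_zero, one_mul, Nat.cast_zero, mul_zero, zero_add, C]
    gcongr with p hp
    have hp1 : p.1 = 0 := by
      simp only [Finset.mem_product, Finset.mem_range] at hp; omega
    simp only [hp1, pow_zero, one_mul]
    exact hint s p.2
  obtain ⟨C0, hC0, h0⟩ := hdec 0
  obtain ⟨C1, hC1, h1⟩ := hdec (N + 3)
  refine ⟨2 ^ (N + 3) * (C0 + C1), by positivity, fun s => hasDecay_of_moments
    (hf.stronglyMeasurable_fhat.measurable.comp (Measurable.prodMk measurable_const measurable_id))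
    (fun ξ => by simpa using h0 s ξ) (h1 s)⟩

lemma synth_fhat (hf : IsSource T f) (s : ℝ) (z : RN N) : synth (fhat f s) z = f s z := by
  obtain ⟨C, -, hC⟩ := hf.exists_hasDecay
  have h : 𝓕⁻ (𝓕 fun x => (f s x : ℂ)) = fun x => (f s x : ℂ) :=
    Continuous.fourierInv_fourier_eq (continuous_ofReal.comp (hf.continuous s)) (hf.integrable s)
      (hC s).integrable
  rw [synth_eq_fourierInv, show fhat f s = 𝓕 fun x => (f s x : ℂ) from rfl, h, ofReal_re]

/-- Translating the source by a time-dependent vector multiplies its Fourier transform by a wave. -/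
lemma fhat_translate (f : ℝ → RN N → ℝ) (c : ℝ → RN N) (s : ℝ) (ξ : RN N) :
    fhat (fun s x => f s (x + c s)) s ξ = wave (c s) ξ * fhat f s ξ := by
  simp only [fhat_eq]
  rw [← integral_add_right_eq_self (fun x => wave (-ξ) x * (f s x : ℂ)) (c s), ← integral_const_mul]
  congr 1
  funext x
  rw [← mul_assoc]
  congr 1
  simp only [wave, ← exp_add, inner_add_left, inner_neg_right, real_inner_comm ξ (c s)]
  congr 1
  rw [real_inner_comm]
  push_cast; ring

end IsSource

end Source

/-! ### Duhamel's identity. -/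

section Duhamel

open Complex

/-- Duhamel's formula in integral form. -/
lemma integral_duhamel {l : ℝ → ℝ} (hl : Continuous l) {F : ℝ → ℂ} (hFm : Measurable F) {t : ℝ}
    (hF : IntegrableOn F (Ioc 0 t)) {L : ℝ → ℝ} (hL : ∀ s, HasDerivAt L (l s) s) :
    ∫ s in Ioc 0 t, (l s : ℂ) * ∫ r in Ioc 0 s, (Real.exp (-(L s - L r)) : ℂ) * F r
      = (∫ r in Ioc 0 t, F r) - ∫ r in Ioc 0 t, (Real.exp (-(L t - L r)) : ℂ) * F r := by
  have hLc : Continuous L := continuous_iff_continuousAt.2 fun s => (hL s).continuousAt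
  set I := Ioc (0 : ℝ) t with hI
  have hkc : Continuous fun x : ℝ × ℝ => l x.1 * Real.exp (-(L x.1 - L x.2)) := by fun_prop
  obtain ⟨B, hB⟩ := (isCompact_Icc.prod isCompact_Icc : IsCompact (Icc 0 t ×ˢ Icc 0 t)).exists_bound_of_continuousOn
    hkc.continuousOn
  -- The triangle r ≤ s is encoded by an indicator on the square, so that the order of integration
  -- can be exchanged there.
  set K : ℝ → ℝ → ℂ := fun s r =>
    (Iic s).indicator (fun r => ((l s * Real.exp (-(L s - L r)) : ℝ) : ℂ) * F r) r with hK
  have hKm : Measurable (Function.uncurry K) := by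
    have : Function.uncurry K = {x : ℝ × ℝ | x.2 ≤ x.1}.indicator fun x =>
        ((l x.1 * Real.exp (-(L x.1 - L x.2)) : ℝ) : ℂ) * F x.2 := by
      funext x
      simp only [Function.uncurry, hK, indicator, mem_Iic, mem_ofPred_eq]
    rw [this]
    refine Measurable.indicator ?_ (measurableSet_le measurable_snd measurable_fst)
    exact (measurable_ofReal.comp hkc.measurable).mul (hFm.comp measurable_snd)
  have hKi : Integrable (Function.uncurry K) ((volume.restrict I).prod (volume.restrict I)) := by
    have hdom : Integrable (fun x : ℝ × ℝ => B * ‖F x.2‖)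
        ((volume.restrict I).prod (volume.restrict I)) :=
      ((integrable_const (1 : ℝ)).mul_prod (Integrable.norm hF)).const_mul B
        |>.congr (Filter.Eventually.of_forall fun x => by simp)
    refine hdom.mono' hKm.aestronglyMeasurable ?_
    have h1 : ∀ᵐ x : ℝ × ℝ ∂((volume.restrict I).prod (volume.restrict I)), x.1 ∈ I :=
      Measure.quasiMeasurePreserving_fst.ae (ae_restrict_mem measurableSet_Ioc)
    have h2 : ∀ᵐ x : ℝ × ℝ ∂((volume.restrict I).prod (volume.restrict I)), x.2 ∈ I :=
      Measure.quasiMeasurePreserving_snd.ae (ae_restrict_mem measurableSet_Ioc)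
    filter_upwards [h1, h2] with x hx1 hx2
    refine (norm_indicator_le_norm_self
      (fun r => ((l x.1 * Real.exp (-(L x.1 - L r)) : ℝ) : ℂ) * F r) x.2).trans ?_
    rw [norm_mul, norm_real]
    gcongr
    exact hB x ⟨Ioc_subset_Icc_self hx1, Ioc_subset_Icc_self hx2⟩
  have hleft : ∀ s ∈ I, (l s : ℂ) * ∫ r in Ioc 0 s, (Real.exp (-(L s - L r)) : ℂ) * F r
      = ∫ r in I, K s r := by
    intro s hs
    have hIs : I ∩ Iic s = Ioc 0 s := by
      ext r; simp only [hI, mem_inter_iff, mem_Ioc, mem_Iic]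
      exact ⟨fun h => ⟨h.1.1, h.2⟩, fun h => ⟨⟨h.1, h.2.trans hs.2⟩, h.2⟩⟩
    rw [setIntegral_indicator measurableSet_Iic, hIs, ← integral_const_mul]
    congr 1; funext r; push_cast; ring
  -- In s the kernel is the derivative of -exp(-(L s - L r)), so its integral over [r, t] is
  -- explicit.
  have hright : ∀ r ∈ I, ∫ s in I, K s r = F r - (Real.exp (-(L t - L r)) : ℂ) * F r := by
    intro r hr
    have hIr : I ∩ Ici r = Icc r t := by
      ext s; simp only [hI, mem_inter_iff, mem_Ioc, mem_Ici, mem_Icc]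
      exact ⟨fun h => ⟨h.2, h.1.2⟩, fun h => ⟨⟨hr.1.trans_le h.1, h.2⟩, h.1⟩⟩
    have e1 : ∀ s, K s r = (Ici r).indicator (fun s =>
        ((l s * Real.exp (-(L s - L r)) : ℝ) : ℂ) * F r) s := fun s => by
      simp only [hK, indicator, mem_Iic, mem_Ici]
    simp only [e1]
    rw [setIntegral_indicator measurableSet_Ici, hIr, integral_mul_const, integral_complex_ofReal,
      integral_Icc_eq_integral_Ioc, ← intervalIntegral.integral_of_le hr.2]
    have hder : ∀ s ∈ uIcc r t, HasDerivAt (fun s => -Real.exp (-(L s - L r)))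
        (l s * Real.exp (-(L s - L r))) s := fun s _ => by
      have := ((((hL s).sub_const (L r)).fun_neg).exp).fun_neg
      exact this.congr_deriv (by ring)
    rw [intervalIntegral.integral_eq_sub_of_hasDerivAt hder
      ((by fun_prop : Continuous fun s => l s * Real.exp (-(L s - L r))).intervalIntegrable _ _)]
    simp only [sub_self, neg_zero, Real.exp_zero]
    push_cast; ring
  rw [setIntegral_congr_fun measurableSet_Ioc hleft, integral_integral_swap hKi,
    setIntegral_congr_fun measurableSet_Ioc hright, integral_sub hF]
  have hbd : ∃ B, ∀ r ∈ Icc 0 t, ‖Real.exp (-(L t - L r))‖ ≤ B :=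
    isCompact_Icc.exists_bound_of_continuousOn
      (by fun_prop : Continuous fun r => Real.exp (-(L t - L r))).continuousOn
  obtain ⟨B', hB'⟩ := hbd
  refine (Integrable.norm hF |>.const_mul B').mono' (((measurable_ofReal.comp
    (by fun_prop : Continuous fun r => Real.exp (-(L t - L r))).measurable).mul hFm).aestronglyMeasurable) ?_
  filter_upwards [ae_restrict_mem measurableSet_Ioc] with r hr
  simp only [norm_mul, norm_real]
  gcongr
  exact hB' r (Ioc_subset_Icc_self hr)

end Duhamel

/-! ### Superpositions of a source with a symbol. -/

section Amplitude

variable {N : ℕ}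

open Complex

/-- Measurable multipliers `m(r, t, ξ)` of modulus at most one for `r ≤ t`. -/
structure IsSymbol (m : ℝ → ℝ → RN N → ℝ) : Prop where
  measurable : Measurable fun p : ℝ × ℝ × RN N => m p.1 p.2.1 p.2.2
  bound : ∀ r t ξ, r ≤ t → |m r t ξ| ≤ 1

/-- The amplitude at time `t` of the superposition with symbol `m` of the source `f`. -/
noncomputable def amp (m : ℝ → ℝ → RN N → ℝ) (f : ℝ → RN N → ℝ) (t : ℝ) (ξ : RN N) : ℂ :=
  ∫ r in Ioc 0 t, (m r t ξ : ℂ) * fhat f r ξ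

/-- The superposition with symbol `m` of the source `f`. -/
noncomputable def superpose (m : ℝ → ℝ → RN N → ℝ) (f : ℝ → RN N → ℝ) (t : ℝ) (x : RN N) : ℝ :=
  synth (amp m f t) x

variable {m : ℝ → ℝ → RN N → ℝ} {f : ℝ → RN N → ℝ} {T C : ℝ}

lemma measurable_fhat_left (hf : IsSource T f) (ξ : RN N) : Measurable fun r => fhat f r ξ :=
  hf.stronglyMeasurable_fhat.measurable.comp (g := fun q : ℝ × RN N => fhat f q.1 q.2)
    (f := fun r : ℝ => (r, ξ)) (by fun_prop)

lemma integrableOn_fhat (hf : IsSource T f) (a b : ℝ) (ξ : RN N) :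
    IntegrableOn (fun r => fhat f r ξ) (Ioc a b) := by
  obtain ⟨C, hC0, hC⟩ := hf.exists_hasDecay
  exact (integrable_const (C * decayWeight ξ)).mono' (measurable_fhat_left hf ξ).aestronglyMeasurable
    (Filter.Eventually.of_forall fun r => (hC r).norm_le ξ)

lemma integrableOn_symbol_mul (hm : IsSymbol m) (hf : IsSource T f) (t : ℝ) (ξ : RN N) :
    IntegrableOn (fun r => (m r t ξ : ℂ) * fhat f r ξ) (Ioc 0 t) := by
  refine (Integrable.norm (integrableOn_fhat hf 0 t ξ)).mono' ?_ ?_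
  · have h1 : Measurable fun r => m r t ξ := hm.measurable.comp
      (f := fun r => (r, t, ξ)) (by fun_prop)
    exact ((measurable_ofReal.comp h1).mul (measurable_fhat_left hf ξ)).aestronglyMeasurable
  · filter_upwards [ae_restrict_mem measurableSet_Ioc] with r hr
    rw [norm_mul, norm_real]
    exact mul_le_of_le_one_left (norm_nonneg _) (hm.bound r t ξ hr.2)

lemma stronglyMeasurable_amp (hm : IsSymbol m) (hf : IsSource T f) :
    StronglyMeasurable fun q : ℝ × RN N => amp m f q.1 q.2 := by
  have : (fun q : ℝ × RN N => amp m f q.1 q.2) = fun q : ℝ × RN N =>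
      ∫ r, {p : (ℝ × RN N) × ℝ | 0 < p.2 ∧ p.2 ≤ p.1.1}.indicator
        (fun p => (m p.2 p.1.1 p.1.2 : ℂ) * fhat f p.2 p.1.2) (q, r) := by
    funext q
    rw [amp, ← integral_indicator measurableSet_Ioc]
    rfl
  rw [this]
  refine StronglyMeasurable.integral_prod_right' (StronglyMeasurable.indicator ?_ ?_)
  · refine StronglyMeasurable.mul ?_ ?_
    · exact (measurable_ofReal.comp (hm.measurable.comp
        (f := fun p : (ℝ × RN N) × ℝ => (p.2, p.1.1, p.1.2)) (by fun_prop))).stronglyMeasurable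
    · exact hf.stronglyMeasurable_fhat.comp_measurable
        (g := fun p : (ℝ × RN N) × ℝ => (p.2, p.1.2)) (by fun_prop)
  · exact (measurableSet_lt measurable_const measurable_snd).inter
      (measurableSet_le measurable_snd (measurable_fst.comp measurable_fst))

lemma hasDecay_amp (hm : IsSymbol m) (hf : IsSource T f) (hT : 0 ≤ T) (hC0 : 0 ≤ C)
    (hC : ∀ s, HasDecay (fhat f s) C) {t : ℝ} (ht : t ≤ T) : HasDecay (amp m f t) (T * C) where
  measurable := (stronglyMeasurable_amp hm hf).measurable.comp
    (g := fun q : ℝ × RN N => amp m f q.1 q.2) (f := fun ξ : RN N => (t, ξ)) (by fun_prop)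
  bound := fun ξ => by
    have hw := decayWeight_nonneg ξ
    have h1 : ∀ r ∈ Ioc 0 t, ‖((1 + ‖ξ‖ : ℝ) ^ 2 : ℝ) * ((m r t ξ : ℂ) * fhat f r ξ)‖
        ≤ C * decayWeight ξ := fun r hr => by
      rw [norm_mul, norm_mul, norm_real, norm_real, Real.norm_of_nonneg (by positivity)]
      refine le_trans ?_ ((hC r).bound ξ)
      gcongr
      exact mul_le_of_le_one_left (norm_nonneg _) (hm.bound r t ξ hr.2)
    have h2 := norm_setIntegral_le_of_norm_le_const (μ := (volume : Measure ℝ)) (by simp) h1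
    rw [integral_const_mul, norm_mul, norm_real, Real.norm_of_nonneg (by positivity)] at h2
    refine h2.trans ?_
    rw [Measure.real, Real.volume_Ioc, sub_zero, ENNReal.toReal_ofReal']
    calc C * decayWeight ξ * max t 0 ≤ C * decayWeight ξ * T := by gcongr; exact max_le ht hT
      _ = _ := by ring

lemma measurable_synth_amp (hm : IsSymbol m) (hf : IsSource T f) {κ : RN N → ℂ}
    (hκ : Measurable κ) :
    StronglyMeasurable fun q : ℝ × RN N => synth (fun ξ => κ ξ * amp m f q.1 ξ) q.2 := by
  have h1 : StronglyMeasurable fun q : ℝ × RN N => ∫ ξ, wave q.2 ξ * (κ ξ * amp m f q.1 ξ) := by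
    refine StronglyMeasurable.integral_prod_right' (f := fun p : (ℝ × RN N) × RN N =>
      wave p.1.2 p.2 * (κ p.2 * amp m f p.1.1 p.2)) ?_
    refine StronglyMeasurable.mul ?_ (StronglyMeasurable.mul ?_ ?_)
    · exact (continuous_wave.comp (by fun_prop :
        Continuous fun p : (ℝ × RN N) × RN N => (p.1.2, p.2))).stronglyMeasurable
    · exact (hκ.comp measurable_snd).stronglyMeasurable
    · exact (stronglyMeasurable_amp hm hf).comp_measurable
        (g := fun p : (ℝ × RN N) × RN N => (p.1.1, p.2)) (by fun_prop)
  exact continuous_re.comp_stronglyMeasurable h1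

end Amplitude

/-! ### The Gaussian propagator and existence of solutions. -/

section Gaussian

variable {N : ℕ}

open Complex

/-- The symbol `4 π² ξ · P ξ` of `-Tr(P D²)`. -/
noncomputable def traceSymbol (P : Matrix (Fin N) (Fin N) ℝ) (ξ : RN N) : ℝ :=
  4 * Real.pi ^ 2 * ((ξ : Fin N → ℝ) ⬝ᵥ P.mulVec (ξ : Fin N → ℝ))

lemma traceSymbol_nonneg {P : Matrix (Fin N) (Fin N) ℝ} (hP : P.PosSemidef) (ξ : RN N) :
    0 ≤ traceSymbol P ξ := by
  have := hP.dotProduct_mulVec_nonneg (ξ : Fin N → ℝ)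
  simp only [star_trivial] at this
  unfold traceSymbol; positivity

lemma traceSymbol_add (P P' : Matrix (Fin N) (Fin N) ℝ) (ξ : RN N) :
    traceSymbol (P + P') ξ = traceSymbol P ξ + traceSymbol P' ξ := by
  simp only [traceSymbol, Matrix.add_mulVec, dotProduct_add]; ring

lemma continuous_traceSymbol {A : ℝ → Matrix (Fin N) (Fin N) ℝ} (hA : Continuous A) :
    Continuous fun p : ℝ × RN N => traceSymbol (A p.1) p.2 := by
  simp only [traceSymbol, dotProduct, Matrix.mulVec]
  have h : ∀ i j, Continuous fun p : ℝ × RN N => A p.1 i j := fun i j =>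
    (hA.comp continuous_fst).matrix_elem i j
  have h' : ∀ i, Continuous fun p : ℝ × RN N => p.2 i := fun i => by fun_prop
  exact continuous_const.mul (continuous_finsetSum _ fun i _ => (h' i).mul
    (continuous_finsetSum _ fun j _ => (h i j).mul (h' j)))

/-- The exponent of the Gaussian propagator. -/
noncomputable def gaussExponent (A : ℝ → Matrix (Fin N) (Fin N) ℝ) (t : ℝ) (ξ : RN N) : ℝ :=
  ∫ s in (0 : ℝ)..t, traceSymbol (A s) ξ

/-- The symbol of the Gaussian propagator. -/
noncomputable def gaussSymbol (A : ℝ → Matrix (Fin N) (Fin N) ℝ) (r t : ℝ) (ξ : RN N) : ℝ :=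
  Real.exp (-(gaussExponent A t ξ - gaussExponent A r ξ))

variable {A : ℝ → Matrix (Fin N) (Fin N) ℝ}

lemma continuous_traceSymbol_left (hA : Continuous A) (ξ : RN N) :
    Continuous fun t => traceSymbol (A t) ξ :=
  (continuous_traceSymbol hA).comp (Continuous.prodMk_left ξ)

lemma continuous_gaussExponent (hA : Continuous A) :
    Continuous fun p : ℝ × RN N => gaussExponent A p.1 p.2 := by
  refine intervalIntegral.continuous_parametric_intervalIntegral_of_continuous
    (f := fun (p : ℝ × RN N) s => traceSymbol (A s) p.2) ?_ continuous_fst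
  exact (continuous_traceSymbol hA).comp (by fun_prop :
    Continuous fun q : (ℝ × RN N) × ℝ => (q.2, q.1.2))

lemma hasDerivAt_gaussExponent (hA : Continuous A) (ξ : RN N) (t : ℝ) :
    HasDerivAt (fun t => gaussExponent A t ξ) (traceSymbol (A t) ξ) t :=
  (continuous_traceSymbol_left hA ξ).integral_hasStrictDerivAt 0 t |>.hasDerivAt

lemma gaussExponent_sub (hA : Continuous A) (ξ : RN N) (r t : ℝ) :
    gaussExponent A t ξ - gaussExponent A r ξ = ∫ s in r..t, traceSymbol (A s) ξ :=
  intervalIntegral.integral_interval_sub_left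
    ((continuous_traceSymbol_left hA ξ).intervalIntegrable _ _)
    ((continuous_traceSymbol_left hA ξ).intervalIntegrable _ _)

lemma gaussExponent_mono (hA : Continuous A) (hApos : ∀ t, (A t).PosSemidef) (ξ : RN N) :
    Monotone fun t => gaussExponent A t ξ := fun r t h => by
  have := intervalIntegral.integral_nonneg (μ := volume) h fun s _ => traceSymbol_nonneg (hApos s) ξ
  rw [← gaussExponent_sub hA] at this
  simpa using this

lemma isSymbol_gaussSymbol (hA : Continuous A) (hApos : ∀ t, (A t).PosSemidef) :
    IsSymbol (gaussSymbol A) where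
  measurable := by
    have h1 : Continuous fun p : ℝ × ℝ × RN N => gaussExponent A p.2.1 p.2.2 :=
      (continuous_gaussExponent hA).comp (by fun_prop :
        Continuous fun p : ℝ × ℝ × RN N => (p.2.1, p.2.2))
    have h2 : Continuous fun p : ℝ × ℝ × RN N => gaussExponent A p.1 p.2.2 :=
      (continuous_gaussExponent hA).comp (by fun_prop :
        Continuous fun p : ℝ × ℝ × RN N => (p.1, p.2.2))
    exact (Real.continuous_exp.comp (h1.sub h2).neg).measurable
  bound := fun r t ξ h => by
    rw [gaussSymbol, Real.abs_exp, Real.exp_le_one_iff]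
    have := gaussExponent_mono hA hApos ξ h
    simp only at this
    linarith

variable {m : ℝ → ℝ → RN N → ℝ} {f : ℝ → RN N → ℝ} {T C : ℝ}

lemma sum_secondSymbol (P : Matrix (Fin N) (Fin N) ℝ) (ξ : RN N) :
    ∑ i, ∑ j, (P i j : ℂ) * secondSymbol j i ξ = -(traceSymbol P ξ : ℂ) := by
  simp only [secondSymbol, traceSymbol, dotProduct, Matrix.mulVec, Finset.mul_sum]
  push_cast
  simp only [← Finset.sum_neg_distrib]
  exact Finset.sum_congr rfl fun i _ => Finset.sum_congr rfl fun j _ => by ring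

lemma trace_mul_hessianMatrix_synth {b : RN N → ℂ} (h : HasDecay b C)
    (P : Matrix (Fin N) (Fin N) ℝ) (x : RN N) :
    (P * hessianMatrix (synth b) x).trace = synth (fun ξ => -(traceSymbol P ξ : ℂ) * b ξ) x := by
  have e : (fun ξ => -(traceSymbol P ξ : ℂ) * b ξ)
      = fun ξ => ∑ i, ∑ j, (P i j : ℂ) * (secondSymbol j i ξ * b ξ) := by
    funext ξ
    rw [← sum_secondSymbol, Finset.sum_mul]
    refine Finset.sum_congr rfl fun i _ => ?_
    rw [Finset.sum_mul]
    exact Finset.sum_congr rfl fun j _ => by ring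
  have hi : ∀ i j, Integrable fun ξ => (P i j : ℂ) * (secondSymbol j i ξ * b ξ) := fun i j =>
    (integrable_secondSymbol_mul h j i).const_mul _
  rw [e, synth_sum _ fun i _ => integrable_finsetSum _ fun j _ => hi i j]
  simp only [synth_sum _ fun j _ => hi _ j, synth_real_mul, Matrix.trace, Matrix.diag,
    Matrix.mul_apply, hessianMatrix_synth h]

lemma norm_traceSymbol_mul_le {b : RN N → ℂ} (h : HasDecay b C)
    {P : Matrix (Fin N) (Fin N) ℝ} {β : ℝ} (hβ0 : 0 ≤ β) (hβ : ∀ i j, |P i j| ≤ β) (ξ : RN N) :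
    ‖(traceSymbol P ξ : ℂ) * b ξ‖ ≤ N * (N * (β * (4 * Real.pi ^ 2 * C * decayWeight ξ))) := by
  rw [← norm_neg, ← neg_mul, ← sum_secondSymbol, Finset.sum_mul]
  have hw := decayWeight_nonneg ξ
  refine (norm_sum_le _ _).trans ((Finset.sum_le_card_nsmul _ _
    (N * (β * (4 * Real.pi ^ 2 * C * decayWeight ξ))) fun i _ => ?_).trans (by simp))
  rw [Finset.sum_mul]
  refine (norm_sum_le _ _).trans ((Finset.sum_le_card_nsmul _ _
    (β * (4 * Real.pi ^ 2 * C * decayWeight ξ)) fun j _ => ?_).trans (by simp))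
  rw [mul_assoc, norm_mul, norm_real]
  exact mul_le_mul (hβ i j) (norm_secondSymbol_mul_le h j i ξ) (norm_nonneg _) hβ0

/-- This is the equation at a fixed frequency in integral form: there Tr(A D²) acts as
multiplication by minus `traceSymbol`. -/
lemma amp_gaussSymbol_eq (hA : Continuous A) (hf : IsSource T f) (t : ℝ) (ξ : RN N) :
    amp (gaussSymbol A) f t ξ = (∫ r in Ioc 0 t, fhat f r ξ)
      - ∫ s in Ioc 0 t, (traceSymbol (A s) ξ : ℂ) * amp (gaussSymbol A) f s ξ := by
  have := integral_duhamel (continuous_traceSymbol_left hA ξ) (measurable_fhat_left hf ξ)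
    (integrableOn_fhat hf 0 t ξ) (hasDerivAt_gaussExponent hA ξ)
  simp only [amp, gaussSymbol]
  rw [this]
  ring

/-- The symbol factors into a function of t times a function of r, so for t ≥ 0 the amplitude is a
continuous factor times a primitive. -/
lemma continuousOn_amp_gaussSymbol (hA : Continuous A) (hf : IsSource T f) (ξ : RN N) :
    ContinuousOn (fun t => amp (gaussSymbol A) f t ξ) (Icc 0 T) := by
  have hL : Continuous fun t => gaussExponent A t ξ :=
    (continuous_gaussExponent hA).comp (Continuous.prodMk_left ξ)
  have hint : ∀ a b, IntervalIntegrable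
      (fun r => (Real.exp (gaussExponent A r ξ) : ℂ) * fhat f r ξ) volume a b := fun a b => by
    have h1 : IntervalIntegrable (fun r => fhat f r ξ) volume a b :=
      ⟨integrableOn_fhat hf a b ξ, integrableOn_fhat hf b a ξ⟩
    exact h1.continuousOn_mul (by fun_prop : Continuous fun r =>
      (Real.exp (gaussExponent A r ξ) : ℂ)).continuousOn
  have hc : Continuous fun t => (Real.exp (-gaussExponent A t ξ) : ℂ)
      * ∫ r in (0 : ℝ)..t, (Real.exp (gaussExponent A r ξ) : ℂ) * fhat f r ξ :=
    (by fun_prop : Continuous fun t => (Real.exp (-gaussExponent A t ξ) : ℂ)).mul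
      (intervalIntegral.continuous_primitive hint 0)
  refine hc.continuousOn.congr fun t ht => ?_
  simp only [amp, gaussSymbol]
  rw [intervalIntegral.integral_of_le ht.1, ← integral_const_mul]
  congr 1
  funext r
  rw [← mul_assoc, ← ofReal_mul, ← Real.exp_add]
  congr 3
  ring

/-- The Gaussian superposition solves `∂_t u = Tr(A D² u) + f`. -/
lemma isSolution_superpose_gaussSymbol (hA : Continuous A) (hApos : ∀ t, (A t).PosSemidef) {β : ℝ}
    (hβ0 : 0 ≤ β) (hβ : ∀ t i j, |A t i j| ≤ β) (hT : 0 ≤ T) (hf : IsSource T f) :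
    IsSolution T A f (superpose (gaussSymbol A) f) := by
  obtain ⟨C, hC0, hC⟩ := hf.exists_hasDecay
  have hm := isSymbol_gaussSymbol hA hApos
  have hd : ∀ t ≤ T, HasDecay (amp (gaussSymbol A) f t) (T * C) := fun t ht =>
    hasDecay_amp hm hf hT hC0 hC ht
  have hTC : 0 ≤ T * C := by positivity
  -- The summand C bounds the transform of the source; the other bounds `traceSymbol` times the
  -- amplitude, with N² matrix entries at most β, the factor 4π² and the decay constant T C.
  set D : ℝ := C + N * (N * (β * (4 * Real.pi ^ 2 * (T * C)))) with hD
  have hFm : ∀ z : RN N, Measurable (Function.uncurry fun (r : ℝ) (ξ : RN N) => wave z ξ *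
      (fhat f r ξ + -(traceSymbol (A r) ξ : ℂ) * amp (gaussSymbol A) f r ξ)) := fun z => by
    refine Measurable.mul ?_ (Measurable.add ?_ (Measurable.mul ?_ ?_))
    · exact (continuous_wave.comp (by fun_prop : Continuous fun p : ℝ × RN N => (z, p.2))).measurable
    · exact hf.stronglyMeasurable_fhat.measurable
    · exact (measurable_ofReal.comp (continuous_traceSymbol hA).measurable).neg
    · exact (stronglyMeasurable_amp hm hf).measurable
  have hFi : ∀ t ≤ T, ∀ z : RN N, Integrable (Function.uncurry fun (r : ℝ) (ξ : RN N) => wave z ξ *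
      (fhat f r ξ + -(traceSymbol (A r) ξ : ℂ) * amp (gaussSymbol A) f r ξ))
      ((volume.restrict (Ioc 0 t)).prod volume) := fun t ht z => by
    have hdom : Integrable (fun x : ℝ × RN N => D * decayWeight x.2)
        ((volume.restrict (Ioc 0 t)).prod volume) :=
      ((integrable_const (1 : ℝ)).mul_prod integrable_decayWeight).const_mul D
        |>.congr (Filter.Eventually.of_forall fun x => by simp)
    refine hdom.mono' (hFm z).aestronglyMeasurable ?_
    have h1 : ∀ᵐ x : ℝ × RN N ∂((volume.restrict (Ioc 0 t)).prod volume), x.1 ∈ Ioc 0 t :=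
      Measure.quasiMeasurePreserving_fst.ae (ae_restrict_mem measurableSet_Ioc)
    filter_upwards [h1] with x hx
    simp only [Function.uncurry]
    rw [norm_mul, norm_wave, one_mul]
    refine (norm_add_le _ _).trans ?_
    have e1 := (hC x.1).norm_le x.2
    have e2 := norm_traceSymbol_mul_le (hd x.1 (hx.2.trans ht)) hβ0 (hβ x.1) x.2
    rw [neg_mul, norm_neg]
    refine (add_le_add e1 e2).trans (le_of_eq ?_)
    rw [hD]; ring
  have hint : ∀ r ≤ T, ∀ z, f r z + (A r * hessianMatrix (superpose (gaussSymbol A) f r) z).trace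
      = (∫ ξ, wave z ξ *
        (fhat f r ξ + -(traceSymbol (A r) ξ : ℂ) * amp (gaussSymbol A) f r ξ)).re := by
    intro r hr z
    have h2 : Integrable fun ξ => -(traceSymbol (A r) ξ : ℂ) * amp (gaussSymbol A) f r ξ := by
      have hmm : Measurable fun ξ => -(traceSymbol (A r) ξ : ℂ) * amp (gaussSymbol A) f r ξ :=
        (measurable_ofReal.comp ((continuous_traceSymbol hA).comp
          (Continuous.prodMk_right r)).measurable).neg.mul (hd r hr).measurable
      refine (integrable_decayWeight.const_mul (N * (N * (β * (4 * Real.pi ^ 2 * (T * C)))))).mono'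
        hmm.aestronglyMeasurable (Filter.Eventually.of_forall fun ξ => ?_)
      rw [neg_mul, norm_neg]
      refine (norm_traceSymbol_mul_le (hd r hr) hβ0 (hβ r) ξ).trans (le_of_eq (by ring))
    change f r z + (A r * hessianMatrix (synth (amp (gaussSymbol A) f r)) z).trace = _
    rw [trace_mul_hessianMatrix_synth (hd r hr), ← hf.synth_fhat r z,
      ← synth_add (hC r).integrable h2, synth]
  refine ⟨?_, ⟨T * C * ∫ ξ : RN N, decayWeight ξ, fun t ht z => abs_synth_le (hd t ht.2) z⟩,
    fun t ht => contDiff_synth (hd t ht.2), fun z => ?_, fun t ht z => ?_⟩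
  · refine continuous_re.comp_continuousOn ?_
    refine continuousOn_of_dominated (bound := fun ξ => T * C * decayWeight ξ) (fun q hq => ?_)
      (fun q hq => Filter.Eventually.of_forall fun ξ => ?_) (integrable_decayWeight.const_mul _)
      (Filter.Eventually.of_forall fun ξ => ?_)
    · exact (integrable_wave_mul (hd q.1 hq.1.2).integrable q.2).aestronglyMeasurable
    · rw [norm_mul, norm_wave, one_mul]
      exact (hd q.1 hq.1.2).norm_le ξ
    · refine ContinuousOn.mul ?_ ?_
      · exact (continuous_wave.comp (by fun_prop :
          Continuous fun q : ℝ × RN N => (q.2, ξ))).continuousOn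
      · exact (continuousOn_amp_gaussSymbol hA hf ξ).comp continuousOn_fst fun q hq => hq.1
  · rw [intervalIntegrable_iff_integrableOn_Ioc_of_le hT]
    have := (hFi T le_rfl z).integral_prod_left.re
    refine IntegrableOn.congr_fun this (fun r hr => ?_) measurableSet_Ioc
    exact (hint r hr.2 z).symm
  · have h1 : ∀ ξ, wave z ξ * amp (gaussSymbol A) f t ξ = ∫ r in Ioc 0 t, wave z ξ *
        (fhat f r ξ + -(traceSymbol (A r) ξ : ℂ) * amp (gaussSymbol A) f r ξ) := fun ξ => by
      have hi : IntegrableOn (fun s => (traceSymbol (A s) ξ : ℂ) * amp (gaussSymbol A) f s ξ)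
          (Ioc 0 t) := by
        have hc : ContinuousOn (fun s => (traceSymbol (A s) ξ : ℂ) * amp (gaussSymbol A) f s ξ)
            (Icc 0 t) :=
          (continuous_ofReal.comp (continuous_traceSymbol_left hA ξ)).continuousOn.mul
            ((continuousOn_amp_gaussSymbol hA hf ξ).mono (Icc_subset_Icc le_rfl ht.2))
        exact hc.integrableOn_Icc.mono_set Ioc_subset_Icc_self
      rw [integral_const_mul, amp_gaussSymbol_eq hA hf t ξ]
      simp only [neg_mul, ← sub_eq_add_neg]
      rw [integral_sub (integrableOn_fhat hf 0 t ξ) hi]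
    rw [superpose, synth, intervalIntegral.integral_of_le ht.1]
    simp only [h1]
    -- Exchanging time and frequency turns the equation at each frequency into the integral equation
    -- in space.
    rw [← integral_integral_swap (hFi t ht.2 z)]
    have h2 := integral_re (hFi t ht.2 z).integral_prod_left
    refine Eq.trans h2.symm ?_
    refine setIntegral_congr_fun measurableSet_Ioc fun r hr => ?_
    exact (hint r (hr.2.trans ht.2) z).symm

end Gaussian

/-! ### Hessians of superpositions and their size. -/

section HessAmp

variable {N : ℕ}

open Complex

lemma continuous_seminorm_matrix (ν : Seminorm ℝ (Matrix (Fin N) (Fin N) ℝ)) : Continuous ν := by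
  have hle : ∀ M : Matrix (Fin N) (Fin N) ℝ,
      ν M ≤ ∑ i, ∑ j, |M i j| * ν (Matrix.single i j 1) := fun M => by
    conv_lhs => rw [Matrix.matrix_eq_sum_single M]
    refine (Finset.le_sum_of_subadditive ν (map_zero ν).le (map_add_le_add ν) _ _).trans
      (Finset.sum_le_sum fun i _ => ?_)
    refine (Finset.le_sum_of_subadditive ν (map_zero ν).le (map_add_le_add ν) _ _).trans
      (Finset.sum_le_sum fun j _ => ?_)
    have : Matrix.single i j (M i j) = M i j • Matrix.single i j (1 : ℝ) := by simp
    rw [this, map_smul_eq_mul, Real.norm_eq_abs]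
  refine continuous_iff_continuousAt.2 fun M0 => ?_
  refine tendsto_iff_norm_sub_tendsto_zero.2 (squeeze_zero (fun _ => norm_nonneg _)
    (g := fun M => ∑ i, ∑ j, |(M - M0) i j| * ν (Matrix.single i j 1)) (fun M => ?_) ?_)
  · rw [Real.norm_eq_abs]
    exact (abs_sub_map_le_sub ν M M0).trans (hle _)
  · have hc : Continuous fun M : Matrix (Fin N) (Fin N) ℝ =>
        ∑ i, ∑ j, |(M - M0) i j| * ν (Matrix.single i j 1) :=
      continuous_finsetSum _ fun i _ => continuous_finsetSum _ fun j _ =>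
        (((continuous_id.sub continuous_const).matrix_elem i j).abs).mul continuous_const
    simpa using hc.tendsto M0

/-- The Hessian matrix of the superposition with symbol `m` of the source `f`. -/
noncomputable def hessAmp (m : ℝ → ℝ → RN N → ℝ) (f : ℝ → RN N → ℝ) (t : ℝ) (x : RN N) :
    Matrix (Fin N) (Fin N) ℝ :=
  Matrix.of fun i j => synth (fun ξ => secondSymbol i j ξ * amp m f t ξ) x

variable {m : ℝ → ℝ → RN N → ℝ} {f : ℝ → RN N → ℝ} {T : ℝ}

lemma hessianMatrix_superpose (hm : IsSymbol m) (hf : IsSource T f) (hT : 0 ≤ T) {t : ℝ}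
    (ht : t ≤ T) (x : RN N) : hessianMatrix (superpose m f t) x = hessAmp m f t x := by
  obtain ⟨C, hC0, hC⟩ := hf.exists_hasDecay
  ext i j
  exact hessianMatrix_synth (hasDecay_amp hm hf hT hC0 hC ht) x i j

/-- The seminorm of the conjugated Hessian matrix. -/
noncomputable def hessSize (ν : Seminorm ℝ (Matrix (Fin N) (Fin N) ℝ))
    (R : ℝ → Matrix (Fin N) (Fin N) ℝ) (m : ℝ → ℝ → RN N → ℝ) (f : ℝ → RN N → ℝ)
    (q : ℝ × RN N) : ℝ :=
  ν ((R q.1).transpose * hessAmp m f q.1 q.2 * R q.1)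

variable {ν : Seminorm ℝ (Matrix (Fin N) (Fin N) ℝ)} {R : ℝ → Matrix (Fin N) (Fin N) ℝ}

lemma stronglyMeasurable_hessAmp (hm : IsSymbol m) (hf : IsSource T f) :
    StronglyMeasurable fun q : ℝ × RN N => hessAmp m f q.1 q.2 := by
  have e : (fun q : ℝ × RN N => hessAmp m f q.1 q.2) = fun q => ∑ i, ∑ j,
      synth (fun ξ => secondSymbol i j ξ * amp m f q.1 ξ) q.2 • Matrix.single i j (1 : ℝ) := by
    funext q
    conv_lhs => rw [Matrix.matrix_eq_sum_single (hessAmp m f q.1 q.2)]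
    simp [hessAmp]
  rw [e]
  exact Finset.stronglyMeasurable_fun_sum _ fun i _ => Finset.stronglyMeasurable_fun_sum _ fun j _ =>
    (measurable_synth_amp hm hf (continuous_secondSymbol i j).measurable).smul_const _

lemma stronglyMeasurable_hessSize (hR : Continuous R) (hm : IsSymbol m) (hf : IsSource T f) :
    StronglyMeasurable (hessSize ν R m f) := by
  have hR1 : StronglyMeasurable fun q : ℝ × RN N => R q.1 :=
    hR.comp_stronglyMeasurable measurable_fst.stronglyMeasurable
  have hR2 : StronglyMeasurable fun q : ℝ × RN N => (R q.1).transpose :=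
    hR.matrix_transpose.comp_stronglyMeasurable measurable_fst.stronglyMeasurable
  have h3 : StronglyMeasurable fun q : ℝ × RN N =>
      (R q.1).transpose * hessAmp m f q.1 q.2 * R q.1 :=
    (hR2.mul (stronglyMeasurable_hessAmp hm hf)).mul hR1
  exact (continuous_seminorm_matrix ν).comp_stronglyMeasurable h3

end HessAmp

/-! ### Symmetric jumps as averages of translations. -/

section Jumps

variable {N : ℕ}

open Complex

/-- The characteristic factor of a jump by `±β` with equal probabilities at time `τ`. -/
noncomputable def jumpFactor (τ : ℝ) (β : RN N) (r t : ℝ) (ξ : RN N) : ℝ :=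
  if r < τ ∧ τ ≤ t then Real.cos (2 * Real.pi * inner ℝ ξ β) else 1

/-- The path which jumps from `0` to `β` at time `τ`. -/
noncomputable def jumpPath (τ : ℝ) (β : RN N) (t : ℝ) : RN N := if τ ≤ t then β else 0

lemma abs_jumpFactor_le (τ : ℝ) (β : RN N) (r t : ℝ) (ξ : RN N) : |jumpFactor τ β r t ξ| ≤ 1 := by
  unfold jumpFactor
  split_ifs
  · exact Real.abs_cos_le_one _
  · simp

lemma measurable_jumpFactor (τ : ℝ) (β : RN N) :
    Measurable fun p : ℝ × ℝ × RN N => jumpFactor τ β p.1 p.2.1 p.2.2 := by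
  unfold jumpFactor
  have h : Measurable fun p : ℝ × ℝ × RN N => Real.cos (2 * Real.pi * inner ℝ p.2.2 β) := by
    fun_prop
  refine Measurable.ite ?_ h measurable_const
  exact (measurableSet_lt measurable_fst measurable_const).inter
    (measurableSet_le measurable_const (measurable_fst.comp measurable_snd))

lemma measurable_jumpPath (τ : ℝ) (β : RN N) : Measurable (jumpPath τ β) :=
  Measurable.ite measurableSet_Ici measurable_const measurable_const

lemma wave_add_wave_neg (β ξ : RN N) :
    wave β ξ + wave (-β) ξ = 2 * (Real.cos (2 * Real.pi * inner ℝ ξ β) : ℂ) := by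
  simp only [wave, inner_neg_right, mul_neg, ofReal_cos]
  rw [two_cos]
  push_cast
  ring_nf

lemma wave_zero (ξ : RN N) : wave 0 ξ = 1 := by simp [wave]

lemma wave_mul_wave_neg (β ξ : RN N) : wave β ξ * wave (-β) ξ = 1 := by
  rw [← wave_add, add_neg_cancel, wave_zero]

/-- The right side averages the plane wave of the path increment over the two signs. The increment
is nonzero only if the jump separates r from t, where the half-open condition r < τ ≤ t matches the
right-continuous path. -/
lemma jumpFactor_eq (τ : ℝ) (β : RN N) {r t : ℝ} (h : r ≤ t) (ξ : RN N) :
    (jumpFactor τ β r t ξ : ℂ) = (1 / 2 : ℝ) * (wave (-jumpPath τ β t) ξ * wave (jumpPath τ β r) ξ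
      + wave (jumpPath τ β t) ξ * wave (-jumpPath τ β r) ξ) := by
  have h1 := wave_mul_wave_neg β ξ
  have h2 := wave_add_wave_neg β ξ
  unfold jumpFactor jumpPath
  by_cases hr : τ ≤ r
  · have ht : τ ≤ t := hr.trans h
    simp only [hr, ht, not_lt.2 hr, false_and, if_false, if_true]
    rw [mul_comm (wave (-β) ξ), h1]
    norm_num
  · by_cases ht : τ ≤ t
    · simp only [hr, ht, not_le.1 hr, and_self, if_false, if_true, neg_zero, wave_zero, mul_one]
      rw [add_comm, h2]
      push_cast; ring
    · simp only [hr, ht, and_false, if_false, neg_zero, wave_zero]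
      norm_num

variable {m : ℝ → ℝ → RN N → ℝ} {f : ℝ → RN N → ℝ} {T : ℝ}

lemma IsSymbol.mul_jumpFactor (hm : IsSymbol m) (τ : ℝ) (β : RN N) :
    IsSymbol fun r t ξ => m r t ξ * jumpFactor τ β r t ξ where
  measurable := hm.measurable.mul (measurable_jumpFactor τ β)
  bound := fun r t ξ h => by
    rw [abs_mul]
    exact mul_le_one₀ (hm.bound r t ξ h) (abs_nonneg _) (abs_jumpFactor_le _ _ _ _ _)

/-- Time-dependent translation of the source. -/
def shiftSource (f : ℝ → RN N → ℝ) (c : ℝ → RN N) (s : ℝ) (x : RN N) : ℝ := f s (x + c s)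

lemma IsSource.shift (hf : IsSource T f) {c : ℝ → RN N} (hc : Measurable c) {B : ℝ}
    (hB : ∀ s, ‖c s‖ ≤ B) : IsSource T (shiftSource f c) where
  measurable := hf.measurable.comp (f := fun q : ℝ × RN N => (q.1, q.2 + c q.1)) (by fun_prop)
  zero := fun t ht => by
    funext x; simp [shiftSource, hf.zero t ht]
  smooth := fun t => (hf.smooth t).comp (contDiff_id.add contDiff_const)
  bounded := fun n => by
    obtain ⟨M, hM⟩ := hf.bounded n
    refine ⟨M, fun t z => ?_⟩
    change ‖iteratedFDeriv ℝ n (fun x => f t (x + c t)) z‖ ≤ M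
    rw [iteratedFDeriv_comp_add_right]
    exact hM t _
  support := by
    obtain ⟨r, hr⟩ := hf.support
    refine ⟨r + B, fun t => closure_minimal (fun x hx => ?_) Metric.isClosed_closedBall⟩
    have h1 : x + c t ∈ Metric.closedBall 0 r := hr t (subset_tsupport _ hx)
    rw [mem_closedBall_zero_iff] at h1 ⊢
    calc ‖x‖ = ‖(x + c t) - c t‖ := by rw [add_sub_cancel_right]
      _ ≤ ‖x + c t‖ + ‖c t‖ := norm_sub_le _ _
      _ ≤ r + B := add_le_add h1 (hB t)

lemma norm_jumpPath_le (τ : ℝ) (β : RN N) (t : ℝ) : ‖jumpPath τ β t‖ ≤ ‖β‖ := by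
  unfold jumpPath; split_ifs <;> simp

/-- Shifting the source by the path multiplies its transform at time r by a wave; shifting the
result back multiplies the amplitude at time t by the opposite one. All these factors commute with
the symbol m, and averaging over the two signs leaves the cosine. -/
lemma hessAmp_mul_jumpFactor (hm : IsSymbol m) (hf : IsSource T f) (hT : 0 ≤ T) (τ : ℝ) (β : RN N)
    {t : ℝ} (ht : t ≤ T) (x : RN N) :
    hessAmp (fun r t ξ => m r t ξ * jumpFactor τ β r t ξ) f t x =
      (1 / 2 : ℝ) • (hessAmp m (shiftSource f (jumpPath τ β)) t (x + -jumpPath τ β t) +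
        hessAmp m (shiftSource f (-jumpPath τ β)) t (x + jumpPath τ β t)) := by
  have hp : IsSource T (shiftSource f (jumpPath τ β)) :=
    hf.shift (measurable_jumpPath τ β) (norm_jumpPath_le τ β)
  have hn : IsSource T (shiftSource f (-jumpPath τ β)) :=
    hf.shift (measurable_jumpPath τ β).neg fun s => by
      rw [Pi.neg_apply, norm_neg]; exact norm_jumpPath_le τ β s
  have hamp : ∀ ξ, amp (fun r t ξ => m r t ξ * jumpFactor τ β r t ξ) f t ξ = (1 / 2 : ℝ) *
      (wave (-jumpPath τ β t) ξ * amp m (shiftSource f (jumpPath τ β)) t ξ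
        + wave (jumpPath τ β t) ξ * amp m (shiftSource f (-jumpPath τ β)) t ξ) := fun ξ => by
    simp only [amp]
    rw [← integral_const_mul, ← integral_const_mul, ← integral_add
      ((integrableOn_symbol_mul hm hp t ξ).const_mul _)
      ((integrableOn_symbol_mul hm hn t ξ).const_mul _), ← integral_const_mul]
    refine setIntegral_congr_fun measurableSet_Ioc fun r hr => ?_
    have e1 : fhat (shiftSource f (jumpPath τ β)) r ξ = _ := IsSource.fhat_translate f _ r ξ
    have e2 : fhat (shiftSource f (-jumpPath τ β)) r ξ = _ := IsSource.fhat_translate f _ r ξ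
    simp only [e1, e2, ofReal_mul, jumpFactor_eq τ β hr.2 ξ, Pi.neg_apply]
    ring
  have hint : ∀ {h : ℝ → RN N → ℝ}, IsSource T h → ∀ i j y,
      Integrable fun ξ => wave y ξ * (secondSymbol i j ξ * amp m h t ξ) := fun {h} hh i j y => by
    obtain ⟨C, hC0, hC⟩ := hh.exists_hasDecay
    exact integrable_wave_mul
      (integrable_secondSymbol_mul (hasDecay_amp hm hh hT hC0 hC ht) i j) y
  ext i j
  simp only [hessAmp, Matrix.smul_apply, Matrix.add_apply, Matrix.of_apply, smul_eq_mul, hamp]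
  rw [← synth_wave_mul, ← synth_wave_mul, ← synth_add (hint hp i j _) (hint hn i j _),
    ← synth_real_mul]
  congr 1
  funext ξ
  ring

end Jumps

/-! ### Stability of the estimate under jumps. -/

section JumpEstimate

variable {N : ℕ}

/-- On each time slice the map is a translation, and the density depends on time only. -/
lemma measurePreserving_shift (T : ℝ) {g : ℝ → ℝ} (hg : Measurable g) {c : ℝ → RN N}
    (hc : Measurable c) :
    MeasurePreserving (fun q : ℝ × RN N => (q.1, q.2 + c q.1)) (weightedMeasure N T g)
      (weightedMeasure N T g) := by
  have hm : Measurable fun q : ℝ × RN N => (q.1, q.2 + c q.1) := by fun_prop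
  have h0 : MeasurePreserving (fun q : ℝ × RN N => (q.1, q.2 + c q.1))
      (((volume : Measure ℝ).restrict (Ioo 0 T)).prod (volume : Measure (RN N)))
      (((volume : Measure ℝ).restrict (Ioo 0 T)).prod (volume : Measure (RN N))) :=
    (MeasurePreserving.id _).skew_product (g := fun t x => x + c t) (by fun_prop)
      (Filter.Eventually.of_forall fun t => (measurePreserving_add_right volume (c t)).map_eq)
  have hgm : Measurable fun q : ℝ × RN N => ENNReal.ofReal (g q.1) :=
    (hg.comp measurable_fst).ennreal_ofReal
  refine ⟨hm, Measure.ext fun s hs => ?_⟩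
  rw [Measure.map_apply hm hs, weightedMeasure, withDensity_apply _ (hm hs),
    withDensity_apply _ hs, ← h0.setLIntegral_comp_preimage hs hgm]

lemma aestronglyMeasurable_shift {T : ℝ} {g : ℝ → ℝ} (hg : Measurable g) {c : ℝ → RN N}
    (hc : Measurable c) {F : ℝ × RN N → ℝ} (hF : StronglyMeasurable F) :
    AEStronglyMeasurable (fun q : ℝ × RN N => F (q.1, q.2 + c q.1)) (weightedMeasure N T g) :=
  hF.aestronglyMeasurable.comp_measurePreserving (measurePreserving_shift T hg hc)

lemma eLpNorm_shift {T : ℝ} {g : ℝ → ℝ} (hg : Measurable g) {c : ℝ → RN N}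
    (hc : Measurable c) {F : ℝ × RN N → ℝ} (hF : StronglyMeasurable F) (p : ENNReal) :
    eLpNorm (fun q : ℝ × RN N => F (q.1, q.2 + c q.1)) p (weightedMeasure N T g)
      = eLpNorm F p (weightedMeasure N T g) :=
  eLpNorm_comp_measurePreserving hF.aestronglyMeasurable (measurePreserving_shift T hg hc)

lemma ae_weightedMeasure (N : ℕ) (T : ℝ) (g : ℝ → ℝ) :
    ∀ᵐ q ∂weightedMeasure N T g, q.1 ∈ Ioo 0 T :=
  (withDensity_absolutelyContinuous _ _).ae_le
    (Measure.quasiMeasurePreserving_fst.ae (ae_restrict_mem measurableSet_Ioo))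

lemma IsSource.memBb {T : ℝ} {f : ℝ → RN N → ℝ} (hf : IsSource T f)
    (hp : ∀ z, ∃ F : Finset ℝ, ∀ t ∈ Icc (0 : ℝ) T \ (F : Set ℝ),
      ContinuousWithinAt (fun s => f s z) (Icc (0 : ℝ) T) t) : MemBb T f where
  borel := hf.measurable.comp (f := fun q : Icc (0 : ℝ) T × RN N => ((q.1 : ℝ), q.2)) (by fun_prop)
  smooth := fun t _ => hf.smooth t
  bounded := fun n => (hf.bounded n).imp fun M hM t _ => hM t
  support := hf.support.imp fun r hr t _ => hr t
  piecewise := hp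

/-- Away from τ the shift is locally constant, so the discontinuities at z are among those of f at z
+ a and z + b, together with τ. The class of sources is therefore stable under a jump. -/
lemma MemBb.shift {T : ℝ} {f : ℝ → RN N → ℝ} (hp : MemBb T f) {c : ℝ → RN N} {τ : ℝ}
    {a b : RN N} (hc : ∀ t, c t = if τ ≤ t then a else b) (hs : IsSource T (shiftSource f c)) :
    MemBb T (shiftSource f c) := by
  classical
  refine hs.memBb fun z => ?_
  obtain ⟨F, hF⟩ := hp.piecewise (z + a)
  obtain ⟨F', hF'⟩ := hp.piecewise (z + b)
  refine ⟨insert τ (F ∪ F'), fun t ht => ?_⟩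
  simp only [Finset.coe_insert, Finset.coe_union, mem_sdiff, mem_insert_iff, mem_union, not_or] at ht
  obtain ⟨htT, hne, h1, h2⟩ := ht
  rcases lt_or_gt_of_ne hne with h | h
  · refine (hF' t ⟨htT, h2⟩).congr_of_eventuallyEq ?_ ?_
    · filter_upwards [mem_nhdsWithin_of_mem_nhds (Iio_mem_nhds h)] with s hs
      simp only [shiftSource, hc, not_le.2 (mem_Iio.1 hs), if_false]
    · simp only [shiftSource, hc, not_le.2 h, if_false]
  · refine (hF t ⟨htT, h1⟩).congr_of_eventuallyEq ?_ ?_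
    · filter_upwards [mem_nhdsWithin_of_mem_nhds (Ioi_mem_nhds h)] with s hs
      simp only [shiftSource, hc, (mem_Ioi.1 hs).le, if_true]
    · simp only [shiftSource, hc, h.le, if_true]

variable {T : ℝ} {ν : Seminorm ℝ (Matrix (Fin N) (Fin N) ℝ)}
  {R : ℝ → Matrix (Fin N) (Fin N) ℝ} {g : ℝ → ℝ} {p : ENNReal} {C : ENNReal}
  {m : ℝ → ℝ → RN N → ℝ}

/-- The estimate for the superposition with symbol `m` of every admissible source. -/
def SymbolEstimate (T : ℝ) (ν : Seminorm ℝ (Matrix (Fin N) (Fin N) ℝ))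
    (R : ℝ → Matrix (Fin N) (Fin N) ℝ) (g : ℝ → ℝ) (p C : ENNReal) (m : ℝ → ℝ → RN N → ℝ) : Prop :=
  ∀ f : ℝ → RN N → ℝ, IsSource T f → MemBb T f →
    eLpNorm (hessSize ν R m f) p (weightedMeasure N T g) ≤
      C * eLpNorm (fun q : ℝ × RN N => f q.1 q.2) p (weightedMeasure N T g)

/-- The two shifted sources have the norm of f, and shifting back preserves the norms of the
results. Minkowski's inequality for the half-sum gives (C + C)/2, so nothing is lost. -/
lemma SymbolEstimate.mul_jumpFactor (h : SymbolEstimate T ν R g p C m) (hp : 1 ≤ p) (hT : 0 ≤ T)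
    (hg : Measurable g) (hR : Continuous R) (hm : IsSymbol m) (τ : ℝ) (β : RN N) :
    SymbolEstimate T ν R g p C fun r t ξ => m r t ξ * jumpFactor τ β r t ξ := by
  intro f hf hfp
  set μ := weightedMeasure N T g
  set c := jumpPath τ β with hcdef
  have hcm : Measurable c := measurable_jumpPath τ β
  have hsp : IsSource T (shiftSource f c) := hf.shift hcm (norm_jumpPath_le τ β)
  have hsn : IsSource T (shiftSource f (-c)) := hf.shift hcm.neg fun s => by
    rw [Pi.neg_apply, norm_neg]; exact norm_jumpPath_le τ β s
  have hbp : MemBb T (shiftSource f c) := hfp.shift (τ := τ) (a := β) (b := 0) (fun t => rfl) hsp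
  have hbn : MemBb T (shiftSource f (-c)) := by
    refine hfp.shift (τ := τ) (a := -β) (b := 0) (fun t => ?_) hsn
    simp only [hcdef, Pi.neg_apply, jumpPath]
    split_ifs <;> simp
  have hfm : StronglyMeasurable fun q : ℝ × RN N => f q.1 q.2 := hf.measurable.stronglyMeasurable
  have sp := stronglyMeasurable_hessSize (ν := ν) hR hm hsp
  have sn := stronglyMeasurable_hessSize (ν := ν) hR hm hsn
  set G : ℝ × RN N → ℝ := fun q => hessSize ν R m (shiftSource f c) (q.1, q.2 + (-c) q.1) with hGdef
  set G' : ℝ × RN N → ℝ := fun q => hessSize ν R m (shiftSource f (-c)) (q.1, q.2 + c q.1)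
    with hGdef'
  have nG : eLpNorm G p μ ≤ C * eLpNorm (fun q : ℝ × RN N => f q.1 q.2) p μ := by
    rw [← eLpNorm_shift hg hcm hfm, hGdef, eLpNorm_shift hg hcm.neg sp]
    exact h _ hsp hbp
  have nG' : eLpNorm G' p μ ≤ C * eLpNorm (fun q : ℝ × RN N => f q.1 q.2) p μ := by
    rw [← eLpNorm_shift hg hcm.neg hfm, hGdef', eLpNorm_shift hg hcm sn]
    exact h _ hsn hbn
  have hG : AEStronglyMeasurable G μ := aestronglyMeasurable_shift hg hcm.neg sp
  have hG' : AEStronglyMeasurable G' μ := aestronglyMeasurable_shift hg hcm sn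
  have hle : ∀ᵐ q ∂μ, ‖hessSize ν R (fun r t ξ => m r t ξ * jumpFactor τ β r t ξ) f q‖
      ≤ ((1 / 2 : ℝ) • (G + G')) q := by
    filter_upwards [ae_weightedMeasure N T g] with q hq
    rw [hessSize, Real.norm_of_nonneg (apply_nonneg _ _),
      hessAmp_mul_jumpFactor hm hf hT τ β hq.2.le, Matrix.mul_smul, Matrix.smul_mul,
      map_smul_eq_mul, Matrix.mul_add, Matrix.add_mul, Real.norm_of_nonneg (by norm_num)]
    simp only [Pi.smul_apply, Pi.add_apply, smul_eq_mul]
    exact mul_le_mul_of_nonneg_left (map_add_le_add ν _ _) (by norm_num)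
  refine (eLpNorm_mono_ae_real hle).trans ?_
  rw [eLpNorm_const_smul]
  refine (mul_le_mul_right ((eLpNorm_add_le hG hG' hp).trans (add_le_add nG nG')) _).trans ?_
  rw [← two_mul, ← mul_assoc]
  have : ‖(1 / 2 : ℝ)‖ₑ * 2 = 1 := by
    rw [Real.enorm_eq_ofReal (by norm_num), ENNReal.ofReal_div_of_pos (by norm_num)]
    simp [ENNReal.inv_mul_cancel]
  rw [this, one_mul]

/-- The product of the characteristic factors of finitely many independent jumps. -/
noncomputable def jumpProduct {ι : Type*} (K : Finset ι) (τ : ι → ℝ) (β : ι → RN N)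
    (r t : ℝ) (ξ : RN N) : ℝ :=
  ∏ i ∈ K, jumpFactor (τ i) (β i) r t ξ

lemma SymbolEstimate.mul_jumpProduct {ι : Type*} (h : SymbolEstimate T ν R g p C m) (hp : 1 ≤ p)
    (hT : 0 ≤ T) (hg : Measurable g) (hR : Continuous R) (hm : IsSymbol m) (K : Finset ι)
    (τ : ι → ℝ) (β : ι → RN N) :
    IsSymbol (fun r t ξ => m r t ξ * jumpProduct K τ β r t ξ) ∧
    SymbolEstimate T ν R g p C fun r t ξ => m r t ξ * jumpProduct K τ β r t ξ := by
  classical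
  induction K using Finset.induction_on with
  | empty => simpa [jumpProduct] using ⟨hm, h⟩
  | insert a K ha ih =>
    have e : (fun r t ξ => m r t ξ * jumpProduct (insert a K) τ β r t ξ)
        = fun r t ξ => m r t ξ * jumpProduct K τ β r t ξ * jumpFactor (τ a) (β a) r t ξ := by
      funext r t ξ
      rw [jumpProduct, Finset.prod_insert ha, jumpProduct]
      ring
    rw [e]
    exact ⟨ih.1.mul_jumpFactor _ _, ih.2.mul_jumpFactor hp hT hg hR ih.1 _ _⟩

end JumpEstimate

/-! ### Approximation of the Gaussian symbol by jump products. -/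

section JumpLimit

variable {N : ℕ}

lemma abs_prod_sub_prod_le {ι : Type*} (s : Finset ι) (a b : ι → ℝ) (ha : ∀ i ∈ s, |a i| ≤ 1)
    (hb : ∀ i ∈ s, |b i| ≤ 1) : |∏ i ∈ s, a i - ∏ i ∈ s, b i| ≤ ∑ i ∈ s, |a i - b i| := by
  classical
  induction s using Finset.induction_on with
  | empty => simp
  | insert x s hx ih =>
    rw [Finset.prod_insert hx, Finset.prod_insert hx, Finset.sum_insert hx]
    have h1 := ih (fun i hi => ha i (Finset.mem_insert_of_mem hi))
      (fun i hi => hb i (Finset.mem_insert_of_mem hi))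
    have h2 : |∏ i ∈ s, a i| ≤ 1 := by
      rw [Finset.abs_prod]
      exact Finset.prod_le_one (fun _ _ => abs_nonneg _)
        fun i hi => ha i (Finset.mem_insert_of_mem hi)
    have h3 := hb x (Finset.mem_insert_self x s)
    calc |a x * ∏ i ∈ s, a i - b x * ∏ i ∈ s, b i|
        = |(a x - b x) * ∏ i ∈ s, a i + b x * (∏ i ∈ s, a i - ∏ i ∈ s, b i)| := by ring_nf
      _ ≤ |a x - b x| * |∏ i ∈ s, a i| + |b x| * |∏ i ∈ s, a i - ∏ i ∈ s, b i| := by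
          rw [← abs_mul, ← abs_mul]; exact abs_add_le _ _
      _ ≤ |a x - b x| + |∏ i ∈ s, a i - ∏ i ∈ s, b i| :=
          add_le_add (mul_le_of_le_one_right (abs_nonneg _) h2)
            (mul_le_of_le_one_left (abs_nonneg _) h3)
      _ ≤ _ := by gcongr

/-- Both functions are 1 - x²/2 up to fourth order when |x| ≤ 1; otherwise the difference is at most
2. -/
lemma abs_cos_sub_exp_le (x : ℝ) : |Real.cos x - Real.exp (-(x ^ 2 / 2))| ≤ 2 * x ^ 4 := by
  rcases le_total |x| 1 with h | h
  · have h1 := Real.cos_bound h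
    have hx2 : x ^ 2 ≤ 1 := by rw [← sq_abs]; exact pow_le_one₀ (abs_nonneg x) h
    have h2 := Real.abs_exp_sub_one_sub_id_le (x := -(x ^ 2 / 2)) (by
      rw [abs_neg, abs_of_nonneg (by positivity)]; linarith)
    rw [show |x| ^ 4 = x ^ 4 by rw [← abs_pow]; exact abs_of_nonneg (by positivity)] at h1
    rw [abs_le] at h1 h2 ⊢
    have hx4 : 0 ≤ x ^ 4 := by positivity
    have e : (-(x ^ 2 / 2)) ^ 2 = x ^ 4 / 4 := by ring
    rw [e] at h2
    constructor <;> linarith [h1.1, h1.2, h2.1, h2.2]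
  · have h1 := Real.abs_cos_le_one x
    have h2 : |Real.exp (-(x ^ 2 / 2))| ≤ 1 := by
      rw [Real.abs_exp, Real.exp_le_one_iff, neg_nonpos]; positivity
    have h3 : 1 ≤ x ^ 4 := by
      have := one_le_pow₀ (n := 4) h
      rwa [← abs_pow, abs_of_nonneg (by positivity)] at this
    linarith [abs_sub (Real.cos x) (Real.exp (-(x ^ 2 / 2)))]

variable {A : ℝ → Matrix (Fin N) (Fin N) ℝ}

/-- The increment of the Gaussian exponent is a sum of squares of linear forms. -/
lemma exists_sum_sq_eq_gaussExponent_sub (hA : Continuous A) (hApos : ∀ t, (A t).PosSemidef)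
    {a b : ℝ} (hab : a ≤ b) : ∃ β : Fin N → RN N, ∀ ξ : RN N,
      ∑ j, (2 * Real.pi * inner ℝ ξ (β j)) ^ 2
        = 2 * (gaussExponent A b ξ - gaussExponent A a ξ) := by
  -- The factor 2 offsets the one half in cos x ≈ exp(-x²/2). The vectors β j are the rows of B in a
  -- factorization P = BᵀB.
  set P : Matrix (Fin N) (Fin N) ℝ := Matrix.of fun i j => ∫ s in a..b, 2 * A s i j with hP
  have hc : ∀ i j, Continuous fun s => A s i j := fun i j => hA.matrix_elem i j
  have hform : ∀ v : Fin N → ℝ, v ⬝ᵥ P.mulVec v = ∫ s in a..b, 2 * (v ⬝ᵥ (A s).mulVec v) := by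
    intro v
    simp only [dotProduct, Matrix.mulVec, hP, Matrix.of_apply, Finset.mul_sum]
    rw [intervalIntegral.integral_finsetSum fun i _ => Continuous.intervalIntegrable
      (continuous_finsetSum _ fun j _ => by fun_prop) _ _]
    refine Finset.sum_congr rfl fun i _ => ?_
    rw [intervalIntegral.integral_finsetSum fun j _ => Continuous.intervalIntegrable
      (by fun_prop) _ _]
    refine Finset.sum_congr rfl fun j _ => ?_
    rw [← intervalIntegral.integral_mul_const, ← intervalIntegral.integral_const_mul]
    congr 1; funext s; ring
  have hPpos : P.PosSemidef := by
    refine Matrix.PosSemidef.of_dotProduct_mulVec_nonneg ?_ fun v => ?_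
    · ext i j
      simp only [hP, Matrix.conjTranspose_apply, Matrix.of_apply, star_trivial]
      congr 1; funext s
      have := (hApos s).1.apply i j
      rw [star_trivial] at this
      rw [this]
    · rw [star_trivial, hform]
      refine intervalIntegral.integral_nonneg hab fun s _ => ?_
      have := (hApos s).dotProduct_mulVec_nonneg v
      rw [star_trivial] at this
      positivity
  obtain ⟨B, hB⟩ := hPpos.exists_eq_transpose_mul
  refine ⟨fun j => WithLp.toLp 2 (B j), fun ξ => ?_⟩
  have h1 : ∀ j, inner ℝ ξ (WithLp.toLp 2 (B j) : RN N) = B.mulVec (ξ : Fin N → ℝ) j := fun j => by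
    simp [PiLp.inner_apply, Matrix.mulVec, dotProduct]
  have h2 : (ξ : Fin N → ℝ) ⬝ᵥ P.mulVec (ξ : Fin N → ℝ)
      = ∑ j, (B.mulVec (ξ : Fin N → ℝ) j) ^ 2 := by
    rw [hB, ← Matrix.mulVec_mulVec, Matrix.dotProduct_mulVec, Matrix.vecMul_transpose]
    simp [dotProduct, sq]
  simp only [h1, mul_pow, ← Finset.mul_sum]
  rw [← h2, hform, gaussExponent_sub hA, ← intervalIntegral.integral_const_mul,
    ← intervalIntegral.integral_const_mul]
  congr 1; funext s
  rw [traceSymbol]; ring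

lemma jumpProduct_prod (n : ℕ) (τ : ℕ → ℝ) (β : ℕ → Fin N → RN N) (r t : ℝ) (ξ : RN N) :
    jumpProduct (Finset.range n ×ˢ (Finset.univ : Finset (Fin N))) (fun i => τ i.1)
      (fun i => β i.1 i.2) r t ξ = ∏ k ∈ Finset.range n with r < τ k ∧ τ k ≤ t,
        ∏ j, Real.cos (2 * Real.pi * inner ℝ ξ (β k j)) := by
  rw [jumpProduct, Finset.prod_product, Finset.prod_filter]
  refine Finset.prod_congr rfl fun k _ => ?_
  simp only [jumpFactor]
  split_ifs <;> simp

/-- Cell k jumps at its right end (k + 1) h, so the jumps in (r, t] belong to the cells between the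
rounded-down times; `hn` ensures that none is cut off. -/
lemma filter_range_eq_Ico {h r t : ℝ} (hh : 0 < h) {n : ℕ} (hn : t ≤ n * h) :
    {k ∈ Finset.range n | r < ((k + 1 : ℕ) : ℝ) * h ∧ ((k + 1 : ℕ) : ℝ) * h ≤ t}
      = Finset.Ico ⌊r / h⌋₊ ⌊t / h⌋₊ := by
  ext k
  rw [Finset.mem_filter, Finset.mem_range, Finset.mem_Ico, ← div_lt_iff₀ hh, ← le_div_iff₀ hh,
    ← Nat.floor_lt' k.succ_ne_zero, ← Nat.le_floor_iff' k.succ_ne_zero, Nat.lt_succ_iff,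
    Nat.succ_le_iff]
  refine ⟨fun H => H.2, fun H => ⟨?_, H⟩⟩
  refine H.2.trans_le (Nat.floor_le_of_le ?_)
  rwa [div_le_iff₀ hh]

/-- The Gaussian symbol is approximated by the characteristic functions of jump processes. -/
lemma abs_jumpProduct_sub_le (hA : Continuous A) (hApos : ∀ t, (A t).PosSemidef) {h T M : ℝ}
    (hh : 0 < h) {n : ℕ} (hn : T ≤ n * h) {β : ℕ → Fin N → RN N}
    (hβ : ∀ k ξ, ∑ j, (2 * Real.pi * inner ℝ ξ (β k j)) ^ 2
      = 2 * (gaussExponent A ((k + 1 : ℕ) * h) ξ - gaussExponent A ((k : ℕ) * h) ξ))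
    {ξ : RN N} (hM : ∀ s ∈ Icc 0 T, traceSymbol (A s) ξ ≤ M) {r t : ℝ} (hr : 0 ≤ r) (hrt : r ≤ t)
    (ht : t ≤ T) :
    |jumpProduct (Finset.range n ×ˢ (Finset.univ : Finset (Fin N)))
        (fun i => ((i.1 + 1 : ℕ) : ℝ) * h) (fun i => β i.1 i.2) r t ξ
      - Real.exp (-(gaussExponent A (⌊t / h⌋₊ * h) ξ - gaussExponent A (⌊r / h⌋₊ * h) ξ))|
      ≤ 8 * (M * h) * gaussExponent A T ξ := by
  set E : ℝ → ℝ := fun s => gaussExponent A s ξ with hE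
  have hmono : Monotone E := gaussExponent_mono hA hApos ξ
  set x : ℕ → Fin N → ℝ := fun k j => 2 * Real.pi * inner ℝ ξ (β k j) with hx
  set Δ : ℕ → ℝ := fun k => E ((k + 1 : ℕ) * h) - E ((k : ℕ) * h) with hΔ
  have hxΔ : ∀ k, ∑ j, x k j ^ 2 = 2 * Δ k := fun k => hβ k ξ
  have hΔ0 : ∀ k, 0 ≤ Δ k := fun k => sub_nonneg.2 (hmono (by gcongr; simp))
  set I := Finset.Ico ⌊r / h⌋₊ ⌊t / h⌋₊ with hI
  have hfl : ⌊r / h⌋₊ ≤ ⌊t / h⌋₊ := Nat.floor_le_floor (by gcongr)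
  have hft : (⌊t / h⌋₊ : ℝ) * h ≤ T :=
    ((le_div_iff₀ hh).1 (Nat.floor_le (div_nonneg (hr.trans hrt) hh.le))).trans ht
  have hsum : ∑ k ∈ I, Δ k = E (⌊t / h⌋₊ * h) - E (⌊r / h⌋₊ * h) := by
    rw [hI, Finset.sum_Ico_eq_sub _ hfl]
    simp only [hΔ]
    rw [Finset.sum_range_sub (fun k : ℕ => E ((k : ℕ) * h)),
      Finset.sum_range_sub (fun k : ℕ => E ((k : ℕ) * h))]
    ring
  have hΔM : ∀ k ∈ I, Δ k ≤ M * h := fun k hk => by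
    have hk2 : ((k + 1 : ℕ) : ℝ) * h ≤ T := le_trans (by
      gcongr; exact (Finset.mem_Ico.1 hk).2) hft
    have hkk : (k : ℝ) * h ≤ ((k + 1 : ℕ) : ℝ) * h := by gcongr; simp
    change gaussExponent A _ ξ - gaussExponent A _ ξ ≤ _
    rw [gaussExponent_sub hA]
    have := intervalIntegral.integral_mono_on hkk
      ((continuous_traceSymbol_left hA ξ).intervalIntegrable _ _)
      (_root_.intervalIntegrable_const (μ := volume) (c := M))
      fun s hs => hM s ⟨le_trans (by positivity) hs.1, hs.2.trans hk2⟩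
    refine this.trans (le_of_eq ?_)
    rw [intervalIntegral.integral_const, smul_eq_mul]
    push_cast; ring
  have hexp : Real.exp (-(E (⌊t / h⌋₊ * h) - E (⌊r / h⌋₊ * h)))
      = ∏ k ∈ I, ∏ j, Real.exp (-(x k j ^ 2 / 2)) := by
    simp only [← Real.exp_sum, Finset.sum_neg_distrib, ← Finset.sum_div, hxΔ]
    rw [← hsum]
    rw [← Finset.mul_sum, mul_div_cancel_left₀ _ two_ne_zero]
  change |_ - Real.exp (-(E (⌊t / h⌋₊ * h) - E (⌊r / h⌋₊ * h)))| ≤ 8 * (M * h) * E T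
  rw [jumpProduct_prod n (fun k => ((k + 1 : ℕ) : ℝ) * h), filter_range_eq_Ico hh (ht.trans hn), hexp]
  have hcos : ∀ y, |Real.cos y| ≤ 1 := Real.abs_cos_le_one
  have hex : ∀ y : ℝ, |Real.exp (-(y ^ 2 / 2))| ≤ 1 := fun y => by
    rw [Real.abs_exp, Real.exp_le_one_iff, neg_nonpos]; positivity
  have hprod : ∀ F : Fin N → ℝ, (∀ j, |F j| ≤ 1) → |∏ j, F j| ≤ 1 := fun F hF => by
    rw [Finset.abs_prod]
    exact Finset.prod_le_one (fun _ _ => abs_nonneg _) fun j _ => hF j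
  refine (abs_prod_sub_prod_le I _ _ (fun k _ => hprod _ fun j => hcos _)
    fun k _ => hprod _ fun j => hex _).trans ?_
  -- On one cell the error is at most 2 (∑ x²)² = 8Δ². One factor Δ is at most M h; the other
  -- telescopes to the total increment of the exponent.
  calc ∑ k ∈ I, |∏ j, Real.cos (x k j) - ∏ j, Real.exp (-(x k j ^ 2 / 2))|
      ≤ ∑ k ∈ I, 8 * (M * h) * Δ k := Finset.sum_le_sum fun k hk => by
        refine (abs_prod_sub_prod_le _ _ _ (fun j _ => hcos _) fun j _ => hex _).trans ?_
        calc ∑ j, |Real.cos (x k j) - Real.exp (-(x k j ^ 2 / 2))|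
            ≤ ∑ j, 2 * (x k j ^ 2) ^ 2 := Finset.sum_le_sum fun j _ =>
              (abs_cos_sub_exp_le _).trans (le_of_eq (by ring))
          _ ≤ 2 * (∑ j, x k j ^ 2) ^ 2 := by
              rw [← Finset.mul_sum]
              gcongr
              exact Finset.sum_sq_le_sq_sum_of_nonneg fun j _ => sq_nonneg _
          _ = 8 * Δ k * Δ k := by rw [hxΔ]; ring
          _ ≤ 8 * (M * h) * Δ k := by
              gcongr
              · exact hΔ0 k
              · exact hΔM k hk
    _ = 8 * (M * h) * (E (⌊t / h⌋₊ * h) - E (⌊r / h⌋₊ * h)) := by rw [← Finset.mul_sum, hsum]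
    _ ≤ 8 * (M * h) * E T := by
        have hM0 : 0 ≤ M := (traceSymbol_nonneg (hApos 0) ξ).trans
          (hM 0 ⟨le_rfl, (hr.trans hrt).trans ht⟩)
        have h0 : 0 ≤ E (⌊r / h⌋₊ * h) := by
          have : E 0 ≤ E (⌊r / h⌋₊ * h) := hmono (by positivity)
          simpa [hE, gaussExponent] using this
        gcongr
        linarith [hmono hft]

lemma tendsto_floor_mul {h : ℕ → ℝ} (hh : ∀ n, 0 < h n)
    (hlim : Filter.Tendsto h Filter.atTop (nhds 0)) {t : ℝ} (ht : 0 ≤ t) :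
    Filter.Tendsto (fun n => (⌊t / h n⌋₊ : ℝ) * h n) Filter.atTop (nhds t) := by
  refine tendsto_of_tendsto_of_tendsto_of_le_of_le (g := fun n => t - h n) (h := fun _ => t) ?_
    tendsto_const_nhds (fun n => ?_) fun n => ?_
  · simpa using hlim.const_sub t
  · have := (div_lt_iff₀ (hh n)).1 (Nat.lt_floor_add_one (t / h n))
    simp only
    linarith
  · exact (le_div_iff₀ (hh n)).1 (Nat.floor_le (div_nonneg ht (hh n).le))

/-- The Gaussian symbol is a limit of characteristic functions of finite jump processes. -/
lemma exists_tendsto_jumpProduct (hA : Continuous A) (hApos : ∀ t, (A t).PosSemidef) {T : ℝ}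
    (hT : 0 < T) : ∃ (K : ℕ → Finset (ℕ × Fin N)) (τ : ℕ → ℕ × Fin N → ℝ)
      (β : ℕ → ℕ × Fin N → RN N), ∀ r t ξ, 0 ≤ r → r ≤ t → t ≤ T →
        Filter.Tendsto (fun n => jumpProduct (K n) (τ n) (β n) r t ξ) Filter.atTop
          (nhds (gaussSymbol A r t ξ)) := by
  -- Exactly n + 1 cells of length h n fill [0, T].
  set h : ℕ → ℝ := fun n => T / (n + 1) with hdef
  have hh : ∀ n, 0 < h n := fun n => by positivity
  have hlim : Filter.Tendsto h Filter.atTop (nhds 0) := by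
    have := (tendsto_one_div_add_atTop_nhds_zero_nat (𝕜 := ℝ)).const_mul T
    simpa [hdef, div_eq_mul_inv] using this
  have hcell : ∀ n k : ℕ, ((k : ℕ) : ℝ) * h n ≤ ((k + 1 : ℕ) : ℝ) * h n := fun n k => by
    have := hh n
    gcongr; simp
  choose β hβ using fun n k => exists_sum_sq_eq_gaussExponent_sub hA hApos (hcell n k)
  refine ⟨fun n => Finset.range (n + 1) ×ˢ Finset.univ, fun n i => ((i.1 + 1 : ℕ) : ℝ) * h n,
    fun n i => β n i.1 i.2, fun r t ξ hr hrt ht => ?_⟩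
  obtain ⟨M, hM⟩ := (isCompact_Icc (a := (0 : ℝ)) (b := T)).exists_bound_of_continuousOn
    (continuous_traceSymbol_left hA ξ).continuousOn
  have hE : Continuous fun s => gaussExponent A s ξ :=
    (continuous_gaussExponent hA).comp (Continuous.prodMk_left ξ)
  have h1 : Filter.Tendsto (fun n => Real.exp (-(gaussExponent A (⌊t / h n⌋₊ * h n) ξ
      - gaussExponent A (⌊r / h n⌋₊ * h n) ξ))) Filter.atTop (nhds (gaussSymbol A r t ξ)) :=
    (Real.continuous_exp.tendsto _).comp (((hE.tendsto t).comp
      (tendsto_floor_mul hh hlim (hr.trans hrt))).sub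
        ((hE.tendsto r).comp (tendsto_floor_mul hh hlim hr))).neg
  have h2 : Filter.Tendsto (fun n => 8 * (M * h n) * gaussExponent A T ξ) Filter.atTop (nhds 0) := by
    simpa using ((hlim.const_mul M).const_mul 8).mul_const (gaussExponent A T ξ)
  have h3 := squeeze_zero_norm (f := fun n => jumpProduct (Finset.range (n + 1) ×ˢ Finset.univ)
      (fun i => ((i.1 + 1 : ℕ) : ℝ) * h n) (fun i => β n i.1 i.2) r t ξ
    - Real.exp (-(gaussExponent A (⌊t / h n⌋₊ * h n) ξ - gaussExponent A (⌊r / h n⌋₊ * h n) ξ)))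
    (fun n => abs_jumpProduct_sub_le hA hApos (hh n) (n := n + 1) (T := T)
    (by rw [hdef]; push_cast; rw [mul_div_cancel₀]; positivity) (hβ n)
    (fun s hs => (Real.le_norm_self _).trans (hM s hs)) hr hrt ht) h2
  simpa using h3.add h1

end JumpLimit

/-! ### Passage to the limit in the estimate. -/

section LimitEstimate

variable {N : ℕ}

open Complex

lemma tendsto_amp {m : ℕ → ℝ → ℝ → RN N → ℝ} {m' : ℝ → ℝ → RN N → ℝ} {f : ℝ → RN N → ℝ} {T : ℝ}
    (hm : ∀ n, IsSymbol (m n)) (hf : IsSource T f) {t : ℝ}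
    (hlim : ∀ r ξ, 0 ≤ r → r ≤ t →
      Filter.Tendsto (fun n => m n r t ξ) Filter.atTop (nhds (m' r t ξ))) (ξ : RN N) :
    Filter.Tendsto (fun n => amp (m n) f t ξ) Filter.atTop (nhds (amp m' f t ξ)) := by
  refine tendsto_integral_of_dominated_convergence (fun r => ‖fhat f r ξ‖)
    (fun n => (integrableOn_symbol_mul (hm n) hf t ξ).aestronglyMeasurable)
    (Integrable.norm (integrableOn_fhat hf 0 t ξ)) (fun n => ?_) ?_
  · filter_upwards [ae_restrict_mem measurableSet_Ioc] with r hr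
    rw [norm_mul, norm_real]
    exact mul_le_of_le_one_left (norm_nonneg _) ((hm n).bound r t ξ hr.2)
  · filter_upwards [ae_restrict_mem measurableSet_Ioc] with r hr
    exact ((continuous_ofReal.tendsto _).comp (hlim r ξ hr.1.le hr.2)).mul_const _

lemma tendsto_hessAmp {m : ℕ → ℝ → ℝ → RN N → ℝ} {m' : ℝ → ℝ → RN N → ℝ} {f : ℝ → RN N → ℝ}
    {T : ℝ} (hm : ∀ n, IsSymbol (m n)) (hf : IsSource T f) (hT : 0 ≤ T) {t : ℝ} (ht : t ≤ T)
    (hlim : ∀ r ξ, 0 ≤ r → r ≤ t →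
      Filter.Tendsto (fun n => m n r t ξ) Filter.atTop (nhds (m' r t ξ))) (x : RN N) :
    Filter.Tendsto (fun n => hessAmp (m n) f t x) Filter.atTop (nhds (hessAmp m' f t x)) := by
  obtain ⟨C, hC0, hC⟩ := hf.exists_hasDecay
  have hd := fun n => hasDecay_amp (hm n) hf hT hC0 hC ht
  refine tendsto_pi_nhds.2 fun i => tendsto_pi_nhds.2 fun j => ?_
  refine (continuous_re.tendsto _).comp (tendsto_integral_of_dominated_convergence
    (fun ξ => 4 * Real.pi ^ 2 * (T * C) * decayWeight ξ) (fun n =>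
      (integrable_wave_mul (integrable_secondSymbol_mul (hd n) i j) x).aestronglyMeasurable)
    (integrable_decayWeight.const_mul _) (fun n => ?_) ?_)
  · refine Filter.Eventually.of_forall fun ξ => ?_
    rw [norm_mul, norm_wave, one_mul]
    exact norm_secondSymbol_mul_le (hd n) i j ξ
  · exact Filter.Eventually.of_forall fun ξ =>
      ((tendsto_amp hm hf hlim ξ).const_mul _).const_mul _

lemma gaussSymbol_add {A A' : ℝ → Matrix (Fin N) (Fin N) ℝ} (hA : Continuous A)
    (hA' : Continuous A') (r t : ℝ) (ξ : RN N) :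
    gaussSymbol (fun t => A t + A' t) r t ξ = gaussSymbol A r t ξ * gaussSymbol A' r t ξ := by
  simp only [gaussSymbol]
  rw [← Real.exp_add, gaussExponent_sub hA, gaussExponent_sub hA',
    gaussExponent_sub (A := fun t => A t + A' t) (hA.add hA')]
  simp only [traceSymbol_add]
  rw [intervalIntegral.integral_add ((continuous_traceSymbol_left hA ξ).intervalIntegrable _ _)
    ((continuous_traceSymbol_left hA' ξ).intervalIntegrable _ _), neg_add]

/-- The estimate persists when a non-negative matrix is added to the diffusion. -/
lemma SymbolEstimate.gaussSymbol_add {T : ℝ} {ν : Seminorm ℝ (Matrix (Fin N) (Fin N) ℝ)}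
    {R : ℝ → Matrix (Fin N) (Fin N) ℝ} {g : ℝ → ℝ} {p : ENNReal} {C : ENNReal}
    {A A' : ℝ → Matrix (Fin N) (Fin N) ℝ} (h : SymbolEstimate T ν R g p C (gaussSymbol A))
    (hA : Continuous A) (hApos : ∀ t, (A t).PosSemidef) (hA' : Continuous A')
    (hApos' : ∀ t, (A' t).PosSemidef) (hp : 1 ≤ p) (hT : 0 < T) (hg : Measurable g)
    (hR : Continuous R) : SymbolEstimate T ν R g p C (gaussSymbol fun t => A t + A' t) := by
  obtain ⟨K, τ, β, hlim⟩ := exists_tendsto_jumpProduct hA' hApos' hT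
  have hn := fun n => h.mul_jumpProduct hp hT.le hg hR (isSymbol_gaussSymbol hA hApos) (K n) (τ n) (β n)
  intro f hf hfp
  have hconv : ∀ᵐ q ∂weightedMeasure N T g, Filter.Tendsto
      (fun n => hessSize ν R (fun r t ξ => gaussSymbol A r t ξ * jumpProduct (K n) (τ n) (β n) r t ξ)
        f q) Filter.atTop (nhds (hessSize ν R (gaussSymbol fun t => A t + A' t) f q)) := by
    filter_upwards [ae_weightedMeasure N T g] with q hq
    have hH : Continuous fun H => ν ((R q.1).transpose * H * R q.1) :=
      (continuous_seminorm_matrix ν).comp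
        ((continuous_const.matrix_mul continuous_id).matrix_mul continuous_const)
    refine (hH.tendsto _).comp (tendsto_hessAmp (fun n => (hn n).1) hf hT.le hq.2.le
      (fun r ξ hr hrt => ?_) q.2)
    rw [_root_.gaussSymbol_add hA hA']
    exact (hlim r q.1 ξ hr hrt hq.2.le).const_mul _
  -- Fatou's lemma: every approximating norm obeys the bound with the same constant, hence so does
  -- the lower limit.
  refine (Lp.eLpNorm_lim_le_liminf_eLpNorm (fun n =>
    (stronglyMeasurable_hessSize hR (hn n).1 hf).aestronglyMeasurable) _ hconv).trans ?_
  refine Filter.liminf_le_of_le (by isBoundedDefault) fun b hb => ?_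
  obtain ⟨n, hbn⟩ := hb.exists
  exact hbn.trans ((hn n).2 f hf hfp)

end LimitEstimate

/-! ### Extension of the data to all times. -/

section Clamping

variable {N : ℕ} {T : ℝ}

lemma ContinuousOn.exists_entry_bound {A : ℝ → Matrix (Fin N) (Fin N) ℝ}
    (hA : ContinuousOn A (Icc 0 T)) : ∃ β, 0 ≤ β ∧ ∀ t ∈ Icc 0 T, ∀ i j, |A t i j| ≤ β := by
  obtain ⟨M, hM⟩ := (isCompact_Icc (a := (0 : ℝ)) (b := T)).exists_bound_of_continuousOn
    (f := fun t i j => A t i j) (continuousOn_pi.2 fun i => continuousOn_pi.2 fun j =>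
      (continuous_id.matrix_elem i j).comp_continuousOn hA)
  refine ⟨|M|, abs_nonneg M, fun t ht i j => ?_⟩
  exact (norm_le_pi_norm (A t i) j).trans ((norm_le_pi_norm (fun i j => A t i j) i).trans
    ((hM t ht).trans (le_abs_self M)))

/-- Cutting a source to zero outside `[0, T]`. -/
noncomputable def cutSource (T : ℝ) (f : ℝ → RN N → ℝ) (t : ℝ) : RN N → ℝ :=
  (Icc 0 T).indicator f t

lemma cutSource_of_mem {f : ℝ → RN N → ℝ} {t : ℝ} (ht : t ∈ Icc 0 T) : cutSource T f t = f t :=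
  indicator_of_mem ht f

lemma cutSource_of_notMem {f : ℝ → RN N → ℝ} {t : ℝ} (ht : t ∉ Icc 0 T) : cutSource T f t = 0 :=
  indicator_of_notMem ht f

lemma MemBb.isSource_cutSource {f : ℝ → RN N → ℝ} (hT : 0 ≤ T) (hf : MemBb T f) :
    IsSource T (cutSource T f) where
  measurable := by
    -- Measurability is known only over [0, T]: times are first projected onto the interval, then
    -- the function is cut off.
    have h1 : Measurable fun q : ℝ × RN N => f (projIcc 0 T hT q.1) q.2 :=
      hf.borel.comp (f := fun q : ℝ × RN N => (projIcc 0 T hT q.1, q.2))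
        ((continuous_projIcc.measurable.comp measurable_fst).prodMk measurable_snd)
    have h2 := h1.indicator (measurable_fst (measurableSet_Icc (a := (0 : ℝ)) (b := T)) :
      MeasurableSet (Prod.fst ⁻¹' Icc 0 T : Set (ℝ × RN N)))
    convert h2 using 1
    funext q
    by_cases hq : q.1 ∈ Icc 0 T
    · rw [cutSource_of_mem hq, indicator_of_mem (by exact hq), projIcc_of_mem hT hq]
    · rw [cutSource_of_notMem hq, indicator_of_notMem (by exact hq), Pi.zero_apply]
  zero := fun t ht => cutSource_of_notMem ht
  smooth := fun t => by
    by_cases ht : t ∈ Icc 0 T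
    · rw [cutSource_of_mem ht]; exact hf.smooth t ht
    · rw [cutSource_of_notMem ht]; exact contDiff_const
  bounded := fun n => by
    obtain ⟨M, hM⟩ := hf.bounded n
    refine ⟨max M 0, fun t z => ?_⟩
    by_cases ht : t ∈ Icc 0 T
    · rw [cutSource_of_mem ht]; exact (hM t ht z).trans (le_max_left _ _)
    · rw [cutSource_of_notMem ht]
      simp
  support := by
    obtain ⟨r, hr⟩ := hf.support
    refine ⟨r, fun t => ?_⟩
    by_cases ht : t ∈ Icc 0 T
    · rw [cutSource_of_mem ht]; exact hr t ht
    · rw [cutSource_of_notMem ht]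
      simp

lemma MemBb.cutSource {f : ℝ → RN N → ℝ} (hT : 0 ≤ T) (hf : MemBb T f) :
    MemBb T (cutSource T f) := by
  refine (hf.isSource_cutSource hT).memBb fun z => ?_
  obtain ⟨F, hF⟩ := hf.piecewise z
  refine ⟨F, fun t ht => (hF t ht).congr (fun s hs => ?_) ?_⟩
  · rw [cutSource_of_mem hs]
  · rw [cutSource_of_mem ht.1]

lemma IsSolution.congr {A A' : ℝ → Matrix (Fin N) (Fin N) ℝ} {f f' v : ℝ → RN N → ℝ}
    (h : IsSolution T A f v) (hT : 0 ≤ T) (hA : ∀ t ∈ Icc 0 T, A t = A' t)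
    (hf : ∀ t ∈ Icc 0 T, f t = f' t) : IsSolution T A' f' v where
  continuous := h.continuous
  bounded := h.bounded
  contDiff := h.contDiff
  integrable := fun z => (h.integrable z).congr fun s hs => by
    rw [uIoc_of_le hT] at hs
    have hs' := Ioc_subset_Icc_self hs
    simp only [hA s hs', hf s hs']
  integral_eq := fun t ht z => by
    rw [h.integral_eq t ht z]
    refine intervalIntegral.integral_congr fun s hs => ?_
    rw [uIcc_of_le ht.1] at hs
    have hs' : s ∈ Icc 0 T := ⟨hs.1, hs.2.trans ht.2⟩
    simp only [hA s hs', hf s hs']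

/-- Bounded classical solutions are unique. -/
lemma IsSolution.unique {A : ℝ → Matrix (Fin N) (Fin N) ℝ} {f w w' : ℝ → RN N → ℝ} (hT : 0 ≤ T)
    (hA : ContinuousOn A (Icc 0 T)) (hApos : ∀ t ∈ Icc 0 T, (A t).PosSemidef)
    (h : IsSolution T A f w) (h' : IsSolution T A f w') : ∀ t ∈ Icc 0 T, w' t = w t := by
  -- Clamping time makes the difference of the solutions and the coefficients satisfy, at all times,
  -- the global hypotheses of the uniqueness lemma.
  set π : ℝ → ℝ := fun t => projIcc 0 T hT t with hπ
  have hπc : Continuous π := continuous_subtype_val.comp continuous_projIcc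
  have hπm : ∀ t, π t ∈ Icc 0 T := fun t => (projIcc 0 T hT t).2
  have hπe : ∀ t ∈ Icc 0 T, π t = t := fun t ht => by simp [hπ, projIcc_of_mem hT ht]
  obtain ⟨β, hβ0, hβ⟩ := hA.exists_entry_bound
  obtain ⟨M, hM⟩ := h.bounded
  obtain ⟨M', hM'⟩ := h'.bounded
  have hmaps : ∀ q : ℝ × RN N, (π q.1, q.2) ∈ Icc (0 : ℝ) T ×ˢ (univ : Set (RN N)) := fun q =>
    ⟨hπm q.1, mem_univ _⟩
  have hpc : Continuous fun q : ℝ × RN N => (π q.1, q.2) := by fun_prop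
  have hhess : ∀ t z, (A (π t) * hessianMatrix (fun x => w' (π t) x + -1 * w (π t) x) z).trace
      = (f (π t) z + (A (π t) * hessianMatrix (w' (π t)) z).trace)
        - (f (π t) z + (A (π t) * hessianMatrix (w (π t)) z).trace) := fun t z => by
    rw [hessianMatrix_add (h'.contDiff _ (hπm t)) (contDiff_const.mul (h.contDiff _ (hπm t))),
      hessianMatrix_const_smul (h.contDiff _ (hπm t))]
    simp only [Matrix.mul_add, Matrix.mul_smul, Matrix.trace_add, Matrix.trace_smul, smul_eq_mul]
    ring
  have key := eq_zero_of_integral_eq (A := fun t => A (π t)) (hA.comp_continuous hπc hπm)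
    (fun t => hApos _ (hπm t)) hβ0 (fun t => hβ _ (hπm t))
    (d := fun t x => w' (π t) x + -1 * w (π t) x)
    ((h'.continuous.comp_continuous hpc hmaps).add
      (continuous_const.mul (h.continuous.comp_continuous hpc hmaps)))
    (M := M' + M) (fun t z => (abs_add_le _ _).trans (add_le_add (hM' _ (hπm t) z) (by
      rw [abs_mul, abs_neg, abs_one, one_mul]; exact hM _ (hπm t) z)))
    (fun t => (h'.contDiff _ (hπm t)).add (contDiff_const.mul (h.contDiff _ (hπm t))))
    (T := T) (fun z => ?_) (fun t ht z => ?_)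
  · intro t ht
    funext z
    have := key t ht z
    simp only [hπe t ht] at this
    linarith
  · simp only [hhess]
    refine ((h'.integrable z).sub (h.integrable z)).congr fun s hs => ?_
    rw [uIoc_of_le hT] at hs
    simp only [hπe s (Ioc_subset_Icc_self hs)]
  · have hsub : uIcc 0 t ⊆ uIcc 0 T := by
      rw [uIcc_of_le ht.1, uIcc_of_le hT]; exact Icc_subset_Icc le_rfl ht.2
    simp only [hhess]
    rw [hπe t ht, h'.integral_eq t ht z, h.integral_eq t ht z, neg_one_mul, ← sub_eq_add_neg,
      ← intervalIntegral.integral_sub ((h'.integrable z).mono_set hsub)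
        ((h.integrable z).mono_set hsub)]
    refine intervalIntegral.integral_congr fun s hs => ?_
    rw [uIcc_of_le ht.1] at hs
    simp only [hπe s ⟨hs.1, hs.2.trans ht.2⟩]

/-- The measure is carried by (0, T), where the clamped and the original data coincide. This
translates between the estimate for solutions and the one for symbols. -/
lemma hessianEstimate_superpose_iff {ν : Seminorm ℝ (Matrix (Fin N) (Fin N) ℝ)}
    {R R' : ℝ → Matrix (Fin N) (Fin N) ℝ} {g : ℝ → ℝ} {p C : ℝ} {m : ℝ → ℝ → RN N → ℝ}
    {f f' : ℝ → RN N → ℝ} (hT : 0 ≤ T) (hm : IsSymbol m) (hf : IsSource T f)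
    (hR : ∀ t ∈ Icc 0 T, R t = R' t) (hff : ∀ t ∈ Icc 0 T, f t = f' t) :
    HessianEstimate T ν R' g p C f' (superpose m f) ↔
      eLpNorm (hessSize ν R m f) (ENNReal.ofReal p) (weightedMeasure N T g) ≤ ENNReal.ofReal C *
        eLpNorm (fun q : ℝ × RN N => f q.1 q.2) (ENNReal.ofReal p) (weightedMeasure N T g) := by
  have e1 : eLpNorm (hessSize ν R m f) (ENNReal.ofReal p) (weightedMeasure N T g) =
      eLpNorm (fun q : ℝ × RN N => ν ((R' q.1).transpose * hessianMatrix (superpose m f q.1) q.2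
        * R' q.1)) (ENNReal.ofReal p) (weightedMeasure N T g) := by
    refine eLpNorm_congr_ae ?_
    filter_upwards [ae_weightedMeasure N T g] with q hq
    rw [hessSize, hessianMatrix_superpose hm hf hT hq.2.le, hR _ (Ioo_subset_Icc_self hq)]
  have e2 : eLpNorm (fun q : ℝ × RN N => f q.1 q.2) (ENNReal.ofReal p) (weightedMeasure N T g) =
      eLpNorm (fun q : ℝ × RN N => f' q.1 q.2) (ENNReal.ofReal p) (weightedMeasure N T g) := by
    refine eLpNorm_congr_ae ?_
    filter_upwards [ae_weightedMeasure N T g] with q hq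
    rw [hff _ (Ioo_subset_Icc_self hq)]
  rw [e1, e2, HessianEstimate]

end Clamping

/-! ### The main theorem. -/

theorem theorem2p2 (N : ℕ) (T : ℝ) (hT : 0 < T)
    (Q Q' : ℝ → Matrix (Fin N) (Fin N) ℝ)
    (hQ : ContinuousOn Q (Icc 0 T)) (hQpos : ∀ t ∈ Icc 0 T, (Q t).PosSemidef)
    (hQ' : ContinuousOn Q' (Icc 0 T)) (hQ'pos : ∀ t ∈ Icc 0 T, (Q' t).PosSemidef)
    (ν : Seminorm ℝ (Matrix (Fin N) (Fin N) ℝ))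
    (R : ℝ → Matrix (Fin N) (Fin N) ℝ) (hR : ContinuousOn R (Icc 0 T))
    (g : ℝ → ℝ) (hg : Measurable g) (hgbdd : ∃ M : ℝ, ∀ t ∈ Icc 0 T, 0 ≤ g t ∧ g t ≤ M)
    (p : ℝ) (hp : 1 < p) (C : ℝ) (hC : 0 < C)
    (hest : ∀ f : ℝ → RN N → ℝ, MemBb T f → ∀ v : ℝ → RN N → ℝ, IsSolution T Q f v →
      HessianEstimate T ν R g p C f v)
    (f : ℝ → RN N → ℝ) (hf : MemBb T f) :
    ∃ w : ℝ → RN N → ℝ, IsSolution T (fun t => Q t + Q' t) f w ∧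
      (∀ w' : ℝ → RN N → ℝ, IsSolution T (fun t => Q t + Q' t) f w' →
        ∀ t ∈ Icc 0 T, w' t = w t) ∧
      HessianEstimate T ν R g p C f w := by
  set π : ℝ → ℝ := fun t => projIcc 0 T hT.le t with hπ
  have hπc : Continuous π := continuous_subtype_val.comp continuous_projIcc
  have hπm : ∀ t, π t ∈ Icc 0 T := fun t => (projIcc 0 T hT.le t).2
  have hπe : ∀ t ∈ Icc 0 T, π t = t := fun t ht => by simp [hπ, projIcc_of_mem hT.le ht]
  have hAc : Continuous fun t => Q (π t) := hQ.comp_continuous hπc hπm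
  have hAc' : Continuous fun t => Q' (π t) := hQ'.comp_continuous hπc hπm
  have hSc : Continuous fun t => Q (π t) + Q' (π t) := hAc.add hAc'
  have hRc : Continuous fun t => R (π t) := hR.comp_continuous hπc hπm
  have hpos : ∀ t, (Q (π t)).PosSemidef := fun t => hQpos _ (hπm t)
  have hpos' : ∀ t, (Q' (π t)).PosSemidef := fun t => hQ'pos _ (hπm t)
  have hsumpos : ∀ t, (Q (π t) + Q' (π t)).PosSemidef := fun t => (hpos t).add (hpos' t)
  obtain ⟨β, hβ0, hβ⟩ := hQ.exists_entry_bound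
  obtain ⟨β', hβ0', hβ'⟩ := (hQ.add hQ').exists_entry_bound
  -- The assumed estimate is used only for the explicit Gaussian solution with Q, so uniqueness for
  -- Q is not needed.
  have hbase : SymbolEstimate T ν (fun t => R (π t)) g (ENNReal.ofReal p) (ENNReal.ofReal C)
      (gaussSymbol fun t => Q (π t)) := fun h hh hhp => by
    rw [← hessianEstimate_superpose_iff hT.le (isSymbol_gaussSymbol hAc hpos) hh
      (R' := R) (f' := h) (fun t ht => by rw [hπe t ht]) fun _ _ => rfl]
    exact hest h hhp _ ((isSolution_superpose_gaussSymbol hAc hpos hβ0 (fun t => hβ _ (hπm t)) hT.le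
      hh).congr hT.le (fun t ht => by rw [hπe t ht]) fun _ _ => rfl)
  have hsum := hbase.gaussSymbol_add hAc hpos hAc' hpos'
    (by rw [← ENNReal.ofReal_one]; exact ENNReal.ofReal_le_ofReal hp.le) hT hg hRc
  have hsrc := hf.isSource_cutSource hT.le
  have hsol : IsSolution T (fun t => Q t + Q' t) f
      (superpose (gaussSymbol fun t => Q (π t) + Q' (π t)) (cutSource T f)) :=
    (isSolution_superpose_gaussSymbol hSc hsumpos hβ0' (fun t => hβ' _ (hπm t)) hT.le
      hsrc).congr hT.le (fun t ht => by rw [hπe t ht]) fun t ht => cutSource_of_mem ht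
  refine ⟨_, hsol, fun w' hw' => hsol.unique hT.le (hQ.add hQ')
    (fun t ht => (hQpos t ht).add (hQ'pos t ht)) hw', ?_⟩
  rw [hessianEstimate_superpose_iff hT.le (isSymbol_gaussSymbol hSc hsumpos) hsrc
    (R := fun t => R (π t)) (fun t ht => by rw [hπe t ht]) fun t ht => cutSource_of_mem ht]
  exact hsum _ hsrc (hf.cutSource hT.le)
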